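/- Let $G\subset \mathrm{GL}_n(\mathbb R)$ be a closed subgroup with Lie algebra $\mathfrak g$. A $G$-structure with connection $(P,\theta,\omega)$ is a manifold $P$ of dimension $n+\dim G$ with a smooth, proper, effective, locally free right $G$-action, a pointwise surjective form $\theta\in\Omega^1(P,\mathbb R^n)$ with $\theta(\tilde\alpha)=0$ and $g^*\theta=g^{-1}\cdot\theta$, and a form $\omega\in\Omega^1(P,\mathfrak g)$ with $\omega(\tilde\alpha)=\alpha$ and $g^*\omega=\mathrm{Ad}_{g^{-1}}\circ\omega$; here $\tilde\alpha$ is the infinitesimal generator of $\alpha\in\mathfrak g$. Then $(\theta,\omega)_p:T_pP\to\mathbb R^n\oplus\mathfrak g$ is an isomorphism for every $p$. The torsion $T(u,v)$ and the curvature $R(u,v)$ at $p$ are the values of $d\theta$ and $d\omega$ on the vectors $(\theta,\omega)_p^{-1}(u,0)$, $(\theta,\omega)_p^{-1}(v,0)$. A local equivalence is a diffeomorphism between open subsets of $P$ preserving $\theta$ and $\omega$; points $p,q$ are equivalent, $p\sim q$, if some local equivalence maps $p$ to $q$; and $I\in C^\infty(P)$ is invariant if it is preserved by all local equivalences. $(P,\theta,\omega)$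 is fully regular of rank $d$ if $\dim\{d_pI : I \text{ invariant}\}=d$ for all $p\in P$. Let $(P,\theta,\omega)$ be fully regular of rank $d$, let $X=P/{\sim}$ with the quotient topology, and let $h:P\to X$ be the quotient map. Then $X$ has a smooth structure of dimension $d$ (possibly non-Hausdorff) for which $h$ is a submersion; fix any such structure. $G$ acts on $X$ by $[p]g=[pg]$; let $\psi:X\times\mathfrak g\to TX$ be the infinitesimal action. There is a unique smooth bundle map $F:X\times\mathbb R^n\to TX$ with $(\mathcal L_{F(u)}f)\circ h=\frac{\partial (f\circ h)}{\partial\theta}(u)$ for all $f\in C^\infty(X)$, $u\in\mathbb R^n$, where $dI=\frac{\partial I}{\partial\theta}\theta+\frac{\partial I}{\partial\omega}\omega$; and the torsion and the curvature descend to unique smooth maps $T:X\to\mathrm{Hom}(\wedge^2\mathbb R^n,\mathbb R^n)$ and $R:X\to\mathrm{Hom}(\wedge^2\mathbb R^n,\mathfrak g)$. Let $A=X\times(\mathbb R^n\oplus\mathfrak g)\to X$ be the trivial bundle, and let $H=(\theta,\omega):TP\to A$, a bundle map covering $h$. There is exactly one Lie algebroid structure $(\rho,[\cdot,\cdot])$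 on $A$, the classifying Lie algebroid of $(P,\theta,\omega)$, such that for the operator $d_A:\Omega^0(A)\to\Omega^1(A)\to\Omega^2(A)$ determined by $H^*d_A=d\,H^*$ one has $$\mathcal L_{\rho(s)}f=\langle s,d_Af\rangle,\qquad \langle[s,t],\eta\rangle=\mathcal L_{\rho(s)}\langle t,\eta\rangle-\mathcal L_{\rho(t)}\langle s,\eta\rangle-d_A\eta(s,t)$$ for all $s,t\in\Gamma(A)$, $f\in C^\infty(X)$, $\eta\in\Omega^1(A)$. Its structure maps are as follows. (i) The anchor is $\rho(u,\alpha)=F(u)+\psi(\alpha)$. (ii) On constant sections $(u,\alpha),(v,\beta)$ the bracket is $$[(u,\alpha),(v,\beta)]=\big(\alpha\cdot v-\beta\cdot u-T(u,v),\ [\alpha,\beta]_{\mathfrak g}-R(u,v)\big).$$ -/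

import Mathlib

open Set Function Topology
open scoped Manifold ContDiff

noncomputable section

/-- The space `ℝᵐ`. -/
abbrev Euc (m : ℕ) : Type := EuclideanSpace ℝ (Fin m)

/-! ### Differential forms of degree one on manifolds -/

section Forms

variable {m : ℕ} {M : Type*} [TopologicalSpace M] [ChartedSpace (Euc m) M]
  [IsManifold (𝓡 m) ∞ M]
  {V : Type*} [NormedAddCommGroup V] [NormedSpace ℝ V]

/-- Smoothness of a `V`-valued 1-form on `M`, seen as a map on the total space of `TM`. -/
def SmoothOneForm (η : (p : M) → TangentSpace (𝓡 m) p →L[ℝ] V) : Prop :=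
  ContMDiff (𝓡 m).tangent 𝓘(ℝ, V) ∞ (fun ξ : TangentBundle (𝓡 m) M => η ξ.proj ξ.snd)

/-- The coordinate expression, in the preferred chart around `p`, of a `V`-valued 1-form. -/
def oneFormInChart (η : (p : M) → TangentSpace (𝓡 m) p →L[ℝ] V) (p : M) (y : Euc m) :
    Euc m →L[ℝ] V :=
  (η ((extChartAt (𝓡 m) p).symm y)).comp
    (mfderiv 𝓘(ℝ, Euc m) (𝓡 m) (extChartAt (𝓡 m) p).symm y)

/-- The exterior derivative `(dη)_p(ξ₁, ξ₂)` of a `V`-valued 1-form, computed in the preferred chart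
around `p`, with the normalisation `dη(ξ₁, ξ₂) = ξ₁ η(ξ₂) - ξ₂ η(ξ₁) - η([ξ₁, ξ₂])`. -/
def extDerivOneForm (η : (p : M) → TangentSpace (𝓡 m) p →L[ℝ] V) (p : M)
    (ξ₁ ξ₂ : TangentSpace (𝓡 m) p) : V :=
  let D : TangentSpace (𝓡 m) p →L[ℝ] Euc m :=
    mfderiv (𝓡 m) 𝓘(ℝ, Euc m) (extChartAt (𝓡 m) p) p
  let η' : Euc m →L[ℝ] Euc m →L[ℝ] V :=
    fderiv ℝ (oneFormInChart η p) (extChartAt (𝓡 m) p p)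
  η' (D ξ₁) (D ξ₂) - η' (D ξ₂) (D ξ₁)

end Forms

/-- The derivative `L_ξ f` of a real function `f` along the tangent vector `ξ` at `p`. -/
def lieDeriv {m : ℕ} {M : Type*} [TopologicalSpace M] [ChartedSpace (Euc m) M] (f : M → ℝ) (p : M)
    (ξ : TangentSpace (𝓡 m) p) : ℝ :=
  mfderiv (𝓡 m) 𝓘(ℝ, ℝ) f p ξ

/-! ### Closed subgroups of `GL(n, ℝ)` -/

section LinearGroup

variable (n k : ℕ) (G : Type*) [TopologicalSpace G] [ChartedSpace (Euc k) G] [Group G]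

/-- A realisation of the `k`-dimensional Lie group `G` as a closed subgroup of `GL(n, ℝ)`. -/
structure ClosedLinearGroup where
  /-- the inclusion of `G` in `GL(n, ℝ)` -/
  toGL : G →* (Euc n →L[ℝ] Euc n)ˣ
  isClosedEmbedding : IsClosedEmbedding toGL
  contMDiff : ContMDiff (𝓡 k) 𝓘(ℝ, Euc n →L[ℝ] Euc n) ∞
    (fun g => (toGL g : Euc n →L[ℝ] Euc n))

variable {n k G}

/-- The action `α · v` of the Lie algebra `𝔤 = T₁G ⊆ 𝔤𝔩(n, ℝ)` on `ℝⁿ`. -/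
def ClosedLinearGroup.lieAct (L : ClosedLinearGroup n k G) (α : GroupLieAlgebra (𝓡 k) G)
    (v : Euc n) : Euc n :=
  (mfderiv (𝓡 k) 𝓘(ℝ, Euc n) (fun g : G => (L.toGL g : Euc n →L[ℝ] Euc n) v) 1 :
    GroupLieAlgebra (𝓡 k) G →L[ℝ] Euc n) α

/-- The adjoint action of `g` on `𝔤 = T₁G`. -/
def adjointAct (g : G) : GroupLieAlgebra (𝓡 k) G →L[ℝ] GroupLieAlgebra (𝓡 k) G :=
  mfderiv (𝓡 k) (𝓡 k) (fun h : G => g * h * g⁻¹) 1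

variable (G) in
/-- The Lie bracket of `𝔤 = T₁G`, where `T₁G` is identified with the model space `ℝᵏ` of `G`. -/
def lieBr (α β : Euc k) : Euc k :=
  @Bracket.bracket (GroupLieAlgebra (𝓡 k) G) (GroupLieAlgebra (𝓡 k) G) _ α β

end LinearGroup

/-! ### Lie algebroids -/

section LieAlgebroids

variable (d : ℕ) (X : Type*) [TopologicalSpace X] [ChartedSpace (Euc d) X]
  [IsManifold (𝓡 d) ∞ X] (W : Type*) [NormedAddCommGroup W] [NormedSpace ℝ W]

/-- Sections of the trivial bundle `X × W → X`: smooth maps `X → W`. -/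
abbrev TrivialSection : Type _ := C^∞⟮𝓡 d, X; 𝓘(ℝ, W), W⟯

/-- A Lie algebroid structure on the trivial vector bundle `X × W → X`. -/
structure TrivialLieAlgebroid where
  /-- the anchor `ρ : X × W → TX` -/
  anchor : (x : X) → W →L[ℝ] TangentSpace (𝓡 d) x
  smooth_anchor : ContMDiff ((𝓡 d).prod 𝓘(ℝ, W)) (𝓡 d).tangent ∞
    (fun q : X × W => (⟨q.1, anchor q.1 q.2⟩ : TangentBundle (𝓡 d) X))
  /-- the bracket of sections -/
  bracket : TrivialSection d X W →ₗ[ℝ] TrivialSection d X W →ₗ[ℝ] TrivialSection d X W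
  bracket_self : ∀ s, bracket s s = 0
  jacobi : ∀ s t r, bracket s (bracket t r) = bracket (bracket s t) r + bracket t (bracket s r)
  leibniz : ∀ (s t : TrivialSection d X W) (f : C^∞⟮𝓡 d, X; 𝓘(ℝ, ℝ), ℝ⟯) (x : X),
    bracket s (f • t) x =
      f x • bracket s t x + lieDeriv f x (anchor x (s x)) • t x

end LieAlgebroids

/-! ### `G`-structures with connection -/

section GStructures

variable {n k : ℕ} {G : Type*} [TopologicalSpace G] [ChartedSpace (Euc k) G] [Group G]

/-- A `G`-structure `(P, θ)`: a manifold `P` of dimension `n + dim G` with a smooth, proper,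
effective and locally free right action of `G`, and a pointwise surjective tensorial 1-form `θ`
with values in `ℝⁿ`. -/
structure GStructure (L : ClosedLinearGroup n k G) (P : Type*) [TopologicalSpace P]
    [ChartedSpace (Euc (n + k)) P] [IsManifold (𝓡 (n + k)) ∞ P] where
  /-- the right action `(p, g) ↦ p g` -/
  act : P → G → P
  act_one : ∀ p, act p 1 = p
  act_mul : ∀ p g h, act p (g * h) = act (act p g) h
  contMDiff_act : ContMDiff ((𝓡 (n + k)).prod (𝓡 k)) (𝓡 (n + k)) ∞
    (fun q : P × G => act q.1 q.2)
  proper : IsProperMap (fun q : P × G => (q.1, act q.1 q.2))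
  effective : ∀ g, (∀ p, act p g = p) → g = 1
  /-- local freeness: the infinitesimal action is injective at every point -/
  locallyFree : ∀ p : P,
    Injective (mfderiv (𝓡 k) (𝓡 (n + k)) (fun g : G => act p g) 1)
  /-- the tautological form -/
  θ : (p : P) → TangentSpace (𝓡 (n + k)) p →L[ℝ] Euc n
  smooth_θ : SmoothOneForm θ
  surjective_θ : ∀ p, Surjective (θ p)
  horizontal : ∀ (p : P) (α : GroupLieAlgebra (𝓡 k) G),
    θ p (mfderiv (𝓡 k) (𝓡 (n + k)) (fun g : G => act p g) 1 α) = 0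
  equivariant_θ : ∀ (g : G) (p : P) (ξ : TangentSpace (𝓡 (n + k)) p),
    θ (act p g) (mfderiv (𝓡 (n + k)) (𝓡 (n + k)) (fun q : P => act q g) p ξ) =
      (L.toGL g⁻¹ : Euc n →L[ℝ] Euc n) (θ p ξ)

/-- A `G`-structure with connection `(P, θ, ω)`. The Lie algebra `𝔤 = T₁G` in which the connection
form `ω` (the field `conn`) takes values is written as the model space `ℝᵏ` of `G`. -/
structure GStructureWithConnection (L : ClosedLinearGroup n k G) (P : Type*) [TopologicalSpace P]
    [ChartedSpace (Euc (n + k)) P] [IsManifold (𝓡 (n + k)) ∞ P] extends GStructure L P where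
  /-- the connection form -/
  conn : (p : P) → TangentSpace (𝓡 (n + k)) p →L[ℝ] Euc k
  smooth_conn : SmoothOneForm conn
  vertical : ∀ (p : P) (α : GroupLieAlgebra (𝓡 k) G),
    conn p (mfderiv (𝓡 k) (𝓡 (n + k)) (fun g : G => act p g) 1 α) = α
  equivariant_conn : ∀ (g : G) (p : P) (ξ : TangentSpace (𝓡 (n + k)) p),
    conn (act p g) (mfderiv (𝓡 (n + k)) (𝓡 (n + k)) (fun q : P => act q g) p ξ) =
      adjointAct g⁻¹ (conn p ξ)

namespace GStructureWithConnection

variable {L : ClosedLinearGroup n k G} {P : Type*} [TopologicalSpace P]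
  [ChartedSpace (Euc (n + k)) P] [IsManifold (𝓡 (n + k)) ∞ P] (S : GStructureWithConnection L P)

/-- The coframe `(θ, ω)_p : T_pP → ℝⁿ ⊕ 𝔤`. -/
def coframe (p : P) : TangentSpace (𝓡 (n + k)) p →L[ℝ] Euc n × Euc k :=
  (S.θ p).prod (S.conn p)

theorem coframe_surjective (p : P) : Surjective (S.coframe p) := by
  rintro ⟨u, α⟩
  obtain ⟨ξ, hξ⟩ := S.surjective_θ p u
  let β : Euc k := α - S.conn p ξ
  let v : TangentSpace (𝓡 (n + k)) p :=
    mfderiv (𝓡 k) (𝓡 (n + k)) (fun g : G => S.act p g) 1 β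
  have h1 : S.θ p v = 0 := S.horizontal p β
  have h2 : S.conn p v = β := S.vertical p β
  refine ⟨ξ + v, ?_⟩
  have e1 : S.θ p (ξ + v) = u := by rw [map_add, h1, hξ, add_zero]
  have e2 : S.conn p (ξ + v) = α := by rw [map_add, h2]; exact add_sub_cancel _ _
  exact Prod.ext e1 e2

theorem coframe_bijective (p : P) : Bijective (S.coframe p) := by
  have hs := S.coframe_surjective p
  let f : Euc (n + k) →ₗ[ℝ] Euc n × Euc k := (S.coframe p).toLinearMap
  have hd : Module.finrank ℝ (Euc (n + k)) = Module.finrank ℝ (Euc n × Euc k) := by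
    simp [Module.finrank_prod]
  exact ⟨(LinearMap.injective_iff_surjective_of_finrank_eq_finrank (f := f) hd).2 hs, hs⟩

/-- The inverse `ℝⁿ ⊕ 𝔤 → T_pP` of the coframe. -/
def frame (p : P) : (Euc n × Euc k) ≃ₗ[ℝ] TangentSpace (𝓡 (n + k)) p :=
  (LinearEquiv.ofBijective (S.coframe p).toLinearMap (S.coframe_bijective p)).symm

/-- The torsion `T(p)(u, v)`: the value of `dθ` on the horizontal lifts of `u` and `v`. -/
def torsion (p : P) (u v : Euc n) : Euc n :=
  extDerivOneForm S.θ p (S.frame p (u, 0)) (S.frame p (v, 0))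

/-- The curvature `R(p)(u, v)`: the value of `dω` on the horizontal lifts of `u` and `v`. -/
def curvature (p : P) (u v : Euc n) : Euc k :=
  extDerivOneForm S.conn p (S.frame p (u, 0)) (S.frame p (v, 0))

/-- The coframe derivative `∂I/∂θ` of a function `I` at `p`, evaluated on `u ∈ ℝⁿ`. -/
def coframeDerivθ (I : P → ℝ) (p : P) (u : Euc n) : ℝ :=
  lieDeriv I p (S.frame p (u, 0))

/-! ### Local equivalences and invariants -/

/-- A local equivalence of `(P, θ, ω)`: a diffeomorphism between open subsets of `P`
that preserves `θ` and `ω` (hence also the infinitesimal generators of the `G`-action). -/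
structure IsLocalEquivalence (Φ : OpenPartialHomeomorph P P) : Prop where
  contMDiffOn : ContMDiffOn (𝓡 (n + k)) (𝓡 (n + k)) ∞ Φ Φ.source
  contMDiffOn_symm : ContMDiffOn (𝓡 (n + k)) (𝓡 (n + k)) ∞ Φ.symm Φ.target
  map_θ : ∀ p ∈ Φ.source, ∀ ξ : TangentSpace (𝓡 (n + k)) p,
    S.θ (Φ p) (mfderiv (𝓡 (n + k)) (𝓡 (n + k)) Φ p ξ) = S.θ p ξ
  map_conn : ∀ p ∈ Φ.source, ∀ ξ : TangentSpace (𝓡 (n + k)) p,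
    S.conn (Φ p) (mfderiv (𝓡 (n + k)) (𝓡 (n + k)) Φ p ξ) = S.conn p ξ

/-- Two points are locally equivalent if a local equivalence takes one to the other. -/
def LocallyEquivalent (p q : P) : Prop :=
  ∃ Φ : OpenPartialHomeomorph P P, S.IsLocalEquivalence Φ ∧ p ∈ Φ.source ∧ Φ p = q

/-- Invariant functions: smooth functions preserved by all local equivalences. -/
structure IsInvariantFunction (I : P → ℝ) : Prop where
  contMDiff : ContMDiff (𝓡 (n + k)) 𝓘(ℝ, ℝ) ∞ I
  invariant : ∀ Φ : OpenPartialHomeomorph P P, S.IsLocalEquivalence Φ →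
    ∀ p ∈ Φ.source, I (Φ p) = I p

/-- The space `{d_p I : I invariant} ⊆ T_p^*P`. -/
def invariantDifferentials (p : P) : Submodule ℝ (TangentSpace (𝓡 (n + k)) p →L[ℝ] ℝ) :=
  Submodule.span ℝ {φ | ∃ I : P → ℝ, S.IsInvariantFunction I ∧
    φ = mfderiv (𝓡 (n + k)) 𝓘(ℝ, ℝ) I p}

/-- `(P, θ, ω)` is fully regular of rank `d`. -/
def IsFullyRegular (d : ℕ) : Prop :=
  ∀ p, Module.finrank ℝ (S.invariantDifferentials p) = d

theorem contMDiff_act_right (g : G) :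
    ContMDiff (𝓡 (n + k)) (𝓡 (n + k)) ∞ (fun p : P => S.act p g) :=
  S.contMDiff_act.comp (contMDiff_id.prodMk contMDiff_const)

theorem mdifferentiableAt_act_right (g : G) (p : P) :
    MDifferentiableAt (𝓡 (n + k)) (𝓡 (n + k)) (fun p : P => S.act p g) p :=
  (S.contMDiff_act_right g).contMDiffAt.mdifferentiableAt (by simp)

/-- Right translation by `g` on `P`. -/
def actHomeo (g : G) : P ≃ₜ P where
  toFun p := S.act p g
  invFun p := S.act p g⁻¹
  left_inv p := by simp only [← S.act_mul, mul_inv_cancel, S.act_one]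
  right_inv p := by simp only [← S.act_mul, inv_mul_cancel, S.act_one]
  continuous_toFun := (S.contMDiff_act_right g).continuous
  continuous_invFun := (S.contMDiff_act_right g⁻¹).continuous

theorem mfderiv_act_surjective (g : G) (q : P) :
    Surjective (mfderiv (𝓡 (n + k)) (𝓡 (n + k)) (fun p : P => S.act p g) q) := by
  have hid : (fun p : P => S.act p g⁻¹) ∘ (fun p : P => S.act p g) = id := by
    funext p; exact (S.actHomeo g).left_inv p
  have hc := mfderiv_comp q (S.mdifferentiableAt_act_right g⁻¹ (S.act q g))
    (S.mdifferentiableAt_act_right g q)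
  rw [hid, mfderiv_id] at hc
  let f : Euc (n + k) →ₗ[ℝ] Euc (n + k) :=
    (mfderiv (𝓡 (n + k)) (𝓡 (n + k)) (fun p : P => S.act p g) q).toLinearMap
  refine (LinearMap.injective_iff_surjective (f := f)).1 ?_
  intro x y hxy
  have hx := congrArg (fun T => T x) hc
  have hy := congrArg (fun T => T y) hc
  have h2 : (mfderiv (𝓡 (n + k)) (𝓡 (n + k)) (fun p : P => S.act p g) q) x =
    (mfderiv (𝓡 (n + k)) (𝓡 (n + k)) (fun p : P => S.act p g) q) y := hxy
  exact hx.trans ((congrArg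
    (mfderiv (𝓡 (n + k)) (𝓡 (n + k)) (fun p : P => S.act p g⁻¹) (S.act q g)) h2).trans hy.symm)

variable {S}

theorem IsLocalEquivalence.mdifferentiableAt {Φ : OpenPartialHomeomorph P P}
    (hΦ : S.IsLocalEquivalence Φ) {p : P} (hp : p ∈ Φ.source) :
    MDifferentiableAt (𝓡 (n + k)) (𝓡 (n + k)) Φ p :=
  (hΦ.contMDiffOn.contMDiffAt (Φ.open_source.mem_nhds hp)).mdifferentiableAt (by simp)

theorem IsLocalEquivalence.refl : S.IsLocalEquivalence (OpenPartialHomeomorph.refl P) := by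
  have h (p : P) : mfderiv (𝓡 (n + k)) (𝓡 (n + k)) (OpenPartialHomeomorph.refl P) p =
    ContinuousLinearMap.id ℝ _ := mfderiv_id
  refine ⟨contMDiff_id.contMDiffOn, contMDiff_id.contMDiffOn, ?_, ?_⟩ <;>
  · intro p _ ξ
    rw [h]; rfl

theorem IsLocalEquivalence.symm {Φ : OpenPartialHomeomorph P P} (hΦ : S.IsLocalEquivalence Φ) :
    S.IsLocalEquivalence Φ.symm := by
  have key : ∀ p ∈ Φ.source, ∀ ξ : TangentSpace (𝓡 (n + k)) (Φ p),
      mfderiv (𝓡 (n + k)) (𝓡 (n + k)) Φ p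
        (mfderiv (𝓡 (n + k)) (𝓡 (n + k)) Φ.symm (Φ p) ξ) = ξ := by
    intro p hp ξ
    have hq : Φ p ∈ Φ.target := Φ.map_source hp
    have hs : MDifferentiableAt (𝓡 (n + k)) (𝓡 (n + k)) Φ.symm (Φ p) :=
      (hΦ.contMDiffOn_symm.contMDiffAt (Φ.open_target.mem_nhds hq)).mdifferentiableAt (by simp)
    have hd : MDifferentiableAt (𝓡 (n + k)) (𝓡 (n + k)) Φ (Φ.symm (Φ p)) :=
      hΦ.mdifferentiableAt (Φ.map_target hq)
    have hc := mfderiv_comp (Φ p) hd hs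
    have he : (Φ ∘ Φ.symm) =ᶠ[𝓝 (Φ p)] id := by
      filter_upwards [Φ.open_target.mem_nhds hq] with y hy using Φ.right_inv hy
    rw [he.mfderiv_eq, mfderiv_id] at hc
    let D : P → (Euc (n + k) →L[ℝ] Euc (n + k)) :=
      fun q => mfderiv (𝓡 (n + k)) (𝓡 (n + k)) Φ q
    have hD : D (Φ.symm (Φ p)) = D p := by rw [Φ.left_inv hp]
    have h1 := congrArg (fun T => T ξ) hc
    have h2 := congrArg
      (fun T => T (mfderiv (𝓡 (n + k)) (𝓡 (n + k)) Φ.symm (Φ p) ξ)) hD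
    exact h2.symm.trans h1.symm
  refine ⟨hΦ.contMDiffOn_symm, by simpa using hΦ.contMDiffOn, ?_, ?_⟩
  · intro q hq ξ
    obtain ⟨p, hp, rfl⟩ : ∃ p ∈ Φ.source, Φ p = q :=
      ⟨Φ.symm q, Φ.map_target hq, Φ.right_inv hq⟩
    have := hΦ.map_θ p hp (mfderiv (𝓡 (n + k)) (𝓡 (n + k)) Φ.symm (Φ p) ξ)
    rw [key p hp ξ] at this
    rw [this, Φ.left_inv hp]
  · intro q hq ξ
    obtain ⟨p, hp, rfl⟩ : ∃ p ∈ Φ.source, Φ p = q :=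
      ⟨Φ.symm q, Φ.map_target hq, Φ.right_inv hq⟩
    have := hΦ.map_conn p hp (mfderiv (𝓡 (n + k)) (𝓡 (n + k)) Φ.symm (Φ p) ξ)
    rw [key p hp ξ] at this
    rw [this, Φ.left_inv hp]

theorem IsLocalEquivalence.trans {Φ Ψ : OpenPartialHomeomorph P P}
    (hΦ : S.IsLocalEquivalence Φ) (hΨ : S.IsLocalEquivalence Ψ) :
    S.IsLocalEquivalence (Φ.trans Ψ) := by
  have key : ∀ p ∈ (Φ.trans Ψ).source, ∀ ξ : TangentSpace (𝓡 (n + k)) p,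
      mfderiv (𝓡 (n + k)) (𝓡 (n + k)) (Φ.trans Ψ) p ξ =
        mfderiv (𝓡 (n + k)) (𝓡 (n + k)) Ψ (Φ p)
          (mfderiv (𝓡 (n + k)) (𝓡 (n + k)) Φ p ξ) := by
    intro p hp ξ
    rw [OpenPartialHomeomorph.trans_source] at hp
    have := mfderiv_comp p (hΨ.mdifferentiableAt hp.2) (hΦ.mdifferentiableAt hp.1)
    exact congrArg (fun T => T ξ) this
  refine ⟨?_, ?_, ?_, ?_⟩
  · rw [OpenPartialHomeomorph.trans_source]
    exact hΨ.contMDiffOn.comp' hΦ.contMDiffOn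
  · rw [OpenPartialHomeomorph.trans_target]
    exact hΦ.contMDiffOn_symm.comp' hΨ.contMDiffOn_symm
  · intro p hp ξ
    have hp' := hp
    rw [OpenPartialHomeomorph.trans_source] at hp'
    rw [key p hp ξ]
    exact (hΨ.map_θ _ hp'.2 _).trans (hΦ.map_θ _ hp'.1 _)
  · intro p hp ξ
    have hp' := hp
    rw [OpenPartialHomeomorph.trans_source] at hp'
    rw [key p hp ξ]
    exact (hΨ.map_conn _ hp'.2 _).trans (hΦ.map_conn _ hp'.1 _)

/-- Conjugating a local equivalence by a right translation gives a local equivalence. -/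
theorem IsLocalEquivalence.conj {Φ : OpenPartialHomeomorph P P}
    (hΦ : S.IsLocalEquivalence Φ) (g : G) :
    S.IsLocalEquivalence (((S.actHomeo g).symm.toOpenPartialHomeomorph.trans Φ).trans
      (S.actHomeo g).toOpenPartialHomeomorph) := by
  set Ψ := ((S.actHomeo g).symm.toOpenPartialHomeomorph.trans Φ).trans
      (S.actHomeo g).toOpenPartialHomeomorph with hΨ
  have hsrc : Ψ.source = (fun p => S.act p g⁻¹) ⁻¹' Φ.source := by
    ext p; simp [hΨ]; rfl
  have htgt : Ψ.target = (fun p => S.act p g⁻¹) ⁻¹' Φ.target := by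
    ext p; simp [hΨ]; rfl
  have hfun : ∀ p, Ψ p = S.act (Φ (S.act p g⁻¹)) g := fun p => rfl
  have hinv : ∀ p, Ψ.symm p = S.act (Φ.symm (S.act p g⁻¹)) g := fun p => rfl
  have hsm : ContMDiffOn (𝓡 (n + k)) (𝓡 (n + k)) ∞ Ψ Ψ.source := by
    rw [hsrc]
    exact (S.contMDiff_act_right g).comp_contMDiffOn
      (hΦ.contMDiffOn.comp (S.contMDiff_act_right g⁻¹).contMDiffOn fun p hp => hp)
  have hcancel : ∀ q, S.act (S.act q g) g⁻¹ = q := (S.actHomeo g).left_inv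
  have key : ∀ q ∈ Φ.source, ∀ ζ : TangentSpace (𝓡 (n + k)) q,
      mfderiv (𝓡 (n + k)) (𝓡 (n + k)) Ψ (S.act q g)
        (mfderiv (𝓡 (n + k)) (𝓡 (n + k)) (fun p : P => S.act p g) q ζ) =
      mfderiv (𝓡 (n + k)) (𝓡 (n + k)) (fun p : P => S.act p g) (Φ q)
        (mfderiv (𝓡 (n + k)) (𝓡 (n + k)) Φ q ζ) := by
    intro q hq ζ
    have hq' : S.act q g ∈ Ψ.source := by rw [hsrc]; simpa [hcancel] using hq
    have hd : MDifferentiableAt (𝓡 (n + k)) (𝓡 (n + k)) Ψ (S.act q g) :=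
      (hsm.contMDiffAt (Ψ.open_source.mem_nhds hq')).mdifferentiableAt (by simp)
    have h1 := mfderiv_comp q hd (S.mdifferentiableAt_act_right g q)
    have h2 := mfderiv_comp q (S.mdifferentiableAt_act_right g (Φ q)) (hΦ.mdifferentiableAt hq)
    have he : Ψ ∘ (fun p : P => S.act p g) = (fun p : P => S.act p g) ∘ Φ := by
      funext p
      simp only [comp_apply, hfun, hcancel]
    rw [he, h2] at h1
    exact (congrArg (fun T => T ζ) h1).symm
  have hval : ∀ q, Ψ (S.act q g) = S.act (Φ q) g := fun q => by rw [hfun, hcancel]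
  refine ⟨hsm, ?_, ?_, ?_⟩
  · rw [htgt]
    exact (S.contMDiff_act_right g).comp_contMDiffOn
      (hΦ.contMDiffOn_symm.comp (S.contMDiff_act_right g⁻¹).contMDiffOn fun p hp => hp)
  · intro p hp ξ
    obtain ⟨q, rfl⟩ : ∃ q, S.act q g = p := ⟨_, (S.actHomeo g).right_inv p⟩
    have hq : q ∈ Φ.source := by rw [hsrc] at hp; simpa [hcancel] using hp
    obtain ⟨ζ, rfl⟩ := S.mfderiv_act_surjective g q ξ
    rw [key q hq ζ, S.equivariant_θ, hval, S.equivariant_θ, hΦ.map_θ q hq]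
  · intro p hp ξ
    obtain ⟨q, rfl⟩ : ∃ q, S.act q g = p := ⟨_, (S.actHomeo g).right_inv p⟩
    have hq : q ∈ Φ.source := by rw [hsrc] at hp; simpa [hcancel] using hp
    obtain ⟨ζ, rfl⟩ := S.mfderiv_act_surjective g q ξ
    rw [key q hq ζ, S.equivariant_conn, hval, S.equivariant_conn, hΦ.map_conn q hq]

variable (S)

/-- Local equivalence of points is an equivalence relation. -/
def localEquivalenceSetoid : Setoid P where
  r := S.LocallyEquivalent
  iseqv :=
    { refl := fun _ => ⟨_, IsLocalEquivalence.refl, mem_univ _, rfl⟩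
      symm := by
        rintro p q ⟨Φ, hΦ, hp, rfl⟩
        exact ⟨Φ.symm, hΦ.symm, Φ.map_source hp, Φ.left_inv hp⟩
      trans := by
        rintro p q r ⟨Φ, hΦ, hp, rfl⟩ ⟨Ψ, hΨ, hq, rfl⟩
        exact ⟨Φ.trans Ψ, hΦ.trans hΨ, by simpa using ⟨hp, hq⟩, rfl⟩ }

/-- The quotient `X = P/∼` of `P` by local equivalence, with the quotient topology. -/
abbrev ClassifyingSpace : Type _ := Quotient S.localEquivalenceSetoid

/-- The classifying map `h : P → X`. -/
def classifyingMap (p : P) : S.ClassifyingSpace := Quotient.mk S.localEquivalenceSetoid p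

/-- The right action of `G` on `X`, given by `[p] g = [p g]`. -/
def classifyingAct (x : S.ClassifyingSpace) (g : G) : S.ClassifyingSpace :=
  Quotient.map (fun p => S.act p g) (by
    rintro p q ⟨Φ, hΦ, hp, rfl⟩
    have hc : S.act (S.act p g) g⁻¹ = p := (S.actHomeo g).left_inv p
    refine ⟨_, hΦ.conj g, ?_, ?_⟩
    · have : S.act (S.act p g) g⁻¹ ∈ Φ.source := by rw [hc]; exact hp
      simpa using! this
    · change S.act (Φ (S.act (S.act p g) g⁻¹)) g = _
      rw [hc]) x


/-- The infinitesimal `G`-action `ψ(α)` on `X` as a bundle map `X × 𝔤 → TX`: the derivative at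
`g = 1` of `g ↦ x g`, applied to `α`. -/
def infAct {d : ℕ} [ChartedSpace (Euc d) S.ClassifyingSpace] (x : S.ClassifyingSpace) :
    Euc k →L[ℝ] TangentSpace (𝓡 d) x :=
  mfderiv (𝓡 k) (𝓡 d) (fun g : G => S.classifyingAct x g) 1

section ClassifyingAlgebroid

variable (d : ℕ) [ChartedSpace (Euc d) S.ClassifyingSpace]
  [IsManifold (𝓡 d) ∞ S.ClassifyingSpace]

/-- `F : X × ℝⁿ → TX` is the bundle map given by the coframe derivative `∂/∂θ`. -/
structure IsCoframeField (F : (x : S.ClassifyingSpace) → Euc n →L[ℝ] TangentSpace (𝓡 d) x) :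
    Prop where
  smooth : ContMDiff ((𝓡 d).prod 𝓘(ℝ, Euc n)) (𝓡 d).tangent ∞
    (fun q : S.ClassifyingSpace × Euc n => (⟨q.1, F q.1 q.2⟩ : TangentBundle (𝓡 d) _))
  deriv_eq : ∀ (f : C^∞⟮𝓡 d, S.ClassifyingSpace; 𝓘(ℝ, ℝ), ℝ⟯) (p : P) (u : Euc n),
    lieDeriv f (S.classifyingMap p) (F (S.classifyingMap p) u) =
      S.coframeDerivθ (f ∘ S.classifyingMap) p u

/-- `T : X → Hom(Λ²ℝⁿ, ℝⁿ)` is the map induced by the torsion of the connection. -/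
structure IsInducedTorsion (T : S.ClassifyingSpace → Euc n [⋀^Fin 2]→L[ℝ] Euc n) : Prop where
  smooth : ContMDiff (𝓡 d) 𝓘(ℝ, Euc n [⋀^Fin 2]→L[ℝ] Euc n) ∞ T
  apply : ∀ (p : P) (u v : Euc n), T (S.classifyingMap p) ![u, v] = S.torsion p u v

/-- `R : X → Hom(Λ²ℝⁿ, 𝔤)` is the map induced by the curvature of the connection. -/
structure IsInducedCurvature (R : S.ClassifyingSpace → Euc n [⋀^Fin 2]→L[ℝ] Euc k) : Prop where
  smooth : ContMDiff (𝓡 d) 𝓘(ℝ, Euc n [⋀^Fin 2]→L[ℝ] Euc k) ∞ R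
  apply : ∀ (p : P) (u v : Euc n), R (S.classifyingMap p) ![u, v] = S.curvature p u v

/-- `Ω⁰(A) = C^∞(X)` for the trivial bundle `A = X × (ℝⁿ ⊕ 𝔤)`. -/
abbrev ZeroForm : Type _ := C^∞⟮𝓡 d, S.ClassifyingSpace; 𝓘(ℝ, ℝ), ℝ⟯

/-- `Ω¹(A)`, the sections of `A*`. -/
abbrev OneForm : Type _ :=
  C^∞⟮𝓡 d, S.ClassifyingSpace;
    𝓘(ℝ, (Euc n × Euc k) →L[ℝ] ℝ), (Euc n × Euc k) →L[ℝ] ℝ⟯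

/-- `Ω²(A)`, the sections of `Λ²A*`. -/
abbrev TwoForm : Type _ :=
  C^∞⟮𝓡 d, S.ClassifyingSpace;
    𝓘(ℝ, (Euc n × Euc k) [⋀^Fin 2]→L[ℝ] ℝ), (Euc n × Euc k) [⋀^Fin 2]→L[ℝ] ℝ⟯

/-- The pullback `H^*η` of `η ∈ Ω¹(A)` along the bundle map `H = (θ, ω) : TP → A` over `h`. -/
def pullbackOneForm (η : S.OneForm d) (p : P) : TangentSpace (𝓡 (n + k)) p →L[ℝ] ℝ :=
  (η (S.classifyingMap p)).comp (S.coframe p)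

/-- The operator `d_A : Ω⁰(A) → Ω¹(A) → Ω²(A)` characterised by `H^* d_A = d H^*`. -/
structure AlgebroidDifferential where
  /-- `d_A` on `Ω⁰(A)` -/
  d₀ : S.ZeroForm d → S.OneForm d
  /-- `d_A` on `Ω¹(A)` -/
  d₁ : S.OneForm d → S.TwoForm d
  pullback_d₀ : ∀ (f : S.ZeroForm d) (p : P) (ξ : TangentSpace (𝓡 (n + k)) p),
    S.pullbackOneForm d (d₀ f) p ξ =
      lieDeriv (f ∘ S.classifyingMap) p ξ
  pullback_d₁ : ∀ (η : S.OneForm d) (p : P) (ξ₁ ξ₂ : TangentSpace (𝓡 (n + k)) p),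
    d₁ η (S.classifyingMap p) ![S.coframe p ξ₁, S.coframe p ξ₂] =
      extDerivOneForm (S.pullbackOneForm d η) p ξ₁ ξ₂

/-- The Lie algebroid structure `A` on `X × (ℝⁿ ⊕ 𝔤)` is that of the classifying Lie algebroid:
for the operator `d_A` one has `L_{ρ(s)} f = ⟨s, d_A f⟩` and
`⟨[s, t], η⟩ = L_{ρ(s)} ⟨t, η⟩ - L_{ρ(t)} ⟨s, η⟩ - d_A η (s, t)`. -/
def IsClassifyingAlgebroid
    (A : TrivialLieAlgebroid d S.ClassifyingSpace (Euc n × Euc k)) : Prop :=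
  ∃ D : S.AlgebroidDifferential d,
    (∀ (s : TrivialSection d S.ClassifyingSpace (Euc n × Euc k)) (f : S.ZeroForm d)
        (x : S.ClassifyingSpace),
      lieDeriv f x (A.anchor x (s x)) = D.d₀ f x (s x)) ∧
    ∀ (s t : TrivialSection d S.ClassifyingSpace (Euc n × Euc k)) (η : S.OneForm d)
        (x : S.ClassifyingSpace),
      η x (A.bracket s t x) =
        lieDeriv (fun y => η y (t y)) x (A.anchor x (s x)) -
        lieDeriv (fun y => η y (s y)) x (A.anchor x (t x)) -
        D.d₁ η x ![s x, t x]

/-- The constant section `(u, α)` of `X × (ℝⁿ ⊕ 𝔤)`. -/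
def constSection (u : Euc n) (α : Euc k) :
    TrivialSection d S.ClassifyingSpace (Euc n × Euc k) :=
  ⟨fun _ => (u, α), contMDiff_const⟩

end ClassifyingAlgebroid

end GStructureWithConnection

end GStructures
end

/-! The coframe (θ, ω) trivialises TP. Through `frame`, vector fields on P become functions P → ℝⁿ ⊕
𝔤, and their Lie bracket becomes `frameBracket`. A local equivalence preserves the coframe, hence
carries each constant-coefficient frame field to itself. So coframe derivatives of invariants, and
brackets of fields with invariant coefficients, are again invariant, and invariant objects descend
to X = P/∼.

The substantial point is the smooth structure of X. Near a point, d invariants with independent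
differentials form a submersion I to ℝᵈ. By full regularity every other invariant is locally a
function of I (`InvariantBox.apply_sec_inv`), in particular the structure functions of the coframe
and the coframe derivatives of I. Cartan's local equivalence theorem
(`exists_openPartialHomeomorph_coframe`) then makes points of a box with equal I equivalent: the
equation DΦ = η(Φ)⁻¹η for maps preserving a coframe η is integrable where I(x) = I(Φ(x)), and this
condition propagates along its solutions. The equation is solved by ODEs along rays, and a Grönwall
estimate shows that the ray solutions form a differentiable map (`exists_hasFDerivAt_total`). Hence
I induces charts of X (`InvariantBox.quotientChart`).

For any smooth structure making h a submersion, smoothness descends along h. The anchor dh ∘ frame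
and the bracket of frame fields therefore live on X. The Lie algebroid axioms are identities for
vector fields on P, and compatibility with d_A is Cartan's formula for d(H^*η). Uniqueness follows
because h is surjective, H is fibrewise bijective, and global invariants separate tangent vectors of
X (`tangentSpace_ext`).

For the explicit formulas, dh ∘ frame is F on (u, 0), and on (0, α) it is dh of the infinitesimal
generator, which is ψ(α). Constant frame fields bracket as follows: horizontal pairs give -T and -R
by Cartan's formula; vertical pairs give the bracket of 𝔤, because orbit maps relate left-invariant
fields to generators; a mixed pair gives α · v, by differentiating the equivariance of the coframe
(`frameBracket_vertical_horizontal`). -/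

noncomputable section

/-! ### Total differential equations -/

section TotalDE

open Metric

variable {E E' F : Type*} [NormedAddCommGroup E] [NormedSpace ℝ E] [NormedAddCommGroup E']
  [NormedSpace ℝ E'] [NormedAddCommGroup F] [NormedSpace ℝ F]

/-- Grönwall's inequality with zero initial value. It is used with ε of order ‖v‖ or ‖v‖² for
variation estimates, and with ε = 0 to show that a quantity vanishes identically. -/
theorem norm_le_mul_exp_of_deriv_bound {f f' : ℝ → E} {K ε : ℝ} (hK : 0 < K) (hε : 0 ≤ ε)
    (h0 : f 0 = 0) (hf : ∀ s ∈ Icc (0 : ℝ) 1, HasDerivWithinAt f (f' s) (Icc 0 1) s)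
    (hb : ∀ s ∈ Icc (0 : ℝ) 1, ‖f' s‖ ≤ K * ‖f s‖ + ε) {s : ℝ} (hs : s ∈ Icc (0 : ℝ) 1) :
    ‖f s‖ ≤ ε * (Real.exp K / K) := by
  have h := norm_le_gronwallBound_of_norm_deriv_right_le (f := f) (f' := f') (δ := 0) (K := K)
    (ε := ε) (a := 0) (b := 1) (fun s hs => (hf s hs).continuousWithinAt)
    (fun s hs => (hf s (Ico_subset_Icc_self hs)).mono_of_mem_nhdsWithin
      (Icc_mem_nhdsGE_of_mem hs)) (by simp [h0]) (fun s hs => hb s (Ico_subset_Icc_self hs)) s hs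
  refine h.trans ?_
  rw [gronwallBound_of_K_ne_0 hK.ne']
  have h1 : Real.exp (K * (s - 0)) - 1 ≤ Real.exp K := by
    have : Real.exp (K * (s - 0)) ≤ Real.exp K := by
      apply Real.exp_le_exp.2
      nlinarith [hs.2]
    linarith
  calc 0 * Real.exp (K * (s - 0)) + ε / K * (Real.exp (K * (s - 0)) - 1)
      ≤ 0 + ε / K * Real.exp K := by
        rw [zero_mul]; gcongr
    _ = ε * (Real.exp K / K) := by ring

/-- First variation of the solutions along rays of the total differential equation
`DΦ(x) = U(x, Φ(x))`, under the integrability condition along the reference ray. -/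
theorem norm_ray_variation_le {U : E × E' → E →L[ℝ] E'} {a : E} {b : E'} {ρ M L₁ L₂ : ℝ}
    (hM : 0 ≤ M) (hL₁ : 0 ≤ L₁) (hL₂ : 0 ≤ L₂)
    (hd : ∀ p ∈ closedBall (a, b) ρ, DifferentiableAt ℝ U p)
    (hUM : ∀ p ∈ closedBall (a, b) ρ, ‖U p‖ ≤ M)
    (hUL : ∀ p ∈ closedBall (a, b) ρ, ‖fderiv ℝ U p‖ ≤ L₁)
    (hUL₂ : ∀ p ∈ closedBall (a, b) ρ, ∀ q ∈ closedBall (a, b) ρ,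
      ‖fderiv ℝ U p - fderiv ℝ U q‖ ≤ L₂ * ‖p - q‖) :
    ∃ C : ℝ, ∀ (h v : E) (y z : ℝ → E'), ‖h‖ ≤ 1 → ‖h + v‖ ≤ 1 → y 0 = b → z 0 = b →
      (∀ s ∈ Icc (0 : ℝ) 1, (a + s • h, y s) ∈ closedBall (a, b) ρ) →
      (∀ s ∈ Icc (0 : ℝ) 1, (a + s • (h + v), z s) ∈ closedBall (a, b) ρ) →
      (∀ s ∈ Icc (0 : ℝ) 1, HasDerivWithinAt y (U (a + s • h, y s) h) (Icc 0 1) s) →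
      (∀ s ∈ Icc (0 : ℝ) 1,
        HasDerivWithinAt z (U (a + s • (h + v), z s) (h + v)) (Icc 0 1) s) →
      (∀ s ∈ Icc (0 : ℝ) 1,
        fderiv ℝ U (a + s • h, y s) (v, U (a + s • h, y s) v) h =
        fderiv ℝ U (a + s • h, y s) (h, U (a + s • h, y s) h) v) →
      ‖z 1 - y 1 - U (a + h, y 1) v‖ ≤ C * ‖v‖ ^ 2 := by
  set K := L₁ + 1 with hKdef
  have hK : 0 < K := by positivity
  set κ := Real.exp K / K with hκ
  have hκ0 : 0 ≤ κ := by positivity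
  -- `C₂ * ‖v‖` bounds both components of the increment (s v, z - y): the summand 1 serves the
  -- first, the Grönwall constant of the first-order estimate the second.
  set C₂ := 1 + (L₁ + M) * κ with hC₂
  have hC₂0 : 0 ≤ C₂ := by positivity
  refine ⟨(L₁ * C₂ + L₂ * C₂ ^ 2) * κ, ?_⟩
  intro h v y z hh hhv hy0 hz0 hyB hzB hy hz hint
  have hconv : Convex ℝ (closedBall (a, b) ρ) := convex_closedBall _ _
  have hdiff : ∀ s : ℝ, ((a + s • (h + v), z s) - (a + s • h, y s) : E × E') =
      (s • v, z s - y s) := by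
    intro s; ext <;> simp
  -- first order estimate
  have hδ : ∀ s ∈ Icc (0 : ℝ) 1, ‖z s - y s‖ ≤ ((L₁ + M) * ‖v‖) * κ := by
    intro s hs
    refine norm_le_mul_exp_of_deriv_bound (f := fun s => z s - y s) hK (by positivity)
      (by simp [hy0, hz0]) (fun s hs => (hz s hs).sub (hy s hs)) ?_ hs
    intro s hs
    have e : U (a + s • (h + v), z s) (h + v) - U (a + s • h, y s) h =
        (U (a + s • (h + v), z s) - U (a + s • h, y s)) (h + v) + U (a + s • h, y s) v := by
      simp only [sub_apply, map_add]; abel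
    have e1 : ‖U (a + s • (h + v), z s) - U (a + s • h, y s)‖ ≤
        L₁ * ‖((s • v, z s - y s) : E × E')‖ := by
      rw [← hdiff]
      exact hconv.norm_image_sub_le_of_norm_fderiv_le hd hUL (hyB s hs) (hzB s hs)
    have e2 : ‖((s • v, z s - y s) : E × E')‖ ≤ ‖v‖ + ‖z s - y s‖ := by
      rw [Prod.norm_def]
      refine max_le ?_ (by simp)
      rw [norm_smul, Real.norm_of_nonneg hs.1]
      nlinarith [hs.2, norm_nonneg v, norm_nonneg (z s - y s)]
    show ‖U (a + s • (h + v), z s) (h + v) - U (a + s • h, y s) h‖ ≤ _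
    rw [e]
    calc _ ≤ ‖U (a + s • (h + v), z s) - U (a + s • h, y s)‖ * ‖h + v‖ +
          ‖U (a + s • h, y s)‖ * ‖v‖ :=
          (norm_add_le _ _).trans (add_le_add (ContinuousLinearMap.le_opNorm _ _)
            (ContinuousLinearMap.le_opNorm _ _))
      _ ≤ (L₁ * (‖v‖ + ‖z s - y s‖)) * 1 + M * ‖v‖ := by
          gcongr
          · exact e1.trans (by gcongr)
          · exact hUM _ (hyB s hs)
      _ ≤ K * ‖z s - y s‖ + (L₁ + M) * ‖v‖ := by
          have := norm_nonneg (z s - y s)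
          rw [hKdef]; nlinarith
  -- second order estimate
  let w : ℝ → E' := fun s => z s - y s - s • U (a + s • h, y s) v
  let w' : ℝ → E' := fun s => (U (a + s • (h + v), z s) (h + v) - U (a + s • h, y s) h) -
    (s • (fderiv ℝ U (a + s • h, y s) (h, U (a + s • h, y s) h)) v + (1 : ℝ) •
      U (a + s • h, y s) v)
  have hw : ∀ s ∈ Icc (0 : ℝ) 1, HasDerivWithinAt w (w' s) (Icc 0 1) s := by
    intro s hs
    refine ((hz s hs).sub (hy s hs)).sub ?_
    have h1 : HasDerivWithinAt (fun s : ℝ => (a + s • h, y s)) (h, U (a + s • h, y s) h)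
        (Icc 0 1) s := by
      refine HasDerivWithinAt.prodMk ?_ (hy s hs)
      simpa using ((hasDerivAt_id s).smul_const h).const_add a |>.hasDerivWithinAt
    have h2 := (hd _ (hyB s hs)).hasFDerivAt.comp_hasDerivWithinAt s h1
    have h3 : HasDerivWithinAt (fun s : ℝ => U (a + s • h, y s) v)
        ((fderiv ℝ U (a + s • h, y s) (h, U (a + s • h, y s) h)) v) (Icc 0 1) s := by
      simpa using h2.clm_apply (hasDerivWithinAt_const s _ v)
    exact (hasDerivWithinAt_id s _).smul h3
  have hwb : ∀ s ∈ Icc (0 : ℝ) 1, ‖w' s‖ ≤ K * ‖w s‖ + (L₁ * C₂ + L₂ * C₂ ^ 2) * ‖v‖ ^ 2 := by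
    intro s hs
    set p := (a + s • h, y s) with hp
    set q := (a + s • (h + v), z s) with hq
    set A := fderiv ℝ U p with hA
    have hX : ‖((s • v, z s - y s) : E × E')‖ ≤ C₂ * ‖v‖ := by
      rw [Prod.norm_def]
      refine max_le ?_ ?_
      · rw [norm_smul, Real.norm_of_nonneg hs.1]
        have : 0 ≤ (L₁ + M) * κ * ‖v‖ := by positivity
        have h1 : s * ‖v‖ ≤ 1 * ‖v‖ := by gcongr; exact hs.2
        have h2 : C₂ * ‖v‖ = 1 * ‖v‖ + (L₁ + M) * κ * ‖v‖ := by rw [hC₂]; ring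
        linarith
      · have := hδ s hs
        have h2 : C₂ * ‖v‖ = ‖v‖ + (L₁ + M) * ‖v‖ * κ := by rw [hC₂]; ring
        have := norm_nonneg v
        simp only
        linarith
    have hRem : ‖U q - U p - A (s • v, z s - y s)‖ ≤ L₂ * C₂ ^ 2 * ‖v‖ ^ 2 := by
      have hseg : segment ℝ p q ⊆ closedBall (a, b) ρ := hconv.segment_subset (hyB s hs) (hzB s hs)
      have := (convex_segment p q).norm_image_sub_le_of_norm_fderiv_le' (f := U) (𝕜 := ℝ) (φ := A)
        (C := L₂ * ‖q - p‖) (fun x hx => hd x (hseg hx)) (fun x hx => by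
          refine (hUL₂ x (hseg hx) p (hyB s hs)).trans ?_
          gcongr
          have := norm_sub_le_of_mem_segment hx
          simpa [norm_sub_rev] using this) (left_mem_segment _ _ _) (right_mem_segment _ _ _)
      rw [hq, hp, hdiff] at this
      rw [hq, hp]
      refine this.trans ?_
      calc L₂ * ‖((s • v, z s - y s) : E × E')‖ * ‖((s • v, z s - y s) : E × E')‖
          ≤ L₂ * (C₂ * ‖v‖) * (C₂ * ‖v‖) := by gcongr
        _ = _ := by ring
    -- `w` is the error of the guess s U(p)v for z - y. On the part s(v, U(p)v) of the increment,
    -- integrability exchanges v and h and cancels the derivative of the guess. What remains is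
    -- linear in `w` or quadratic in v.
    have hsplit : ((s • v, z s - y s) : E × E') = s • (v, U p v) + (0, w s) := by
      ext
      · simp
      · simp [w, hp]
    have e : w' s = A (0, w s) h + A (s • v, z s - y s) v +
        (U q - U p - A (s • v, z s - y s)) (h + v) := by
      have h1 := hint s hs
      rw [← hp, ← hA] at h1
      have h2 : A (s • v, z s - y s) h = s • A (h, U p h) v + A (0, w s) h := by
        rw [hsplit, map_add, map_smul]
        simp only [add_apply, smul_apply, h1]
      simp only [w', ← hp, ← hq, ← hA, sub_apply, map_add, h2, one_smul]
      abel
    rw [e]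
    have n1 : ‖A (0, w s) h‖ ≤ L₁ * ‖w s‖ := by
      calc ‖A (0, w s) h‖ ≤ ‖A (0, w s)‖ * ‖h‖ := ContinuousLinearMap.le_opNorm _ _
        _ ≤ (L₁ * ‖w s‖) * 1 := by
          gcongr
          refine (A.le_opNorm _).trans ?_
          have : ‖((0 : E), w s)‖ = ‖w s‖ := by simp [Prod.norm_def]
          rw [this]; gcongr; exact hUL _ (hyB s hs)
        _ = _ := mul_one _
    have n2 : ‖A (s • v, z s - y s) v‖ ≤ L₁ * C₂ * ‖v‖ ^ 2 := by
      calc _ ≤ ‖A (s • v, z s - y s)‖ * ‖v‖ := ContinuousLinearMap.le_opNorm _ _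
        _ ≤ (L₁ * (C₂ * ‖v‖)) * ‖v‖ := by
          gcongr
          refine (A.le_opNorm _).trans ?_
          gcongr; exact hUL _ (hyB s hs)
        _ = _ := by ring
    have n3 : ‖(U q - U p - A (s • v, z s - y s)) (h + v)‖ ≤ L₂ * C₂ ^ 2 * ‖v‖ ^ 2 := by
      calc _ ≤ ‖U q - U p - A (s • v, z s - y s)‖ * ‖h + v‖ := ContinuousLinearMap.le_opNorm _ _
        _ ≤ (L₂ * C₂ ^ 2 * ‖v‖ ^ 2) * 1 := by gcongr
        _ = _ := mul_one _
    have := norm_nonneg (w s)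
    calc _ ≤ L₁ * ‖w s‖ + L₁ * C₂ * ‖v‖ ^ 2 + L₂ * C₂ ^ 2 * ‖v‖ ^ 2 :=
          (norm_add₃_le).trans (add_le_add_three n1 n2 n3)
      _ ≤ _ := by rw [hKdef]; nlinarith
  have := norm_le_mul_exp_of_deriv_bound hK (by positivity) (by simp [w, hy0, hz0]) hw hwb
    (right_mem_Icc.2 zero_le_one)
  simp only [w, one_smul] at this
  refine this.trans (le_of_eq (by ring))

/-- Existence of solutions along rays, for a map `U` which is bounded and Lipschitz on a ball. -/
theorem exists_ray_solution [CompleteSpace E'] {U : E × E' → E →L[ℝ] E'} {a : E} {b : E'}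
    {ρ M L₁ : ℝ} (hρ : 0 ≤ ρ) (hL₁ : 0 ≤ L₁)
    (hd : ∀ p ∈ closedBall (a, b) ρ, DifferentiableAt ℝ U p)
    (hUM : ∀ p ∈ closedBall (a, b) ρ, ‖U p‖ ≤ M)
    (hUL : ∀ p ∈ closedBall (a, b) ρ, ‖fderiv ℝ U p‖ ≤ L₁)
    {h : E} (h1 : ‖h‖ ≤ 1) (hhρ : ‖h‖ ≤ ρ) (hMh : M * ‖h‖ ≤ ρ) :
    ∃ y : ℝ → E', y 0 = b ∧ (∀ s ∈ Icc (0 : ℝ) 1, (a + s • h, y s) ∈ closedBall (a, b) ρ) ∧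
      ∀ s ∈ Icc (0 : ℝ) 1, HasDerivWithinAt y (U (a + s • h, y s) h) (Icc 0 1) s := by
  lift ρ to NNReal using hρ
  lift L₁ to NNReal using hL₁
  have hmem : ∀ s ∈ Icc (0 : ℝ) 1, ∀ z ∈ closedBall b ρ, (a + s • h, z) ∈ closedBall (a, b) ρ := by
    intro s hs z hz
    rw [← closedBall_prod_same]
    refine ⟨?_, hz⟩
    rw [mem_closedBall_iff_norm, add_sub_cancel_left, norm_smul, Real.norm_of_nonneg hs.1]
    exact (mul_le_of_le_one_left (norm_nonneg _) hs.2).trans hhρ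
  let t₀ : Icc (0 : ℝ) 1 := ⟨0, left_mem_Icc.2 zero_le_one⟩
  -- The speed is at most ρ and the time interval has length 1, so a solution starting exactly at b
  -- cannot leave the ball of radius ρ.
  have hP : IsPicardLindelof (fun t z => U (a + t • h, z) h) t₀ b ρ 0
      ρ L₁ := by
    refine ⟨fun t ht => ?_, fun z hz => ?_, fun t ht z hz => ?_, ?_⟩
    · refine LipschitzOnWith.of_dist_le_mul fun z hz z' hz' => ?_
      rw [dist_eq_norm, dist_eq_norm, ← sub_apply]
      refine (ContinuousLinearMap.le_opNorm _ _).trans ?_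
      have := (convex_closedBall (a, b) ρ).norm_image_sub_le_of_norm_fderiv_le hd hUL
        (hmem t ht z' hz') (hmem t ht z hz)
      have e : ‖((a + t • h, z) - (a + t • h, z') : E × E')‖ = ‖z - z'‖ := by
        simp [Prod.norm_def]
      rw [e] at this
      calc _ ≤ (L₁ * ‖z - z'‖) * 1 := by gcongr
        _ = _ := by simp
    · intro t ht
      have hc : ContinuousAt U (a + t • h, z) := (hd _ (hmem t ht z hz)).continuousAt
      have hc2 : ContinuousAt (fun t : ℝ => (a + t • h, z)) t := by fun_prop
      have hc3 : ContinuousAt (fun t : ℝ => U (a + t • h, z)) t :=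
        ContinuousAt.comp (g := U) (f := fun t : ℝ => (a + t • h, z)) hc hc2
      exact (hc3.clm_apply continuousAt_const).continuousWithinAt
    · refine (ContinuousLinearMap.le_opNorm _ _).trans ?_
      exact (mul_le_mul_of_nonneg_right (hUM _ (hmem t ht z hz)) (norm_nonneg _)).trans hMh
    · simp [t₀]
  -- The fixed point of the Picard operator is used directly because it carries the information that
  -- the solution stays in the ball.
  obtain ⟨α, hα⟩ := ODE.FunSpace.exists_isFixedPt_next hP (mem_closedBall_self le_rfl)
  have hin : ∀ s, α.compProj s ∈ closedBall b ρ := fun s => α.compProj_mem_closedBall hP.mul_max_le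
  refine ⟨α.compProj, ?_, fun s hs => hmem s hs _ (hin s), fun t ht => ?_⟩
  · change α.compProj (t₀ : ℝ) = b
    rw [ODE.FunSpace.compProj_val, ← hα, ODE.FunSpace.next_apply₀]
  · apply ODE.hasDerivWithinAt_picard_Icc t₀.2 hP.continuousOn_uncurry
      α.continuous_compProj.continuousOn (fun _ ht' => α.compProj_mem_closedBall hP.mul_max_le)
      b ht |>.congr_of_mem _ ht
    intro t' ht'
    nth_rw 1 [← hα]
    rw [ODE.FunSpace.compProj_of_mem ht', ODE.FunSpace.next_apply]

/-- Local existence for the total differential equation `DΦ(x) = U(x, Φ(x))`, `Φ(a) = b`, when the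
integrability condition holds on the zero set of a function `J` which the equation preserves. -/
theorem exists_hasFDerivAt_total [CompleteSpace E'] {U : E × E' → E →L[ℝ] E'} {a : E} {b : E'}
    (hU : ContDiffAt ℝ 2 U (a, b)) {J : E × E' → F} {C : ℝ}
    (hJ : ∀ᶠ p in 𝓝 (a, b), DifferentiableAt ℝ J p) (hJ0 : J (a, b) = 0)
    (hJU : ∀ᶠ p in 𝓝 (a, b), ∀ v, ‖fderiv ℝ J p (v, U p v)‖ ≤ C * ‖J p‖ * ‖v‖)
    (hint : ∀ᶠ p in 𝓝 (a, b), J p = 0 → ∀ v w,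
      fderiv ℝ U p (v, U p v) w = fderiv ℝ U p (w, U p w) v) :
    ∃ Φ : E → E', Φ a = b ∧ ∀ᶠ x in 𝓝 a, HasFDerivAt Φ (U (x, Φ x)) x := by
  have hU' : ContDiffAt ℝ 1 (fderiv ℝ U) (a, b) := hU.fderiv_right (by norm_num)
  obtain ⟨L₂, S, hS, hL₂⟩ := hU'.exists_lipschitzOnWith
  have hd : ∀ᶠ p in 𝓝 (a, b), DifferentiableAt ℝ U p := by
    filter_upwards [hU.eventually (by simp)] with p hp using hp.differentiableAt (by simp)
  have hUM : ∀ᶠ p in 𝓝 (a, b), ‖U p‖ < ‖U (a, b)‖ + 1 :=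
    hU.continuousAt.norm.eventually_lt_const (lt_add_one _)
  have hUL : ∀ᶠ p in 𝓝 (a, b), ‖fderiv ℝ U p‖ < ‖fderiv ℝ U (a, b)‖ + 1 :=
    ((continuous_norm (E := E × E' →L[ℝ] E →L[ℝ] E')).continuousAt.comp
      hU'.continuousAt).eventually_lt_const (lt_add_one _)
  obtain ⟨ρ, hρ, hball⟩ := Metric.nhds_basis_closedBall.mem_iff.1
    (Filter.inter_mem hS (hd.and (hUM.and (hUL.and (hJ.and (hJU.and hint))))))
  set M := ‖U (a, b)‖ + 1
  set L₁ := ‖fderiv ℝ U (a, b)‖ + 1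
  have hM : 0 ≤ M := by positivity
  have hL₁ : 0 ≤ L₁ := by positivity
  have hdB : ∀ p ∈ closedBall (a, b) ρ, DifferentiableAt ℝ U p := fun p hp => (hball hp).2.1
  have hMB : ∀ p ∈ closedBall (a, b) ρ, ‖U p‖ ≤ M := fun p hp => (hball hp).2.2.1.le
  have hLB : ∀ p ∈ closedBall (a, b) ρ, ‖fderiv ℝ U p‖ ≤ L₁ := fun p hp => (hball hp).2.2.2.1.le
  obtain ⟨C', hC'⟩ := norm_ray_variation_le hM hL₁ L₂.2 hdB hMB hLB
    (fun p hp q hq => hL₂.norm_sub_le (hball hp).1 (hball hq).1)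
  -- The three bounds are those required of ‖h‖ for a ray solution: at most 1, at most ρ, and M‖h‖
  -- at most ρ.
  set r := min 1 (min ρ (ρ / (M + 1))) with hr
  have hr0 : 0 < r := by positivity
  have hr1 : r ≤ 1 := min_le_left _ _
  have hrρ : r ≤ ρ := (min_le_right _ _).trans (min_le_left _ _)
  have hrM : M * r ≤ ρ := by
    have : r ≤ ρ / (M + 1) := (min_le_right _ _).trans (min_le_right _ _)
    rw [le_div_iff₀ (by positivity)] at this
    nlinarith
  have hex : ∀ h : E, ∃ y : ℝ → E', ‖h‖ < r → y 0 = b ∧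
      (∀ s ∈ Icc (0 : ℝ) 1, (a + s • h, y s) ∈ closedBall (a, b) ρ) ∧
      ∀ s ∈ Icc (0 : ℝ) 1, HasDerivWithinAt y (U (a + s • h, y s) h) (Icc 0 1) s := by
    intro h
    by_cases hh : ‖h‖ < r
    · obtain ⟨y, hy⟩ := exists_ray_solution hρ.le hL₁ hdB hMB hLB (hh.le.trans hr1)
        (hh.le.trans hrρ) ((mul_le_mul_of_nonneg_left hh.le hM).trans hrM)
      exact ⟨y, fun _ => hy⟩
    · exact ⟨fun _ => b, fun h => absurd h hh⟩
  choose y hy using hex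
  -- Along a ray the derivative of `J` is bounded by a multiple of `J`, which starts at 0. So `J`
  -- stays 0, and integrability is available along every ray.
  have hJy : ∀ h : E, ‖h‖ < r → ∀ s ∈ Icc (0 : ℝ) 1, J (a + s • h, y h s) = 0 := by
    intro h hh s hs
    obtain ⟨h0, hB, hD⟩ := hy h hh
    have := norm_le_mul_exp_of_deriv_bound (f := fun s => J (a + s • h, y h s))
      (f' := fun s => fderiv ℝ J (a + s • h, y h s) (h, U (a + s • h, y h s) h))
      (K := |C| + 1) (ε := 0) (by positivity) le_rfl (by simp [h0, hJ0]) (fun s hs => by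
        have h1 : HasDerivWithinAt (fun s : ℝ => (a + s • h, y h s)) (h, U (a + s • h, y h s) h)
            (Icc 0 1) s := by
          refine HasDerivWithinAt.prodMk ?_ (hD s hs)
          simpa using ((hasDerivAt_id s).smul_const h).const_add a |>.hasDerivWithinAt
        exact (hball (hB s hs)).2.2.2.2.1.hasFDerivAt.comp_hasDerivWithinAt s h1)
      (fun s hs => by
        refine ((hball (hB s hs)).2.2.2.2.2.1 h).trans ?_
        have h2 := norm_nonneg (J (a + s • h, y h s))
        have h3 := norm_nonneg h
        have h4 : ‖h‖ ≤ 1 := hh.le.trans hr1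
        calc C * ‖J (a + s • h, y h s)‖ * ‖h‖ ≤ |C| * ‖J (a + s • h, y h s)‖ * 1 := by
              gcongr; exact le_abs_self C
          _ ≤ _ := by nlinarith) hs
    simpa using this
  -- Φ(x) is the value at time 1 of the solution along the ray from a to x.
  refine ⟨fun x => y (x - a) 1, ?_, ?_⟩
  · obtain ⟨h0, hB, hD⟩ := hy 0 (by simpa using hr0)
    have := norm_le_mul_exp_of_deriv_bound (f := fun s => y 0 s - b) (K := 1) (ε := 0)
      one_pos le_rfl (by simp [h0]) (fun s hs => (hD s hs).sub_const b) (by simp)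
      (right_mem_Icc.2 zero_le_one)
    simpa [sub_eq_zero] using this
  · filter_upwards [Metric.ball_mem_nhds a hr0] with x hx
    rw [mem_ball_iff_norm] at hx
    rw [hasFDerivAt_iff_isLittleO_nhds_zero]
    have hsmall : ∀ᶠ v : E in 𝓝 0, ‖x - a + v‖ < r := by
      have : ContinuousAt (fun v : E => ‖x - a + v‖) 0 := by fun_prop
      exact this.eventually_lt_const (by simpa using hx)
    -- The variation estimate between neighbouring rays is the differentiability of Φ at x, with a
    -- quadratic remainder.
    have hO : (fun v : E => y (x + v - a) 1 - y (x - a) 1 - U (x, y (x - a) 1) v) =O[𝓝 0]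
        fun v : E => ‖v‖ ^ 2 := by
      refine Asymptotics.IsBigO.of_bound C' ?_
      filter_upwards [hsmall] with v hv
      obtain ⟨h0, hB, hD⟩ := hy _ hx
      obtain ⟨h0', hB', hD'⟩ := hy _ hv
      have := hC' (x - a) v (y (x - a)) (y (x - a + v)) (hx.le.trans hr1) (hv.le.trans hr1)
        h0 h0' hB hB' hD hD' (fun s hs => (hball (hB s hs)).2.2.2.2.2.2 (hJy _ hx s hs) _ _)
      rw [show x + v - a = x - a + v by abel]
      simpa using this
    refine hO.trans_isLittleO ?_
    have := Asymptotics.isLittleO_norm_pow_id (E' := E) one_lt_two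
    exact this

end TotalDE

/-! ### Smoothness of solutions and the inverse function theorem. -/

section FlatSmooth

variable {E E' : Type*} [NormedAddCommGroup E] [NormedSpace ℝ E] [NormedAddCommGroup E']
  [NormedSpace ℝ E']

/-- Solutions of a smooth total differential equation are smooth. -/
theorem contDiffOn_of_hasFDerivAt_total {U : E × E' → E →L[ℝ] E'} {Φ : E → E'} {s : Set E}
    {T : Set (E × E')} (hs : IsOpen s) (hU : ContDiffOn ℝ ∞ U T) (hT : ∀ x ∈ s, (x, Φ x) ∈ T)
    (hΦ : ∀ x ∈ s, HasFDerivAt Φ (U (x, Φ x)) x) : ContDiffOn ℝ ∞ Φ s := by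
  have hd : DifferentiableOn ℝ Φ s := fun x hx => (hΦ x hx).differentiableAt.differentiableWithinAt
  -- Bootstrapping: the derivative U(x, Φ(x)) is as regular as Φ, so each step gains one derivative.
  have key : ∀ j : ℕ, ContDiffOn ℝ j Φ s := by
    intro j
    induction j with
    | zero => exact contDiffOn_zero.2 hd.continuousOn
    | succ j ih =>
      push_cast
      rw [contDiffOn_succ_iff_fderiv_of_isOpen hs]
      refine ⟨hd, by simp, ?_⟩
      have h1 : ContDiffOn ℝ j (fun x => U (x, Φ x)) s :=
        (hU.of_le (by exact_mod_cast le_top)).comp (contDiffOn_id.prodMk ih) hT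
      exact h1.congr fun x hx => (hΦ x hx).fderiv
  exact contDiffOn_infty.2 key

/-- The inverse function theorem, giving an open partial homeomorphism that is smooth
in both directions. -/
theorem exists_openPartialHomeomorph_of_contDiffOn [CompleteSpace E] {f : E → E'} {s : Set E}
    (hs : IsOpen s) (hf : ContDiffOn ℝ ∞ f s) {a : E} (ha : a ∈ s) (f' : E ≃L[ℝ] E')
    (hf' : HasFDerivAt f (f' : E →L[ℝ] E') a) :
    ∃ Φ : OpenPartialHomeomorph E E', a ∈ Φ.source ∧ Φ.source ⊆ s ∧ (∀ x, Φ x = f x) ∧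
      ContDiffOn ℝ ∞ Φ.symm Φ.target := by
  have hfa : ContDiffAt ℝ ∞ f a := hf.contDiffAt (hs.mem_nhds ha)
  have hne : (∞ : ℕ∞ω) ≠ 0 := by simp
  set Φ₀ := hfa.toOpenPartialHomeomorph f hf' hne with hΦ₀
  have hfd : ContinuousOn (fderiv ℝ f) s := hf.continuousOn_fderiv_of_isOpen hs (by simp)
  -- The domain is cut down to the open set where the derivative is invertible, so that the inverse
  -- is smooth on the whole target and not only at the image of a.
  have hO : IsOpen (s ∩ fderiv ℝ f ⁻¹' range ((↑) : (E ≃L[ℝ] E') → E →L[ℝ] E')) :=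
    hfd.isOpen_inter_preimage hs ContinuousLinearEquiv.isOpen
  set O := s ∩ fderiv ℝ f ⁻¹' range ((↑) : (E ≃L[ℝ] E') → E →L[ℝ] E') with hOdef
  have hcoe : ∀ x, Φ₀.restrOpen O hO x = f x := fun x => rfl
  refine ⟨Φ₀.restrOpen O hO, ?_, ?_, hcoe, ?_⟩
  · rw [OpenPartialHomeomorph.restrOpen_source]
    exact ⟨hfa.mem_toOpenPartialHomeomorph_source hf' hne, ha, f', hf'.fderiv.symm⟩
  · rw [OpenPartialHomeomorph.restrOpen_source]
    exact fun x hx => hx.2.1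
  · intro y hy
    have hx := (Φ₀.restrOpen O hO).map_target hy
    rw [OpenPartialHomeomorph.restrOpen_source] at hx
    obtain ⟨hxs, e, he⟩ := hx.2
    have hfx : ContDiffAt ℝ ∞ f ((Φ₀.restrOpen O hO).symm y) := hf.contDiffAt (hs.mem_nhds hxs)
    refine (OpenPartialHomeomorph.contDiffAt_symm (Φ₀.restrOpen O hO) (f₀' := e) hy ?_
      hfx).contDiffWithinAt
    rw [he]
    exact (hfx.differentiableAt (by simp)).hasFDerivAt

end FlatSmooth

/-! ### Smooth maps into spaces of linear and alternating maps. -/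

section PointwiseSmooth

variable {EM HM M : Type*} [NormedAddCommGroup EM] [NormedSpace ℝ EM] [TopologicalSpace HM]
  [TopologicalSpace M] [ChartedSpace HM M] {I : ModelWithCorners ℝ EM HM}
  {V F : Type*} [NormedAddCommGroup V] [NormedSpace ℝ V]
  [NormedAddCommGroup F] [NormedSpace ℝ F]

/-- A map into `V →L[ℝ] F`, with `V` finite-dimensional, is smooth if its values are. -/
theorem contMDiffAt_clm_of_apply [FiniteDimensional ℝ V] {f : M → V →L[ℝ] F} {x : M}
    (hf : ∀ v, ContMDiffAt I 𝓘(ℝ, F) ∞ (fun y => f y v) x) :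
    ContMDiffAt I 𝓘(ℝ, V →L[ℝ] F) ∞ f x := by
  let b := Module.finBasis ℝ V
  let c : Fin (Module.finrank ℝ V) → F →L[ℝ] V →L[ℝ] F := fun i =>
    ContinuousLinearMap.smulRightL ℝ V F (LinearMap.toContinuousLinearMap (b.coord i))
  have he : f = fun y => ∑ i, c i (f y (b i)) := by
    funext y
    ext v
    rw [sum_apply]
    conv_lhs => rw [← b.sum_repr v, map_sum]
    simp [c]
  rw [he]
  refine contMDiffAt_finsetSum fun i _ => ?_
  exact (c i).contMDiff.contMDiffAt.comp x (hf (b i))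

theorem contMDiff_clm_of_apply [FiniteDimensional ℝ V] {f : M → V →L[ℝ] F}
    (hf : ∀ v, ContMDiff I 𝓘(ℝ, F) ∞ (fun y => f y v)) :
    ContMDiff I 𝓘(ℝ, V →L[ℝ] F) ∞ f :=
  fun x => contMDiffAt_clm_of_apply fun v => hf v x

/-- The alternating form attached to a bilinear map `B`, with the value
`(B(v, w) - B(w, v)) / 2` on `(v, w)`. -/
def alternatization₂ (V F : Type*) [NormedAddCommGroup V] [NormedSpace ℝ V]
    [NormedAddCommGroup F] [NormedSpace ℝ F] : (V →L[ℝ] V →L[ℝ] F) →L[ℝ] V [⋀^Fin 2]→L[ℝ] F :=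
  (2⁻¹ : ℝ) • (ContinuousAlternatingMap.alternatizeUncurryFinCLM ℝ V F (n := 1)).comp
    (ContinuousLinearMap.compL ℝ V (V →L[ℝ] F) (V [⋀^Fin 1]→L[ℝ] F)
      (ContinuousAlternatingMap.ofSubsingletonLIE (𝕜 := ℝ) (ι := Fin 1) (E := V) (F := F)
        0).toContinuousLinearEquiv)

theorem alternatization₂_apply (B : V →L[ℝ] V →L[ℝ] F) (v w : V) :
    alternatization₂ V F B ![v, w] = (2⁻¹ : ℝ) • (B v w - B w v) := by
  simp [alternatization₂, ContinuousAlternatingMap.alternatizeUncurryFin_apply, Fin.sum_univ_two,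
    sub_eq_add_neg]
  rfl

/-- A family of alternating bilinear maps whose values are smooth comes from a smooth map
into the space of alternating forms. -/
theorem exists_contMDiff_alternating [FiniteDimensional ℝ V] {b : M → V → V → F}
    (hadd : ∀ x v v' w, b x (v + v') w = b x v w + b x v' w)
    (hsmul : ∀ x (c : ℝ) v w, b x (c • v) w = c • b x v w)
    (halt : ∀ x v w, b x v w = -b x w v)
    (hb : ∀ v w, ContMDiff I 𝓘(ℝ, F) ∞ (fun x => b x v w)) :
    ∃ T : M → V [⋀^Fin 2]→L[ℝ] F, ContMDiff I 𝓘(ℝ, V [⋀^Fin 2]→L[ℝ] F) ∞ T ∧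
      ∀ x v w, T x ![v, w] = b x v w := by
  have hadd' : ∀ x v w w', b x v (w + w') = b x v w + b x v w' := by
    intro x v w w'
    rw [halt, hadd, halt x w, halt x w']; abel
  have hsmul' : ∀ x (c : ℝ) v w, b x v (c • w) = c • b x v w := by
    intro x c v w
    rw [halt, hsmul, halt x w, smul_neg, neg_neg]
  let B : M → V →L[ℝ] V →L[ℝ] F := fun x => LinearMap.toContinuousLinearMap
    { toFun := fun v => LinearMap.toContinuousLinearMap
        { toFun := fun w => b x v w, map_add' := hadd' x v, map_smul' := fun c w => hsmul' x c v w }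
      map_add' := fun v v' => by ext w; simp [hadd]
      map_smul' := fun c v => by ext w; simp [hsmul] }
  -- Smoothness of `B` can be tested on vectors, and alternatization is a fixed continuous linear
  -- map. Its factor 1/2 makes it reproduce the values of `B`, which is already alternating.
  refine ⟨fun x => alternatization₂ V F (B x), ?_, ?_⟩
  · have hB : ContMDiff I 𝓘(ℝ, V →L[ℝ] V →L[ℝ] F) ∞ B :=
      contMDiff_clm_of_apply fun v => contMDiff_clm_of_apply fun w => hb v w
    have hA : ContMDiff 𝓘(ℝ, V →L[ℝ] V →L[ℝ] F) 𝓘(ℝ, V [⋀^Fin 2]→L[ℝ] F) ∞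
        (alternatization₂ V F) := by
      rw [contMDiff_iff_contDiff]
      fun_prop
    exact hA.comp hB
  · intro x v w
    rw [alternatization₂_apply]
    change (2⁻¹ : ℝ) • (b x v w - b x w v) = b x v w
    rw [halt x w v, sub_neg_eq_add, ← two_smul ℝ, smul_smul]
    norm_num

end PointwiseSmooth

/-! ### Vector fields and their brackets in charts. -/

section FieldsInCharts

open VectorField

variable {m : ℕ} {M : Type*} [TopologicalSpace M] [ChartedSpace (Euc m) M]

/-- The expression of a vector field in a chart. -/
def fieldInChart (e : OpenPartialHomeomorph M (Euc m)) (X : (p : M) → TangentSpace (𝓡 m) p)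
    (y : Euc m) : Euc m :=
  mfderiv (𝓡 m) 𝓘(ℝ, Euc m) e (e.symm y) (X (e.symm y))

/-- The expression of a vector-valued 1-form in a chart. -/
def formInChart {V : Type*} [NormedAddCommGroup V] [NormedSpace ℝ V]
    (e : OpenPartialHomeomorph M (Euc m)) (η : (p : M) → TangentSpace (𝓡 m) p →L[ℝ] V)
    (y : Euc m) : Euc m →L[ℝ] V :=
  (η (e.symm y)).comp (mfderiv 𝓘(ℝ, Euc m) (𝓡 m) e.symm y)

variable {e : OpenPartialHomeomorph M (Euc m)}

theorem mdifferentiable_of_mem_maximalAtlas (he : e ∈ IsManifold.maximalAtlas (𝓡 m) ∞ M) :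
    e.MDifferentiable (𝓡 m) 𝓘(ℝ, Euc m) :=
  ⟨(contMDiffOn_of_mem_maximalAtlas he).mdifferentiableOn (by simp),
    (contMDiffOn_symm_of_mem_maximalAtlas he).mdifferentiableOn (by simp)⟩

theorem isInvertible_mfderiv_symm (he : e ∈ IsManifold.maximalAtlas (𝓡 m) ∞ M) {y : Euc m}
    (hy : y ∈ e.target) : (mfderiv 𝓘(ℝ, Euc m) (𝓡 m) e.symm y).IsInvertible :=
  ⟨(mdifferentiable_of_mem_maximalAtlas he).symm.mfderiv hy, rfl⟩

theorem isInvertible_mfderiv_chart (he : e ∈ IsManifold.maximalAtlas (𝓡 m) ∞ M) {p : M}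
    (hp : p ∈ e.source) : (mfderiv (𝓡 m) 𝓘(ℝ, Euc m) e p).IsInvertible :=
  ⟨(mdifferentiable_of_mem_maximalAtlas he).mfderiv hp, rfl⟩

theorem mfderiv_symm_mfderiv_chart (he : e ∈ IsManifold.maximalAtlas (𝓡 m) ∞ M) {p : M}
    (hp : p ∈ e.source) (ξ : TangentSpace (𝓡 m) p) :
    mfderiv 𝓘(ℝ, Euc m) (𝓡 m) e.symm (e p) (mfderiv (𝓡 m) 𝓘(ℝ, Euc m) e p ξ) = ξ :=
  congrArg (fun T => T ξ) ((mdifferentiable_of_mem_maximalAtlas he).symm_comp_deriv hp)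

theorem mfderiv_chart_mfderiv_symm (he : e ∈ IsManifold.maximalAtlas (𝓡 m) ∞ M) {y : Euc m}
    (hy : y ∈ e.target) (v : Euc m) :
    mfderiv (𝓡 m) 𝓘(ℝ, Euc m) e (e.symm y) (mfderiv 𝓘(ℝ, Euc m) (𝓡 m) e.symm y v) = v :=
  congrArg (fun T => T v) ((mdifferentiable_of_mem_maximalAtlas he).comp_symm_deriv hy)

theorem mfderiv_symm_fieldInChart (he : e ∈ IsManifold.maximalAtlas (𝓡 m) ∞ M) {y : Euc m}
    (hy : y ∈ e.target) (X : (p : M) → TangentSpace (𝓡 m) p) :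
    mfderiv 𝓘(ℝ, Euc m) (𝓡 m) e.symm y (fieldInChart e X y) = X (e.symm y) := by
  have h := mfderiv_symm_mfderiv_chart he (e.map_target hy) (X (e.symm y))
  rw [e.right_inv hy] at h
  exact h

theorem inverse_mfderiv_symm (he : e ∈ IsManifold.maximalAtlas (𝓡 m) ∞ M) {y : Euc m}
    (hy : y ∈ e.target) :
    (mfderiv 𝓘(ℝ, Euc m) (𝓡 m) e.symm y).inverse =
      mfderiv (𝓡 m) 𝓘(ℝ, Euc m) e (e.symm y) := by
  refine ContinuousLinearMap.inverse_eq ?_ ?_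
  · have h := (mdifferentiable_of_mem_maximalAtlas he).symm_comp_deriv (e.map_target hy)
    rw [e.right_inv hy] at h
    exact h
  · exact (mdifferentiable_of_mem_maximalAtlas he).comp_symm_deriv hy

theorem mpullback_symm_eq_fieldInChart (he : e ∈ IsManifold.maximalAtlas (𝓡 m) ∞ M) {y : Euc m}
    (hy : y ∈ e.target) (X : (p : M) → TangentSpace (𝓡 m) p) :
    mpullback 𝓘(ℝ, Euc m) (𝓡 m) e.symm X y = fieldInChart e X y := by
  rw [mpullback_apply, inverse_mfderiv_symm he hy]
  rfl

variable [IsManifold (𝓡 m) ∞ M]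

/-- Over ℝ, `minSmoothness` changes nothing. The two instances supply the regularity under which Lie
brackets, and the Jacobi identity, are available. -/
instance : IsManifold (𝓡 m) (minSmoothness ℝ 2) M := by
  rw [minSmoothness_of_isRCLikeNormedField]; infer_instance

instance : IsManifold (𝓡 m) (minSmoothness ℝ 3) M := by
  rw [minSmoothness_of_isRCLikeNormedField]
  exact IsManifold.of_le (n := ∞) (WithTop.coe_le_coe.2 le_top)

/-- Smoothness at a point of a vector field on a manifold. -/
abbrev SmoothFieldAt (X : (p : M) → TangentSpace (𝓡 m) p) (p : M) : Prop :=
  ContMDiffAt (𝓡 m) (𝓡 m).tangent ∞ (fun q => (⟨q, X q⟩ : TangentBundle (𝓡 m) M)) p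

theorem contDiffAt_fieldInChart_of_le (he : e ∈ IsManifold.maximalAtlas (𝓡 m) ∞ M) {y : Euc m}
    (hy : y ∈ e.target) {X : (p : M) → TangentSpace (𝓡 m) p} {r : ℕ∞ω} (hr : r + 1 ≤ ∞)
    (hX : ContMDiffAt (𝓡 m) (𝓡 m).tangent r (fun q => (⟨q, X q⟩ : TangentBundle (𝓡 m) M))
      (e.symm y)) :
    ContDiffAt ℝ r (fieldInChart e X) y := by
  have h := ContMDiffAt.mpullback_vectorField_preimage (I := 𝓘(ℝ, Euc m)) (I' := 𝓡 m)
    (m := r) (n := ∞) (f := e.symm) hX (contMDiffAt_symm_of_mem_maximalAtlas he hy)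
    (isInvertible_mfderiv_symm he hy) hr
  refine (contMDiffAt_vectorSpace_iff_contDiffAt.1 h).congr_of_eventuallyEq ?_
  filter_upwards [e.open_target.mem_nhds hy] with z hz
  exact (mpullback_symm_eq_fieldInChart he hz X).symm

theorem contDiffAt_fieldInChart (he : e ∈ IsManifold.maximalAtlas (𝓡 m) ∞ M) {y : Euc m}
    (hy : y ∈ e.target) {X : (p : M) → TangentSpace (𝓡 m) p} (hX : SmoothFieldAt X (e.symm y)) :
    ContDiffAt ℝ ∞ (fieldInChart e X) y :=
  contDiffAt_fieldInChart_of_le he hy (by simp) hX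

theorem mlieBracket_eq_lieBracket {E : Type*} [NormedAddCommGroup E] [NormedSpace ℝ E]
    (V W : E → E) (y : E) : (mlieBracket 𝓘(ℝ, E) V W y : E) = lieBracket ℝ V W y :=
  (congrFun (mlieBracketWithin_eq_lieBracketWithin (s := univ)) y).trans
    (congrFun lieBracketWithin_univ y)

/-- The Lie bracket of vector fields can be computed in any chart. -/
theorem mfderiv_mlieBracket_chart (he : e ∈ IsManifold.maximalAtlas (𝓡 m) ∞ M) {p : M}
    (hp : p ∈ e.source) {X Y : (p : M) → TangentSpace (𝓡 m) p}
    (hX : MDifferentiableAt (𝓡 m) (𝓡 m).tangent (fun q => (⟨q, X q⟩ : TangentBundle (𝓡 m) M)) p)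
    (hY : MDifferentiableAt (𝓡 m) (𝓡 m).tangent (fun q => (⟨q, Y q⟩ : TangentBundle (𝓡 m) M)) p) :
    mfderiv (𝓡 m) 𝓘(ℝ, Euc m) e p (mlieBracket (𝓡 m) X Y p) =
      lieBracket ℝ (fieldInChart e X) (fieldInChart e Y) (e p) := by
  obtain ⟨y, hy, rfl⟩ : ∃ y ∈ e.target, e.symm y = p := ⟨e p, e.map_source hp, e.left_inv hp⟩
  have h := mpullback_mlieBracket (I := 𝓘(ℝ, Euc m)) (I' := 𝓡 m) (f := e.symm) (x₀ := y)
    hX hY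
    (contMDiffAt_symm_of_mem_maximalAtlas he hy)
    (by rw [minSmoothness_of_isRCLikeNormedField]; exact WithTop.coe_le_coe.2 le_top)
  rw [mpullback_symm_eq_fieldInChart he hy] at h
  have h2 : mlieBracket 𝓘(ℝ, Euc m) (mpullback 𝓘(ℝ, Euc m) (𝓡 m) e.symm X)
      (mpullback 𝓘(ℝ, Euc m) (𝓡 m) e.symm Y) y =
      mlieBracket 𝓘(ℝ, Euc m) (fieldInChart e X) (fieldInChart e Y) y := by
    refine Filter.EventuallyEq.mlieBracket_vectorField_eq ?_ ?_
    · filter_upwards [e.open_target.mem_nhds hy] with z hz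
      exact mpullback_symm_eq_fieldInChart he hz X
    · filter_upwards [e.open_target.mem_nhds hy] with z hz
      exact mpullback_symm_eq_fieldInChart he hz Y
  rw [h2] at h
  rw [e.right_inv hy]
  exact h.trans (mlieBracket_eq_lieBracket _ _ y)

end FieldsInCharts

/-! ### One-forms in charts and Cartan's formula for the exterior derivative. -/

section FormsInCharts

open VectorField

variable {m : ℕ} {M : Type*} [TopologicalSpace M] [ChartedSpace (Euc m) M]
  {V : Type*} [NormedAddCommGroup V] [NormedSpace ℝ V]
  {e : OpenPartialHomeomorph M (Euc m)} {η : (p : M) → TangentSpace (𝓡 m) p →L[ℝ] V}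

theorem formInChart_fieldInChart (he : e ∈ IsManifold.maximalAtlas (𝓡 m) ∞ M) {y : Euc m}
    (hy : y ∈ e.target) (X : (p : M) → TangentSpace (𝓡 m) p) :
    formInChart e η y (fieldInChart e X y) = η (e.symm y) (X (e.symm y)) :=
  congrArg (η (e.symm y)) (mfderiv_symm_fieldInChart he hy X)

/-- Near p one has f = g ∘ e. Leaving g free off the target allows a globally defined g, such as a
linear projection. -/
theorem mfderiv_eq_fderiv_chart {W : Type*} [NormedAddCommGroup W] [NormedSpace ℝ W]
    (he : e ∈ IsManifold.maximalAtlas (𝓡 m) ∞ M) {p : M}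
    (hp : p ∈ e.source) {f : M → W} {g : Euc m → W} (hfg : ∀ y ∈ e.target, g y = f (e.symm y))
    (hg : DifferentiableAt ℝ g (e p)) (ξ : TangentSpace (𝓡 m) p) :
    mvfderiv (𝓡 m) f p ξ =
      fderiv ℝ g (e p) (mfderiv (𝓡 m) 𝓘(ℝ, Euc m) e p ξ) := by
  have h1 : f =ᶠ[𝓝 p] g ∘ e := by
    filter_upwards [e.open_source.mem_nhds hp] with q hq
    rw [comp_apply, hfg _ (e.map_source hq), e.left_inv hq]
  have h2 := mfderiv_comp p (hg.mdifferentiableAt)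
    ((mdifferentiable_of_mem_maximalAtlas he).mdifferentiableAt hp)
  rw [← h1.mfderiv_eq, mfderiv_eq_fderiv] at h2
  exact congrArg (fun T => T ξ) h2

theorem mpullback_chart_symm (he : e ∈ IsManifold.maximalAtlas (𝓡 m) ∞ M) {y : Euc m}
    (hy : y ∈ e.target) (v : Euc m) :
    mpullback (𝓡 m) 𝓘(ℝ, Euc m) e (fun _ => v) (e.symm y) =
      mfderiv 𝓘(ℝ, Euc m) (𝓡 m) e.symm y v := by
  have hp := e.map_target hy
  have h0 := (mdifferentiable_of_mem_maximalAtlas he).comp_symm_deriv (e.map_source hp)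
  rw [e.left_inv hp] at h0
  have h : (mfderiv (𝓡 m) 𝓘(ℝ, Euc m) e (e.symm y)).inverse =
      mfderiv 𝓘(ℝ, Euc m) (𝓡 m) e.symm (e (e.symm y)) :=
    ContinuousLinearMap.inverse_eq h0 ((mdifferentiable_of_mem_maximalAtlas he).symm_comp_deriv hp)
  change (mfderiv (𝓡 m) 𝓘(ℝ, Euc m) e (e.symm y)).inverse v = _
  rw [h, e.right_inv hy]

variable [IsManifold (𝓡 m) ∞ M]

theorem SmoothOneForm.apply_field (hη : SmoothOneForm η) {X : (p : M) → TangentSpace (𝓡 m) p}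
    {p : M} (hX : SmoothFieldAt X p) :
    ContMDiffAt (𝓡 m) 𝓘(ℝ, V) ∞ (fun q => η q (X q)) p :=
  ContMDiffAt.comp p (g := fun ξ : TangentBundle (𝓡 m) M => η ξ.proj ξ.snd) (hη _) hX

/-- Around every point of the domain of a chart there are constant coordinate vector fields. -/
theorem smoothFieldAt_coordinate (he : e ∈ IsManifold.maximalAtlas (𝓡 m) ∞ M) {p : M}
    (hp : p ∈ e.source) (v : Euc m) :
    SmoothFieldAt (mpullback (𝓡 m) 𝓘(ℝ, Euc m) e (fun _ => v)) p := by
  refine ContMDiffAt.mpullback_vectorField_preimage (n := ∞) ?_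
    (contMDiffAt_of_mem_maximalAtlas he hp) (isInvertible_mfderiv_chart he hp) (by simp)
  exact contMDiffAt_vectorSpace_iff_contDiffAt.2 contDiffAt_const

/-- Tested on a vector v, the coordinate expression is η evaluated on the smooth coordinate field of
v. -/
theorem contDiffAt_formInChart (he : e ∈ IsManifold.maximalAtlas (𝓡 m) ∞ M) {y : Euc m}
    (hy : y ∈ e.target) (hη : SmoothOneForm η) : ContDiffAt ℝ ∞ (formInChart e η) y := by
  refine ContMDiffAt.contDiffAt (contMDiffAt_clm_of_apply fun v => ?_)
  have h := (hη.apply_field (smoothFieldAt_coordinate he (e.map_target hy) v)).comp y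
    (contMDiffAt_symm_of_mem_maximalAtlas he hy)
  refine h.congr_of_eventuallyEq ?_
  filter_upwards [e.open_target.mem_nhds hy] with z hz
  exact congrArg (η (e.symm z)) (mpullback_chart_symm he hz v).symm

/-- The exterior derivative of a 1-form in a chart, evaluated on vector fields. -/
theorem fderiv_formInChart_sub (he : e ∈ IsManifold.maximalAtlas (𝓡 m) ∞ M) {p : M}
    (hp : p ∈ e.source) (hη : SmoothOneForm η) {X Y : (p : M) → TangentSpace (𝓡 m) p}
    (hX : SmoothFieldAt X p) (hY : SmoothFieldAt Y p) :
    fderiv ℝ (formInChart e η) (e p) (mfderiv (𝓡 m) 𝓘(ℝ, Euc m) e p (X p))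
        (mfderiv (𝓡 m) 𝓘(ℝ, Euc m) e p (Y p)) -
      fderiv ℝ (formInChart e η) (e p) (mfderiv (𝓡 m) 𝓘(ℝ, Euc m) e p (Y p))
        (mfderiv (𝓡 m) 𝓘(ℝ, Euc m) e p (X p)) =
    mvfderiv (𝓡 m) (fun q => η q (Y q)) p (X p) -
      mvfderiv (𝓡 m) (fun q => η q (X q)) p (Y p) -
      η p (mlieBracket (𝓡 m) X Y p) := by
  obtain ⟨y, hy, rfl⟩ : ∃ y ∈ e.target, e.symm y = p := ⟨e p, e.map_source hp, e.left_inv hp⟩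
  have hA : DifferentiableAt ℝ (formInChart e η) y :=
    (contDiffAt_formInChart he hy hη).differentiableAt (by simp)
  have hXd : DifferentiableAt ℝ (fieldInChart e X) y :=
    (contDiffAt_fieldInChart he hy hX).differentiableAt (by simp)
  have hYd : DifferentiableAt ℝ (fieldInChart e Y) y :=
    (contDiffAt_fieldInChart he hy hY).differentiableAt (by simp)
  have hb := mfderiv_mlieBracket_chart he hp (hX.mdifferentiableAt (by simp))
    (hY.mdifferentiableAt (by simp))
  have hb2 : η (e.symm y) (mlieBracket (𝓡 m) X Y (e.symm y)) =
      formInChart e η y (lieBracket ℝ (fieldInChart e X) (fieldInChart e Y) y) := by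
    have h := formInChart_fieldInChart (η := η) he hy (mlieBracket (𝓡 m) X Y)
    rw [← h]
    rw [e.right_inv hy] at hb
    exact congrArg (formInChart e η y) hb
  have h1 := mfderiv_eq_fderiv_chart (f := fun q => η q (Y q))
    (g := fun z => formInChart e η z (fieldInChart e Y z)) he hp
    (fun z hz => formInChart_fieldInChart he hz Y) (by
      rw [e.right_inv hy]; exact hA.clm_apply hYd) (X (e.symm y))
  have h2 := mfderiv_eq_fderiv_chart (f := fun q => η q (X q))
    (g := fun z => formInChart e η z (fieldInChart e X z)) he hp
    (fun z hz => formInChart_fieldInChart he hz X) (by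
      rw [e.right_inv hy]; exact hA.clm_apply hXd) (Y (e.symm y))
  rw [h1, h2, hb2, e.right_inv hy, fderiv_clm_apply hA hYd, fderiv_clm_apply hA hXd]
  -- By the product rule, the terms in which the fields are differentiated assemble to η of the
  -- bracket and cancel the last summand.
  change fderiv ℝ (formInChart e η) y (fieldInChart e X y) (fieldInChart e Y y) -
    fderiv ℝ (formInChart e η) y (fieldInChart e Y y) (fieldInChart e X y) =
    (formInChart e η y (fderiv ℝ (fieldInChart e Y) y (fieldInChart e X y)) +
      fderiv ℝ (formInChart e η) y (fieldInChart e X y) (fieldInChart e Y y)) -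
    (formInChart e η y (fderiv ℝ (fieldInChart e X) y (fieldInChart e Y y)) +
      fderiv ℝ (formInChart e η) y (fieldInChart e Y y) (fieldInChart e X y)) -
    formInChart e η y (fderiv ℝ (fieldInChart e Y) y (fieldInChart e X y) -
      fderiv ℝ (fieldInChart e X) y (fieldInChart e Y y))
  rw [map_sub]
  abel

/-- The exterior derivative of a 1-form evaluated on vector fields. -/
theorem extDerivOneForm_apply (hη : SmoothOneForm η) {p : M}
    {X Y : (p : M) → TangentSpace (𝓡 m) p} (hX : SmoothFieldAt X p) (hY : SmoothFieldAt Y p) :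
    extDerivOneForm η p (X p) (Y p) =
    mvfderiv (𝓡 m) (fun q => η q (Y q)) p (X p) -
      mvfderiv (𝓡 m) (fun q => η q (X q)) p (Y p) -
      η p (mlieBracket (𝓡 m) X Y p) :=
  fderiv_formInChart_sub (IsManifold.chart_mem_maximalAtlas p) (mem_chart_source (Euc m) p) hη hX hY

end FormsInCharts

/-! ### Brackets of vector fields related by a smooth map. -/

section RelatedFields

open VectorField

/-- Differentiate each relation Df · X = X' ∘ f along the other field; the second derivatives of f
cancel by symmetry. No invertibility of f is needed, so this applies to orbit maps of G as well as
to local equivalences. -/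
theorem fderiv_lieBracket_of_related {E E' : Type*} [NormedAddCommGroup E] [NormedSpace ℝ E]
    [NormedAddCommGroup E'] [NormedSpace ℝ E'] {f : E → E'} {y : E} (hf : ContDiffAt ℝ ∞ f y)
    {X Y : E → E} {X' Y' : E' → E'} (hX : DifferentiableAt ℝ X y) (hY : DifferentiableAt ℝ Y y)
    (hX' : DifferentiableAt ℝ X' (f y)) (hY' : DifferentiableAt ℝ Y' (f y))
    (hfX : ∀ᶠ z in 𝓝 y, fderiv ℝ f z (X z) = X' (f z))
    (hfY : ∀ᶠ z in 𝓝 y, fderiv ℝ f z (Y z) = Y' (f z)) :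
    fderiv ℝ f y (lieBracket ℝ X Y y) = lieBracket ℝ X' Y' (f y) := by
  have hd : DifferentiableAt ℝ f y := hf.differentiableAt (by simp)
  rw [fderiv_apply_lieBracket hf
    (by rw [minSmoothness_of_isRCLikeNormedField]; exact WithTop.coe_le_coe.2 le_top) hY hX]
  have e1 : (fun z => fderiv ℝ f z (X z)) =ᶠ[𝓝 y] X' ∘ f := hfX
  have e2 : (fun z => fderiv ℝ f z (Y z)) =ᶠ[𝓝 y] Y' ∘ f := hfY
  rw [e1.fderiv_eq, e2.fderiv_eq, fderiv_comp _ hX' hd, fderiv_comp _ hY' hd, lieBracket_eq]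
  simp [hfX.self_of_nhds, hfY.self_of_nhds]

variable {m l : ℕ} {M : Type*} [TopologicalSpace M] [ChartedSpace (Euc m) M]
  [IsManifold (𝓡 m) ∞ M] {N : Type*} [TopologicalSpace N] [ChartedSpace (Euc l) N]
  [IsManifold (𝓡 l) ∞ N]

/-- A vector field is, over the domain of the chart, the pullback of its own coordinate expression.
-/
theorem smoothFieldAt_of_fieldInChart {e : OpenPartialHomeomorph M (Euc m)}
    (he : e ∈ IsManifold.maximalAtlas (𝓡 m) ∞ M) {p : M} (hp : p ∈ e.source)
    {X : (p : M) → TangentSpace (𝓡 m) p} (hX : ContDiffAt ℝ ∞ (fieldInChart e X) (e p)) :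
    SmoothFieldAt X p := by
  have h := ContMDiffAt.mpullback_vectorField_preimage (I := 𝓡 m) (I' := 𝓘(ℝ, Euc m))
    (m := ∞) (n := ∞) (f := e) (V := fieldInChart e X)
    (contMDiffAt_vectorSpace_iff_contDiffAt.2 hX)
    (contMDiffAt_of_mem_maximalAtlas he hp) (isInvertible_mfderiv_chart he hp) (by simp)
  refine h.congr_of_eventuallyEq ?_
  filter_upwards [e.open_source.mem_nhds hp] with q hq
  have h1 : fieldInChart e X (e q) = mfderiv (𝓡 m) 𝓘(ℝ, Euc m) e q (X q) := by
    unfold fieldInChart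
    rw [e.left_inv hq]
  have h2 : (mfderiv (𝓡 m) 𝓘(ℝ, Euc m) e q).inverse
      (mfderiv (𝓡 m) 𝓘(ℝ, Euc m) e q (X q)) = X q :=
    (isInvertible_mfderiv_chart he hq).inverse_apply_self _
  have h3 : mpullback (𝓡 m) 𝓘(ℝ, Euc m) e (fieldInChart e X) q = X q := by
    rw [← h2]
    exact congrArg (mfderiv (𝓡 m) 𝓘(ℝ, Euc m) e q).inverse h1
  rw [h3]

/-- Lie brackets of vector fields which are related by a smooth map are related. -/
theorem mfderiv_mlieBracket_of_related {f : M → N} {p : M}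
    (hf : ∀ᶠ q in 𝓝 p, ContMDiffAt (𝓡 m) (𝓡 l) ∞ f q)
    {X Y : (p : M) → TangentSpace (𝓡 m) p} {X' Y' : (q : N) → TangentSpace (𝓡 l) q}
    (hX : ContMDiffAt (𝓡 m) (𝓡 m).tangent 1 (fun q => (⟨q, X q⟩ : TangentBundle (𝓡 m) M)) p)
    (hY : ContMDiffAt (𝓡 m) (𝓡 m).tangent 1 (fun q => (⟨q, Y q⟩ : TangentBundle (𝓡 m) M)) p)
    (hX' : ContMDiffAt (𝓡 l) (𝓡 l).tangent 1
      (fun q => (⟨q, X' q⟩ : TangentBundle (𝓡 l) N)) (f p))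
    (hY' : ContMDiffAt (𝓡 l) (𝓡 l).tangent 1
      (fun q => (⟨q, Y' q⟩ : TangentBundle (𝓡 l) N)) (f p))
    (hfX : ∀ᶠ q in 𝓝 p, mfderiv (𝓡 m) (𝓡 l) f q (X q) = X' (f q))
    (hfY : ∀ᶠ q in 𝓝 p, mfderiv (𝓡 m) (𝓡 l) f q (Y q) = Y' (f q)) :
    mfderiv (𝓡 m) (𝓡 l) f p (mlieBracket (𝓡 m) X Y p) = mlieBracket (𝓡 l) X' Y' (f p) := by
  set φ := chartAt (Euc m) p with hφdef
  set ψ := chartAt (Euc l) (f p) with hψdef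
  have hφ : φ ∈ IsManifold.maximalAtlas (𝓡 m) ∞ M := IsManifold.chart_mem_maximalAtlas p
  have hψ : ψ ∈ IsManifold.maximalAtlas (𝓡 l) ∞ N := IsManifold.chart_mem_maximalAtlas (f p)
  have hp : p ∈ φ.source := mem_chart_source _ p
  have hfp : f p ∈ ψ.source := mem_chart_source _ (f p)
  have hy : φ p ∈ φ.target := φ.map_source hp
  let F : Euc m → Euc l := ψ ∘ f ∘ φ.symm
  have hfn : ∀ᶠ q in 𝓝 p, ContMDiffAt (𝓡 m) (𝓡 l) ∞ f q ∧ f q ∈ ψ.source ∧ q ∈ φ.source := by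
    filter_upwards [hf,
      hf.self_of_nhds.continuousAt.preimage_mem_nhds (ψ.open_source.mem_nhds hfp),
      φ.open_source.mem_nhds hp] with q h1 h2 h3 using ⟨h1, h2, h3⟩
  have hFc : ∀ q, ContMDiffAt (𝓡 m) (𝓡 l) ∞ f q → f q ∈ ψ.source → q ∈ φ.source →
      ContDiffAt ℝ ∞ F (φ q) := by
    intro q h1 h2 h3
    refine ContMDiffAt.contDiffAt ?_
    have h4 := contMDiffAt_symm_of_mem_maximalAtlas hφ (φ.map_source h3)
    have h5 : ContMDiffAt (𝓡 m) (𝓡 l) ∞ f (φ.symm (φ q)) := by rwa [φ.left_inv h3]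
    have h6 : ContMDiffAt (𝓡 l) 𝓘(ℝ, Euc l) ∞ ψ (f (φ.symm (φ q))) := by
      rw [φ.left_inv h3]; exact contMDiffAt_of_mem_maximalAtlas hψ h2
    exact h6.comp (φ q) (h5.comp (φ q) h4)
  have chain : ∀ q, ContMDiffAt (𝓡 m) (𝓡 l) ∞ f q → f q ∈ ψ.source → q ∈ φ.source →
      ∀ ξ : TangentSpace (𝓡 m) q, mfderiv (𝓡 l) 𝓘(ℝ, Euc l) ψ (f q) (mfderiv (𝓡 m) (𝓡 l) f q ξ) =
        fderiv ℝ F (φ q) (mfderiv (𝓡 m) 𝓘(ℝ, Euc m) φ q ξ) := by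
    intro q h1 h2 h3 ξ
    have h4 := mfderiv_eq_fderiv_chart (f := ψ ∘ f) (g := F) hφ h3 (fun y _ => rfl)
      ((hFc q h1 h2 h3).differentiableAt (by simp)) ξ
    rw [← h4]
    have h5 := mfderiv_comp q ((mdifferentiable_of_mem_maximalAtlas hψ).mdifferentiableAt h2)
      (h1.mdifferentiableAt (by simp))
    exact (congrArg (fun T => T ξ) h5).symm
  have hsymm : Filter.Tendsto φ.symm (𝓝 (φ p)) (𝓝 p) := by
    have := φ.continuousAt_symm hy
    rwa [ContinuousAt, φ.left_inv hp] at this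
  have rel : ∀ (X : (p : M) → TangentSpace (𝓡 m) p) (X' : (q : N) → TangentSpace (𝓡 l) q),
      (∀ᶠ q in 𝓝 p, mfderiv (𝓡 m) (𝓡 l) f q (X q) = X' (f q)) →
      ∀ᶠ z in 𝓝 (φ p), fderiv ℝ F z (fieldInChart φ X z) = fieldInChart ψ X' (F z) := by
    intro X X' hXX'
    filter_upwards [hsymm.eventually hfn, hsymm.eventually hXX', φ.open_target.mem_nhds hy]
      with z h1 h2 h3
    have h4 := chain _ h1.1 h1.2.1 h1.2.2 (X (φ.symm z))
    rw [φ.right_inv h3] at h4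
    refine h4.symm.trans ?_
    rw [h2]
    have h5 : ψ.symm (F z) = f (φ.symm z) := ψ.left_inv h1.2.1
    unfold fieldInChart
    rw [h5]
  have hc := hFc p hf.self_of_nhds hfp hp
  have hFp : F (φ p) = ψ (f p) := congrArg (fun q => ψ (f q)) (φ.left_inv hp)
  have h12 : (1 : ℕ∞ω) + 1 ≤ ∞ := WithTop.coe_le_coe.2 le_top
  have hdf : ∀ {X : (p : M) → TangentSpace (𝓡 m) p}, ContMDiffAt (𝓡 m) (𝓡 m).tangent 1
      (fun q => (⟨q, X q⟩ : TangentBundle (𝓡 m) M)) p →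
      DifferentiableAt ℝ (fieldInChart φ X) (φ p) := fun {X} h =>
    (contDiffAt_fieldInChart_of_le hφ hy h12 (by rwa [φ.left_inv hp])).differentiableAt (by simp)
  have hdf' : ∀ {X : (p : N) → TangentSpace (𝓡 l) p}, ContMDiffAt (𝓡 l) (𝓡 l).tangent 1
      (fun q => (⟨q, X q⟩ : TangentBundle (𝓡 l) N)) (f p) →
      DifferentiableAt ℝ (fieldInChart ψ X) (F (φ p)) := fun {X} h => by
    rw [hFp]
    exact (contDiffAt_fieldInChart_of_le hψ (ψ.map_source hfp) h12
      (by rwa [ψ.left_inv hfp])).differentiableAt (by simp)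
  have key := fderiv_lieBracket_of_related hc (hdf hX) (hdf hY) (hdf' hX') (hdf' hY')
    (rel X X' hfX) (rel Y Y' hfY)
  -- The derivative of the chart is injective, so both sides may be compared in coordinates, where
  -- the flat statement applies.
  apply (mdifferentiable_of_mem_maximalAtlas hψ).mfderiv_injective hfp
  rw [mfderiv_mlieBracket_chart hψ hfp (hX'.mdifferentiableAt (by simp))
    (hY'.mdifferentiableAt (by simp)), chain p hf.self_of_nhds hfp hp,
    mfderiv_mlieBracket_chart hφ hp (hX.mdifferentiableAt (by simp))
      (hY.mdifferentiableAt (by simp)), key, hFp]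

/-- A family of linear maps from a fixed finite-dimensional space to the tangent spaces is smooth
if its values on fixed vectors are smooth vector fields. -/
theorem contMDiff_linear_family {W : Type*} [NormedAddCommGroup W] [NormedSpace ℝ W]
    [FiniteDimensional ℝ W] {ρ : (x : M) → W →L[ℝ] TangentSpace (𝓡 m) x}
    (hρ : ∀ w x, SmoothFieldAt (fun x => ρ x w) x) :
    ContMDiff ((𝓡 m).prod 𝓘(ℝ, W)) (𝓡 m).tangent ∞
      (fun q : M × W => (⟨q.1, ρ q.1 q.2⟩ : TangentBundle (𝓡 m) M)) := by
  intro q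
  set t := trivializationAt (Euc m) (TangentSpace (𝓡 m) : M → Type _) q.1 with ht
  have hq : q.1 ∈ t.baseSet := mem_baseSet_trivializationAt _ _ q.1
  rw [Bundle.contMDiffAt_totalSpace]
  refine ⟨contMDiffAt_fst, ?_⟩
  have hcoef : ContMDiffAt (𝓡 m) 𝓘(ℝ, W →L[ℝ] Euc m) ∞
      (fun x => (t.continuousLinearMapAt ℝ x).comp (ρ x)) q.1 := by
    refine contMDiffAt_clm_of_apply fun w => ?_
    have h1 := (Bundle.contMDiffAt_totalSpace.1 (hρ w q.1)).2
    refine h1.congr_of_eventuallyEq ?_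
    filter_upwards [t.open_baseSet.mem_nhds hq] with x hx
    exact Bundle.Trivialization.continuousLinearMapAt_apply_of_mem ℝ t hx (ρ x w)
  have h2 : ContMDiffAt ((𝓡 m).prod 𝓘(ℝ, W)) 𝓘(ℝ, Euc m) ∞
      (fun r : M × W => ((t.continuousLinearMapAt ℝ r.1).comp (ρ r.1)) r.2) q :=
    ContMDiffAt.clm_apply (hcoef.comp q contMDiffAt_fst) contMDiffAt_snd
  refine h2.congr_of_eventuallyEq ?_
  filter_upwards [(t.open_baseSet.preimage continuous_fst).mem_nhds hq] with r hr
  exact (Bundle.Trivialization.continuousLinearMapAt_apply_of_mem ℝ t hr (ρ r.1 r.2)).symm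

end RelatedFields

/-! ### Derivatives of functions along smooth fields. -/

section DerivativeAlongField

variable {m : ℕ} {M : Type*} [TopologicalSpace M] [ChartedSpace (Euc m) M]
  [IsManifold (𝓡 m) ∞ M] {V : Type*} [NormedAddCommGroup V] [NormedSpace ℝ V]

theorem contMDiffAt_mvfderiv_apply {f : M → V} (hf : ContMDiff (𝓡 m) 𝓘(ℝ, V) ∞ f)
    {X : (p : M) → TangentSpace (𝓡 m) p} {p : M} (hX : SmoothFieldAt X p) :
    ContMDiffAt (𝓡 m) 𝓘(ℝ, V) ∞ (fun q => mvfderiv (𝓡 m) f q (X q)) p := by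
  set e := chartAt (Euc m) p
  have he : e ∈ IsManifold.maximalAtlas (𝓡 m) ∞ M := IsManifold.chart_mem_maximalAtlas p
  have hp : p ∈ e.source := mem_chart_source _ p
  have hg : ∀ y ∈ e.target, ContDiffAt ℝ ∞ (f ∘ e.symm) y := fun y hy =>
    ContMDiffAt.contDiffAt ((hf _).comp y (contMDiffAt_symm_of_mem_maximalAtlas he hy))
  have hF : ContDiffAt ℝ ∞ (fieldInChart e X) (e p) :=
    contDiffAt_fieldInChart he (e.map_source hp) (by rwa [e.left_inv hp])
  have h1 : ContDiffAt ℝ ∞ (fun y => fderiv ℝ (f ∘ e.symm) y (fieldInChart e X y)) (e p) :=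
    ((hg _ (e.map_source hp)).fderiv_right (m := ∞) (by simp)).clm_apply hF
  refine (h1.contMDiffAt.comp p (contMDiffAt_of_mem_maximalAtlas he hp)).congr_of_eventuallyEq ?_
  filter_upwards [e.open_source.mem_nhds hp] with q hq
  rw [mfderiv_eq_fderiv_chart he hq (g := f ∘ e.symm) (fun _ _ => rfl)
    ((hg _ (e.map_source hq)).differentiableAt (by simp))]
  have h2 : fieldInChart e X (e q) = mfderiv (𝓡 m) 𝓘(ℝ, Euc m) e q (X q) := by
    unfold fieldInChart
    rw [e.left_inv hq]
  rw [comp_apply, h2]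

end DerivativeAlongField

/-! ### Frame fields, their brackets, and invariance under local equivalences. -/

namespace GStructureWithConnection

open VectorField

variable {n k : ℕ} {G : Type*} [TopologicalSpace G] [ChartedSpace (Euc k) G] [Group G]
  {L : ClosedLinearGroup n k G} {P : Type*} [TopologicalSpace P]
  [ChartedSpace (Euc (n + k)) P] [IsManifold (𝓡 (n + k)) ∞ P] (S : GStructureWithConnection L P)

theorem smooth_coframe : SmoothOneForm S.coframe :=
  ContMDiff.prodMk_space S.smooth_θ S.smooth_conn

@[simp]
theorem coframe_frame (p : P) (w : Euc n × Euc k) : S.coframe p (S.frame p w) = w :=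
  (LinearEquiv.ofBijective (S.coframe p).toLinearMap (S.coframe_bijective p)).apply_symm_apply w

@[simp]
theorem frame_coframe (p : P) (ξ : TangentSpace (𝓡 (n + k)) p) :
    S.frame p (S.coframe p ξ) = ξ :=
  (LinearEquiv.ofBijective (S.coframe p).toLinearMap (S.coframe_bijective p)).symm_apply_apply ξ

/-- The inverse of the coframe as a continuous linear map. -/
def frameL (p : P) : (Euc n × Euc k) →L[ℝ] TangentSpace (𝓡 (n + k)) p :=
  ⟨(S.frame p).toLinearMap, by
    let f : (Euc n × Euc k) →ₗ[ℝ] Euc (n + k) := (S.frame p).toLinearMap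
    exact f.continuous_of_finiteDimensional⟩

section Charts

variable {e : OpenPartialHomeomorph P (Euc (n + k))}

/-- The expression of the coframe in a chart has the frame as its inverse. -/
theorem isInvertible_formInChart_coframe
    (he : e ∈ IsManifold.maximalAtlas (𝓡 (n + k)) ∞ P) {y : Euc (n + k)} (hy : y ∈ e.target) :
    (formInChart e S.coframe y).IsInvertible ∧
    ∀ w, (formInChart e S.coframe y).inverse w = fieldInChart e (fun q => S.frame q w) y := by
  let B : (Euc n × Euc k) →L[ℝ] Euc (n + k) :=
    (mfderiv (𝓡 (n + k)) 𝓘(ℝ, Euc (n + k)) e (e.symm y)).comp (S.frameL (e.symm y))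
  have h1 : (formInChart e S.coframe y).comp B = ContinuousLinearMap.id ℝ _ := by
    refine ContinuousLinearMap.ext fun w => ?_
    exact (formInChart_fieldInChart he hy (fun q => S.frame q w)).trans (S.coframe_frame _ w)
  have h2 : B.comp (formInChart e S.coframe y) = ContinuousLinearMap.id ℝ _ := by
    refine ContinuousLinearMap.ext fun v => ?_
    have h3 : S.frame (e.symm y) (S.coframe (e.symm y)
        (mfderiv 𝓘(ℝ, Euc (n + k)) (𝓡 (n + k)) e.symm y v)) = _ := S.frame_coframe _ _
    exact (congrArg (mfderiv (𝓡 (n + k)) 𝓘(ℝ, Euc (n + k)) e (e.symm y)) h3).trans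
      (mfderiv_chart_mfderiv_symm he hy v)
  refine ⟨⟨ContinuousLinearEquiv.equivOfInverse' _ _ h1 h2, rfl⟩, fun w => ?_⟩
  rw [ContinuousLinearMap.inverse_eq h1 h2]
  rfl

theorem contDiffAt_inverse_formInChart_coframe
    (he : e ∈ IsManifold.maximalAtlas (𝓡 (n + k)) ∞ P) {y : Euc (n + k)} (hy : y ∈ e.target) :
    ContDiffAt ℝ ∞ (fun y => (formInChart e S.coframe y).inverse) y := by
  obtain ⟨⟨E, hE⟩, -⟩ := S.isInvertible_formInChart_coframe he hy
  have h1 : ContDiffAt ℝ ∞ ContinuousLinearMap.inverse (formInChart e S.coframe y) := by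
    rw [← hE]
    exact contDiffAt_map_inverse E
  exact h1.comp y (contDiffAt_formInChart he hy S.smooth_coframe)

end Charts

/-- In a chart the frame is the inverse of the coframe, and inversion of linear maps is smooth. -/
theorem smoothFieldAt_frame {s : P → Euc n × Euc k} {p : P}
    (hs : ContMDiffAt (𝓡 (n + k)) 𝓘(ℝ, Euc n × Euc k) ∞ s p) :
    SmoothFieldAt (fun q => S.frame q (s q)) p := by
  set e := chartAt (Euc (n + k)) p
  have he : e ∈ IsManifold.maximalAtlas (𝓡 (n + k)) ∞ P := IsManifold.chart_mem_maximalAtlas p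
  have hp : p ∈ e.source := mem_chart_source _ p
  refine smoothFieldAt_of_fieldInChart he hp ?_
  have hs' : ContDiffAt ℝ ∞ (s ∘ e.symm) (e p) := by
    refine ContMDiffAt.contDiffAt (ContMDiffAt.comp (e p) ?_
      (contMDiffAt_symm_of_mem_maximalAtlas he (e.map_source hp)))
    rwa [e.left_inv hp]
  refine ((S.contDiffAt_inverse_formInChart_coframe he (e.map_source hp)).clm_apply
    hs').congr_of_eventuallyEq ?_
  filter_upwards [e.open_target.mem_nhds (e.map_source hp)] with y hy
  exact ((S.isInvertible_formInChart_coframe he hy).2 (s (e.symm y))).symm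

theorem smoothFieldAt_frame_const (w : Euc n × Euc k) (p : P) :
    SmoothFieldAt (fun q => S.frame q w) p :=
  S.smoothFieldAt_frame contMDiffAt_const

/-- The bracket of `W`-valued functions on `P`, seen as vector fields through the coframe. -/
def frameBracket (s t : P → Euc n × Euc k) (p : P) : Euc n × Euc k :=
  S.coframe p (mlieBracket (𝓡 (n + k)) (fun q => S.frame q (s q)) (fun q => S.frame q (t q)) p)

/-- On frame fields with constant coefficients the form has constant values, so only the bracket
term of Cartan's formula survives. The map π selects θ or ω. -/
theorem extDerivOneForm_coframe_const {V : Type*} [NormedAddCommGroup V] [NormedSpace ℝ V]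
    (π : Euc n × Euc k →L[ℝ] V) (w z : Euc n × Euc k) (p : P)
    {η : (p : P) → TangentSpace (𝓡 (n + k)) p →L[ℝ] V} (hη : SmoothOneForm η)
    (hπ : ∀ p, η p = π.comp (S.coframe p)) :
    extDerivOneForm η p (S.frame p w) (S.frame p z) =
      -π (S.frameBracket (fun _ => w) (fun _ => z) p) := by
  have h := extDerivOneForm_apply hη (S.smoothFieldAt_frame_const w p)
    (S.smoothFieldAt_frame_const z p)
  have hc : ∀ w : Euc n × Euc k, (fun q => η q (S.frame q w)) = fun _ => π w := by
    intro w
    funext q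
    rw [hπ]
    exact congrArg π (S.coframe_frame q w)
  have h0 : ∀ w : Euc n × Euc k, mvfderiv (𝓡 (n + k)) (fun q => η q (S.frame q w)) p = 0 := by
    intro w
    rw [hc]
    exact mfderiv_const
  rw [h0, h0] at h
  refine h.trans ?_
  rw [hπ]
  simp [frameBracket]

theorem frameBracket_horizontal (u v : Euc n) (p : P) :
    S.frameBracket (fun _ => (u, 0)) (fun _ => (v, 0)) p =
      (-S.torsion p u v, -S.curvature p u v) := by
  have h1 := S.extDerivOneForm_coframe_const (ContinuousLinearMap.fst ℝ _ _) (u, 0) (v, 0) p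
    S.smooth_θ (fun _ => rfl)
  have h2 := S.extDerivOneForm_coframe_const (ContinuousLinearMap.snd ℝ _ _) (u, 0) (v, 0) p
    S.smooth_conn (fun _ => rfl)
  unfold torsion curvature
  rw [h1, h2]
  simp

theorem contMDiff_frameBracket {s t : P → Euc n × Euc k}
    (hs : ContMDiff (𝓡 (n + k)) 𝓘(ℝ, Euc n × Euc k) ∞ s)
    (ht : ContMDiff (𝓡 (n + k)) 𝓘(ℝ, Euc n × Euc k) ∞ t) :
    ContMDiff (𝓡 (n + k)) 𝓘(ℝ, Euc n × Euc k) ∞ (S.frameBracket s t) := fun p =>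
  -- Smoothness of the bracket is stated for a manifold of class n + 1; for n = ⊤ this is again
  -- class ∞.
  haveI : IsManifold (𝓡 (n + k)) ((⊤ : ℕ∞) + 1) P := by
    change IsManifold (𝓡 (n + k)) ∞ P
    infer_instance
  S.smooth_coframe.apply_field (X := mlieBracket (𝓡 (n + k)) (fun q => S.frame q (s q))
    (fun q => S.frame q (t q))) (ContMDiffAt.mlieBracket_vectorField (n := (⊤ : ℕ∞)) (m := (⊤ : ℕ∞))
      (S.smoothFieldAt_frame (hs p)) (S.smoothFieldAt_frame (ht p))
      (by rw [minSmoothness_of_isRCLikeNormedField]; simp))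

/-! ### Invariant maps -/

/-- Smooth maps to a vector space which are preserved by all local equivalences. -/
structure IsInvariantMap {V : Type*} [NormedAddCommGroup V] [NormedSpace ℝ V] (J : P → V) :
    Prop where
  contMDiff : ContMDiff (𝓡 (n + k)) 𝓘(ℝ, V) ∞ J
  invariant : ∀ Φ : OpenPartialHomeomorph P P, S.IsLocalEquivalence Φ →
    ∀ p ∈ Φ.source, J (Φ p) = J p

variable {S}

theorem IsLocalEquivalence.coframe_mfderiv {Φ : OpenPartialHomeomorph P P}
    (hΦ : S.IsLocalEquivalence Φ) {p : P} (hp : p ∈ Φ.source) (ξ : TangentSpace (𝓡 (n + k)) p) :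
    S.coframe (Φ p) (mfderiv (𝓡 (n + k)) (𝓡 (n + k)) Φ p ξ) = S.coframe p ξ :=
  Prod.ext (hΦ.map_θ p hp ξ) (hΦ.map_conn p hp ξ)

/-- Preserving the coframe is the same as preserving the dual frame fields. All invariance
statements below rest on this. -/
theorem IsLocalEquivalence.mfderiv_frame {Φ : OpenPartialHomeomorph P P}
    (hΦ : S.IsLocalEquivalence Φ) {p : P} (hp : p ∈ Φ.source) (w : Euc n × Euc k) :
    mfderiv (𝓡 (n + k)) (𝓡 (n + k)) Φ p (S.frame p w) = S.frame (Φ p) w := by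
  rw [← S.frame_coframe (Φ p) (mfderiv (𝓡 (n + k)) (𝓡 (n + k)) Φ p (S.frame p w)),
    hΦ.coframe_mfderiv hp, S.coframe_frame]

variable {V : Type*} [NormedAddCommGroup V] [NormedSpace ℝ V]

/-- Differentiate J ∘ Φ = J and use that Φ carries the field frame(s) to itself. -/
theorem IsInvariantMap.mvfderiv_frame {J : P → V} (hJ : S.IsInvariantMap J)
    {s : P → Euc n × Euc k} (hs : S.IsInvariantMap s) :
    S.IsInvariantMap (fun p => mvfderiv (𝓡 (n + k)) J p (S.frame p (s p))) := by
  refine ⟨fun p => contMDiffAt_mvfderiv_apply hJ.contMDiff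
    (S.smoothFieldAt_frame (hs.contMDiff p)), fun Φ hΦ p hp => ?_⟩
  have h1 : J ∘ Φ =ᶠ[𝓝 p] J := by
    filter_upwards [Φ.open_source.mem_nhds hp] with q hq using hJ.invariant Φ hΦ q hq
  have h2 := mfderiv_comp p ((hJ.contMDiff (Φ p)).mdifferentiableAt (by simp))
    (hΦ.mdifferentiableAt hp)
  rw [h1.mfderiv_eq] at h2
  have h3 := congrArg (fun T => T (S.frame p (s p))) h2
  rw [hs.invariant Φ hΦ p hp, ← hΦ.mfderiv_frame hp]
  exact h3.symm

/-- A local equivalence relates each of the two fields to itself, hence also their bracket. For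
constant s and t this is the invariance of the structure functions. -/
theorem IsInvariantMap.frameBracket {s t : P → Euc n × Euc k} (hs : S.IsInvariantMap s)
    (ht : S.IsInvariantMap t) : S.IsInvariantMap (S.frameBracket s t) := by
  refine ⟨S.contMDiff_frameBracket hs.contMDiff ht.contMDiff, fun Φ hΦ p hp => ?_⟩
  have hr : ∀ {s : P → Euc n × Euc k}, S.IsInvariantMap s → ∀ᶠ q in 𝓝 p,
      mfderiv (𝓡 (n + k)) (𝓡 (n + k)) Φ q (S.frame q (s q)) = S.frame (Φ q) (s (Φ q)) := by
    intro s hs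
    filter_upwards [Φ.open_source.mem_nhds hp] with q hq
    rw [hΦ.mfderiv_frame hq, hs.invariant Φ hΦ q hq]
  have h1 : (1 : ℕ∞ω) ≤ ∞ := WithTop.coe_le_coe.2 le_top
  have h := mfderiv_mlieBracket_of_related (f := Φ) (p := p)
    (X' := fun q => S.frame q (s q)) (Y' := fun q => S.frame q (t q))
    (by filter_upwards [Φ.open_source.mem_nhds hp] with q hq
        exact hΦ.contMDiffOn.contMDiffAt (Φ.open_source.mem_nhds hq))
    ((S.smoothFieldAt_frame (hs.contMDiff p)).of_le h1)
    ((S.smoothFieldAt_frame (ht.contMDiff p)).of_le h1)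
    ((S.smoothFieldAt_frame (hs.contMDiff _)).of_le h1)
    ((S.smoothFieldAt_frame (ht.contMDiff _)).of_le h1)
    (hr hs) (hr ht)
  unfold GStructureWithConnection.frameBracket
  rw [← h, hΦ.coframe_mfderiv hp]

theorem isInvariantMap_const (c : V) : S.IsInvariantMap (fun _ => c) :=
  ⟨contMDiff_const, fun _ _ _ _ => rfl⟩

theorem IsInvariantMap.clm_comp {V' : Type*} [NormedAddCommGroup V'] [NormedSpace ℝ V']
    {J : P → V} (hJ : S.IsInvariantMap J) (T : V →L[ℝ] V') :
    S.IsInvariantMap (fun p => T (J p)) :=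
  ⟨T.contMDiff.comp hJ.contMDiff, fun Φ hΦ p hp => congrArg T (hJ.invariant Φ hΦ p hp)⟩

theorem IsInvariantMap.eq_of_locallyEquivalent {J : P → V} (hJ : S.IsInvariantMap J) {p q : P}
    (h : S.LocallyEquivalent p q) : J p = J q := by
  obtain ⟨Φ, hΦ, hp, rfl⟩ := h
  exact (hJ.invariant Φ hΦ p hp).symm

theorem isInvariantFunction_iff {I : P → ℝ} : S.IsInvariantFunction I ↔ S.IsInvariantMap I :=
  ⟨fun h => ⟨h.1, h.2⟩, fun h => ⟨h.1, h.2⟩⟩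

end GStructureWithConnection

/-! ### Cartan's local equivalence theorem for coframes in a vector space. -/

section FlatCoframes

variable {E W Z : Type*} [NormedAddCommGroup E] [NormedSpace ℝ E]
  [NormedAddCommGroup W] [NormedSpace ℝ W] [NormedAddCommGroup Z] [NormedSpace ℝ Z]

/-- The equation `DΦ(x) = η(Φ(x))⁻¹ η(x)` for maps preserving a coframe `η` is integrable on the
set where `π x = π (Φ x)` if the structure functions of `η` factor through `π`. -/
theorem fderiv_inverse_comp_symm {η : E → E →L[ℝ] W} {T : Set E} (hT : IsOpen T)
    (hη : ContDiffOn ℝ ∞ η T) (hinv : ∀ y ∈ T, (η y).IsInvertible)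
    (hηi : ∀ y ∈ T, ContDiffAt ℝ ∞ (fun y => (η y).inverse) y) {c : W → W → W} {x y : E}
    (hx : x ∈ T) (hy : y ∈ T)
    (hcx : ∀ v w, fderiv ℝ η x v w - fderiv ℝ η x w v = c (η x v) (η x w))
    (hcy : ∀ v w, fderiv ℝ η y v w - fderiv ℝ η y w v = c (η y v) (η y w)) (v w : E) :
    fderiv ℝ (fun p : E × E => (η p.2).inverse.comp (η p.1)) (x, y)
        (v, (η y).inverse (η x v)) w =
      fderiv ℝ (fun p : E × E => (η p.2).inverse.comp (η p.1)) (x, y)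
        (w, (η y).inverse (η x w)) v := by
  set U : E × E → E →L[ℝ] E := fun p => (η p.2).inverse.comp (η p.1) with hUdef
  have hηd : ∀ z ∈ T, HasFDerivAt η (fderiv ℝ η z) z := fun z hz =>
    ((hη.contDiffAt (hT.mem_nhds hz)).differentiableAt (by simp)).hasFDerivAt
  have hUd : HasFDerivAt U (fderiv ℝ U (x, y)) (x, y) := by
    refine DifferentiableAt.hasFDerivAt ?_
    have h1 : DifferentiableAt ℝ (fun p : E × E => (η p.2).inverse) (x, y) :=
      DifferentiableAt.comp (x, y) (g := fun y => (η y).inverse)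
        ((hηi y hy).differentiableAt (by simp)) differentiableAt_snd
    have h2 : DifferentiableAt ℝ (fun p : E × E => η p.1) (x, y) :=
      DifferentiableAt.comp (x, y) (g := η) (hηd x hx).differentiableAt differentiableAt_fst
    exact h1.clm_comp h2
  -- This is the derivative of the identity η(y) U(x, y) w = η(x) w in the direction (v, U v).
  have key : ∀ v w, fderiv ℝ η y (U (x, y) v) (U (x, y) w) +
      η y (fderiv ℝ U (x, y) (v, U (x, y) v) w) = fderiv ℝ η x v w := by
    intro v w
    have h1 : HasFDerivAt (fun p : E × E => η p.2)
        ((fderiv ℝ η y).comp (ContinuousLinearMap.snd ℝ E E)) (x, y) :=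
      HasFDerivAt.comp (x, y) (g := η) (hηd y hy) hasFDerivAt_snd
    have h2 : HasFDerivAt (fun p : E × E => η p.1)
        ((fderiv ℝ η x).comp (ContinuousLinearMap.fst ℝ E E)) (x, y) :=
      HasFDerivAt.comp (x, y) (g := η) (hηd x hx) hasFDerivAt_fst
    have h3 := h1.clm_apply (hUd.clm_apply (hasFDerivAt_const w (x, y)))
    have h4 := h2.clm_apply (hasFDerivAt_const w (x, y))
    have h5 : (fun p : E × E => η p.2 (U p w)) =ᶠ[𝓝 (x, y)] fun p => η p.1 w := by
      filter_upwards [(hT.preimage continuous_snd).mem_nhds (show (x, y) ∈ _ from hy)] with p hp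
      exact (hinv _ hp).self_apply_inverse _
    have h6 := congrArg (fun A => A (v, U (x, y) v)) (h4.unique (h3.congr_of_eventuallyEq h5.symm))
    simp at h6
    rw [h6, add_comm]
  have hu : ∀ v, η y (U (x, y) v) = η x v := fun v => (hinv y hy).self_apply_inverse _
  have hinj : Injective (η y) := (hinv y hy).injective
  apply hinj
  have e1 := key v w
  have e2 := key w v
  have e3 := hcx v w
  have e4 := hcy (U (x, y) v) (U (x, y) w)
  rw [hu, hu, ← e3] at e4
  change η y (fderiv ℝ U (x, y) (v, U (x, y) v) w) = η y (fderiv ℝ U (x, y) (w, U (x, y) w) v)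
  rw [← sub_eq_zero]
  -- Antisymmetrised, `key` expresses the integrability defect as dη at x minus dη at y on
  -- corresponding vectors; both equal the same value of c.
  have : η y (fderiv ℝ U (x, y) (v, U (x, y) v) w) - η y (fderiv ℝ U (x, y) (w, U (x, y) w) v) =
    (fderiv ℝ η x v w - fderiv ℝ η x w v) - (fderiv ℝ η y (U (x, y) v) (U (x, y) w) -
      fderiv ℝ η y (U (x, y) w) (U (x, y) v)) := by
    rw [← e1, ← e2]; abel
  rw [this, e4, sub_self]

/-- Cartan's local equivalence theorem: if the structure functions of a coframe `η`, and the
derivatives of the linear map `π` with respect to `η`, factor through `π`, then points with the same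
image under `π` are related by a local diffeomorphism preserving `η`. -/
theorem exists_openPartialHomeomorph_coframe [CompleteSpace E] {η : E → E →L[ℝ] W} {T : Set E}
    (hT : IsOpen T)
    (hη : ContDiffOn ℝ ∞ η T) (hinv : ∀ y ∈ T, (η y).IsInvertible)
    (hηi : ∀ y ∈ T, ContDiffAt ℝ ∞ (fun y => (η y).inverse) y)
    (π : E →L[ℝ] Z) {κ : Z → W →L[ℝ] Z} {c : Z → W → W → W}
    (hκ : ∀ y ∈ T, ContDiffAt ℝ 1 κ (π y))
    (hκπ : ∀ y ∈ T, ∀ w, π ((η y).inverse w) = κ (π y) w)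
    (hc : ∀ y ∈ T, ∀ v w, fderiv ℝ η y v w - fderiv ℝ η y w v = c (π y) (η y v) (η y w))
    {x₀ y₀ : E} (hx₀ : x₀ ∈ T) (hy₀ : y₀ ∈ T) (hπ : π x₀ = π y₀) :
    ∃ Φ : OpenPartialHomeomorph E E, x₀ ∈ Φ.source ∧ Φ x₀ = y₀ ∧ Φ.source ⊆ T ∧ Φ.target ⊆ T ∧
      ContDiffOn ℝ ∞ Φ Φ.source ∧ ContDiffOn ℝ ∞ Φ.symm Φ.target ∧
      ∀ x ∈ Φ.source, ∀ v, η (Φ x) (fderiv ℝ Φ x v) = η x v := by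
  set U : E × E → E →L[ℝ] E := fun p => (η p.2).inverse.comp (η p.1) with hUdef
  have hUc : ContDiffOn ℝ ∞ U (T ×ˢ T) := by
    intro p hp
    refine ContDiffAt.contDiffWithinAt ?_
    have h1 : ContDiffAt ℝ ∞ (fun p : E × E => (η p.2).inverse) p :=
      ContDiffAt.comp p (g := fun y => (η y).inverse) (hηi _ hp.2) contDiffAt_snd
    have h2 : ContDiffAt ℝ ∞ (fun p : E × E => η p.1) p :=
      ContDiffAt.comp p (g := η) (hη.contDiffAt (hT.mem_nhds hp.1)) contDiffAt_fst
    exact h1.clm_comp h2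
  have hTT : T ×ˢ T ∈ 𝓝 (x₀, y₀) := prod_mem_nhds (hT.mem_nhds hx₀) (hT.mem_nhds hy₀)
  -- `J` measures the failure of Φ to preserve π; integrability is only known on its zero set.
  set J : E × E →L[ℝ] Z := π.comp (ContinuousLinearMap.snd ℝ E E) -
    π.comp (ContinuousLinearMap.fst ℝ E E) with hJdef
  have hJ : ∀ x y, J (x, y) = π y - π x := fun x y => by simp [J]
  obtain ⟨K, t, ht, hK⟩ := (hκ x₀ hx₀).exists_lipschitzOnWith
  have hηb : ∀ᶠ x in 𝓝 x₀, ‖η x‖ < ‖η x₀‖ + 1 :=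
    (hη.contDiffAt (hT.mem_nhds hx₀)).continuousAt.norm.eventually_lt_const (lt_add_one _)
  have hf : Filter.Tendsto (fun p : E × E => p.1) (𝓝 (x₀, y₀)) (𝓝 x₀) := continuousAt_fst
  have hs : Filter.Tendsto (fun p : E × E => p.2) (𝓝 (x₀, y₀)) (𝓝 y₀) := continuousAt_snd
  -- Along the equation the derivative of `J` is (κ(π y) - κ(π x)) η(x)v. The local Lipschitz
  -- constant of κ and a bound for η give the factor.
  have hJU : ∀ᶠ p in 𝓝 (x₀, y₀), ∀ v,
      ‖fderiv ℝ J p (v, U p v)‖ ≤ (K * (‖η x₀‖ + 1)) * ‖J p‖ * ‖v‖ := by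
    filter_upwards [hTT, hf.eventually hηb,
      hf.eventually (π.continuous.continuousAt.preimage_mem_nhds ht),
      hs.eventually (π.continuous.continuousAt.preimage_mem_nhds (hπ ▸ ht))]
      with p hp h1 h2 h3 v
    rw [ContinuousLinearMap.fderiv, hJ]
    have e1 : π (U p v) = κ (π p.2) (η p.1 v) := hκπ _ hp.2 _
    have e2 : π v = κ (π p.1) (η p.1 v) := by
      rw [← hκπ _ hp.1, (hinv _ hp.1).inverse_apply_self]
    have h4 : ‖κ (π p.2) - κ (π p.1)‖ ≤ K * ‖J p‖ := by
      have := hK.dist_le_mul _ h3 _ h2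
      rwa [dist_eq_norm, dist_eq_norm, ← hJ p.1 p.2] at this
    rw [e1, e2, ← sub_apply]
    calc ‖(κ (π p.2) - κ (π p.1)) (η p.1 v)‖ ≤ ‖κ (π p.2) - κ (π p.1)‖ * (‖η p.1‖ * ‖v‖) :=
          (ContinuousLinearMap.le_opNorm _ _).trans
            (mul_le_mul_of_nonneg_left (ContinuousLinearMap.le_opNorm _ _) (norm_nonneg _))
      _ ≤ (K * ‖J p‖) * ((‖η x₀‖ + 1) * ‖v‖) := by gcongr
      _ = _ := by ring
  have hint : ∀ᶠ p in 𝓝 (x₀, y₀), J p = 0 → ∀ v w,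
      fderiv ℝ U p (v, U p v) w = fderiv ℝ U p (w, U p w) v := by
    filter_upwards [hTT] with p hp h0 v w
    have h1 : π p.2 = π p.1 := sub_eq_zero.1 ((hJ p.1 p.2).symm.trans h0)
    exact fderiv_inverse_comp_symm hT hη hinv hηi hp.1 hp.2 (hc _ hp.1)
      (fun v w => by rw [hc _ hp.2, h1]) v w
  obtain ⟨φ, hφ0, hφ⟩ := exists_hasFDerivAt_total
    ((hUc.contDiffAt hTT).of_le (WithTop.coe_le_coe.2 le_top)) (J := J)
    (Filter.Eventually.of_forall fun p => J.differentiableAt) (by rw [hJ, hπ, sub_self]) hJU hint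
  have hφc : ContinuousAt φ x₀ := hφ.self_of_nhds.continuousAt
  have hφT : ∀ᶠ x in 𝓝 x₀, φ x ∈ T := hφc.preimage_mem_nhds (hT.mem_nhds (hφ0 ▸ hy₀))
  obtain ⟨s, hs, hso, hxs⟩ := eventually_nhds_iff.1 ((hφ.and hφT).and (hT.mem_nhds hx₀))
  have hφs : ContDiffOn ℝ ∞ φ s := contDiffOn_of_hasFDerivAt_total hso hUc
    (fun x hx => ⟨(hs x hx).2, (hs x hx).1.2⟩) fun x hx => (hs x hx).1.1
  -- The derivative of the solution is a composite of invertible coframe values, so the solution is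
  -- a local diffeomorphism.
  have hUi : (U (x₀, φ x₀)).IsInvertible :=
    (hinv _ (hs x₀ hxs).1.2).inverse.comp (hinv _ (hs x₀ hxs).2)
  obtain ⟨A, hA⟩ := hUi
  obtain ⟨Φ, h1, h2, h3, h4⟩ := exists_openPartialHomeomorph_of_contDiffOn hso hφs hxs A
    (hA ▸ (hs x₀ hxs).1.1)
  have h3' : ⇑Φ = φ := funext h3
  refine ⟨Φ, h1, by rw [h3', hφ0], fun x hx => (hs x (h2 hx)).2, fun y hy => ?_,
    by rw [h3']; exact hφs.mono h2, h4, fun x hx v => ?_⟩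
  · rw [← Φ.right_inv hy, h3]
    exact (hs _ (h2 (Φ.map_target hy))).1.2
  · rw [h3', (hs x (h2 hx)).1.1.fderiv]
    exact (hinv _ (hs x (h2 hx)).1.2).self_apply_inverse _

end FlatCoframes

/-! ### Linear algebra of independent functionals. -/

section LinearAlgebra

variable {E : Type*} [AddCommGroup E] [Module ℝ E] [TopologicalSpace E] {d : ℕ}

/-- A nonzero functional vanishing on the range would be a linear relation between the components.
-/
theorem surjective_of_linearIndependent {A : E →L[ℝ] Euc d}
    (h : LinearIndependent ℝ (fun i => (EuclideanSpace.proj i : Euc d →L[ℝ] ℝ).comp A)) :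
    Surjective A := by
  rw [← ContinuousLinearMap.coe_coe, ← LinearMap.range_eq_top]
  by_contra hne
  obtain ⟨f, hf, hfr⟩ := Submodule.exists_le_ker_of_lt_top _ (lt_top_iff_ne_top.2 hne)
  apply hf
  have hb : ∀ x : Euc d, f x = ∑ i, x i * f (EuclideanSpace.single i 1) := by
    intro x
    conv_lhs => rw [← (EuclideanSpace.basisFun (Fin d) ℝ).sum_repr x]
    simp
  have h0 : ∑ i, f (EuclideanSpace.single i 1) •
      ((EuclideanSpace.proj i : Euc d →L[ℝ] ℝ).comp A) = 0 := by
    ext v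
    have h1 : f (A v) = 0 := hfr ⟨v, rfl⟩
    rw [hb] at h1
    rw [sum_apply]
    simpa [mul_comm] using h1
  have h2 := Fintype.linearIndependent_iff.1 h _ h0
  refine (EuclideanSpace.basisFun (Fin d) ℝ).toBasis.ext fun i => ?_
  simpa using h2 i

/-- If the components of a surjective map `A` onto `ℝᵈ` lie in a `d`-dimensional space of
functionals, then every functional in this space vanishes on the kernel of `A`. -/
theorem apply_eq_zero_of_mem_of_finrank_eq {A : E →L[ℝ] Euc d} (hA : Surjective A)
    {Λ : Submodule ℝ (E →L[ℝ] ℝ)} [FiniteDimensional ℝ Λ] (hΛ : Module.finrank ℝ Λ = d)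
    (hmem : ∀ i, (EuclideanSpace.proj i : Euc d →L[ℝ] ℝ).comp A ∈ Λ) {φ : E →L[ℝ] ℝ} (hφ : φ ∈ Λ)
    {v : E} (hv : A v = 0) : φ v = 0 := by
  set b : Fin d → (E →L[ℝ] ℝ) := fun i => (EuclideanSpace.proj i : Euc d →L[ℝ] ℝ).comp A with hb
  have hli : LinearIndependent ℝ b := by
    rw [Fintype.linearIndependent_iff]
    intro g hg i
    obtain ⟨w, hw⟩ := hA (EuclideanSpace.single i 1)
    have h1 := congrArg (fun T => T w) hg
    simp only [sum_apply] at h1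
    simpa [b, hw] using h1
  have hle : Submodule.span ℝ (range b) ≤ Λ := by
    rw [Submodule.span_le]
    rintro _ ⟨i, rfl⟩
    exact hmem i
  -- The d components are independent, so by dimension they span Λ.
  have heq : Submodule.span ℝ (range b) = Λ := by
    refine Submodule.eq_of_le_of_finrank_eq hle ?_
    rw [finrank_span_eq_card hli, hΛ, Fintype.card_fin]
  rw [← heq] at hφ
  induction hφ using Submodule.span_induction with
  | mem x hx =>
    obtain ⟨i, rfl⟩ := hx
    simp [b, hv]
  | zero => rfl
  | add x y _ _ hx hy => rw [add_apply, hx, hy, add_zero]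
  | smul a x _ hx => rw [smul_apply, hx, smul_zero]

/-- A surjective linear map `ℝᵐ → ℝᵈ` is a projection in suitable linear coordinates. -/
theorem exists_continuousLinearEquiv_fst {m : ℕ} {A : Euc m →L[ℝ] Euc d} (hA : Surjective A) :
    ∃ e : Euc m ≃L[ℝ] Euc d × Euc (m - d), ∀ v, (e v).1 = A v := by
  obtain ⟨Q, hQ⟩ := A.ker.exists_isCompl
  have hAr : A.range = ⊤ := LinearMap.range_eq_top.2 hA
  let q : Euc m →L[ℝ] A.ker := LinearMap.toContinuousLinearMap (A.ker.projectionOnto Q hQ)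
  have hqr : q.range = ⊤ := by
    exact Submodule.range_projectionOnto hQ
  have hqk : IsCompl A.ker q.ker := by
    have : q.ker = Q := Submodule.ker_projectionOnto hQ
    rw [this]
    exact hQ
  let e₁ := ContinuousLinearMap.equivProdOfSurjectiveOfIsCompl A q hAr hqr hqk
  -- Surjectivity forces d ≤ m, so the truncated difference is the true dimension of the kernel.
  have hdim : Module.finrank ℝ A.ker = Module.finrank ℝ (Euc (m - d)) := by
    have h1 := LinearMap.finrank_range_add_finrank_ker (A : Euc m →ₗ[ℝ] Euc d)
    have h2 : Module.finrank ℝ (LinearMap.range (A : Euc m →ₗ[ℝ] Euc d)) = d := by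
      rw [show LinearMap.range (A : Euc m →ₗ[ℝ] Euc d) = ⊤ from hAr]; simp
    rw [h2] at h1
    simp at h1 ⊢
    omega
  exact ⟨e₁.trans ((ContinuousLinearEquiv.refl ℝ (Euc d)).prodCongr
    (ContinuousLinearEquiv.ofFinrankEq hdim)), fun v => rfl⟩

end LinearAlgebra

/-! ### Adapted charts built from independent invariants. -/

namespace GStructureWithConnection

variable {n k : ℕ} {G : Type*} [TopologicalSpace G] [ChartedSpace (Euc k) G] [Group G]
  {L : ClosedLinearGroup n k G} {P : Type*} [TopologicalSpace P]
  [ChartedSpace (Euc (n + k)) P] [IsManifold (𝓡 (n + k)) ∞ P] (S : GStructureWithConnection L P)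

/-- A chart of `P` onto a product of two balls in which an invariant map, whose differential has
a kernel annihilated by all invariants, is the projection to the first factor. -/
structure InvariantBox (d : ℕ) where
  /-- the chart -/
  chart : OpenPartialHomeomorph P (Euc (n + k))
  mem_maximalAtlas : chart ∈ IsManifold.maximalAtlas (𝓡 (n + k)) ∞ P
  /-- the linear coordinates -/
  coord : Euc (n + k) ≃L[ℝ] Euc d × Euc (n + k - d)
  /-- the invariant map -/
  inv : P → Euc d
  isInvariantMap_inv : S.IsInvariantMap inv
  /-- the centre of the first ball -/
  ctr : Euc d
  /-- the centre of the second ball -/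
  ctr' : Euc (n + k - d)
  /-- the radius of the balls -/
  r : ℝ
  r_pos : 0 < r
  fst_coord : ∀ q ∈ chart.source, (coord (chart q)).1 = inv q
  target_eq : chart.target = coord ⁻¹' (Metric.ball ctr r ×ˢ Metric.ball ctr' r)
  ker_le : ∀ q ∈ chart.source, ∀ J : P → ℝ, S.IsInvariantMap J → ∀ ξ : TangentSpace (𝓡 (n + k)) q,
    mvfderiv (𝓡 (n + k)) inv q ξ = 0 → mvfderiv (𝓡 (n + k)) J q ξ = 0

variable {S} {d : ℕ}

theorem isInvariantMap_toLp {J : Fin d → P → ℝ} (hJ : ∀ i, S.IsInvariantMap (J i)) :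
    S.IsInvariantMap (fun p => (WithLp.toLp 2 (fun i => J i p) : Euc d)) := by
  refine ⟨?_, fun Φ hΦ p hp => ?_⟩
  · have h : ContMDiff (𝓡 (n + k)) 𝓘(ℝ, Fin d → ℝ) ∞ (fun p i => J i p) :=
      contMDiff_pi_space.2 fun i => (hJ i).contMDiff
    exact (PiLp.continuousLinearEquiv 2 ℝ (fun _ : Fin d => ℝ)).symm.contDiff.contMDiff.comp h
  · simp only [(hJ _).invariant Φ hΦ p hp]

theorem proj_mvfderiv_toLp {J : Fin d → P → ℝ} (hJ : ∀ i, S.IsInvariantMap (J i)) (p : P)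
    (i : Fin d) :
    (EuclideanSpace.proj i : Euc d →L[ℝ] ℝ).comp
        (mvfderiv (𝓡 (n + k)) (fun p => (WithLp.toLp 2 (fun i => J i p) : Euc d)) p) =
      mvfderiv (𝓡 (n + k)) (J i) p := by
  have h := mfderiv_comp p
    ((EuclideanSpace.proj i : Euc d →L[ℝ] ℝ).differentiableAt.mdifferentiableAt)
    (((isInvariantMap_toLp hJ).contMDiff p).mdifferentiableAt (by simp))
  rw [mfderiv_eq_fderiv, ContinuousLinearMap.fderiv] at h
  exact h.symm

/-- Take d invariants whose differentials form a basis of the invariant differentials at p₀ and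
straighten the submersion they define. It remains a submersion on the whole box. As the rank is d at
every point, its differential spans all invariant differentials there, not only at p₀. -/
theorem exists_invariantBox (hS : S.IsFullyRegular d) (p₀ : P) :
    ∃ B : S.InvariantBox d, p₀ ∈ B.chart.source := by
  classical
  have hfin : ∀ p : P, FiniteDimensional ℝ (S.invariantDifferentials p) := fun p =>
    have : FiniteDimensional ℝ (TangentSpace (𝓡 (n + k)) p →L[ℝ] ℝ) :=
      inferInstanceAs (FiniteDimensional ℝ (Euc (n + k) →L[ℝ] ℝ))
    inferInstance
  let D : Set (TangentSpace (𝓡 (n + k)) p₀ →L[ℝ] ℝ) := {φ | ∃ I : P → ℝ,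
    S.IsInvariantFunction I ∧ φ = mfderiv (𝓡 (n + k)) 𝓘(ℝ, ℝ) I p₀}
  have : FiniteDimensional ℝ (Submodule.span ℝ D) := hfin p₀
  obtain ⟨f, hf, -, hli⟩ := Submodule.exists_fun_fin_finrank_span_eq ℝ D
  have hd : Module.finrank ℝ (Submodule.span ℝ D) = d := hS p₀
  choose J' hJ' hfJ' using hf
  let J : Fin d → P → ℝ := fun i => J' (Fin.cast hd.symm i)
  have hJ : ∀ i, S.IsInvariantMap (J i) := fun i => isInvariantFunction_iff.1 (hJ' _)
  let I : P → Euc d := fun p => WithLp.toLp 2 (fun i => J i p)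
  have hI : S.IsInvariantMap I := isInvariantMap_toLp hJ
  have hIproj := proj_mvfderiv_toLp hJ
  have hmem : ∀ q i, (EuclideanSpace.proj i : Euc d →L[ℝ] ℝ).comp (mvfderiv (𝓡 (n + k)) I q) ∈
      S.invariantDifferentials q := fun q i => by
    rw [hIproj]
    exact Submodule.subset_span ⟨J i, hJ' _, rfl⟩
  have hsurj : Surjective (mvfderiv (𝓡 (n + k)) I p₀) := by
    refine surjective_of_linearIndependent ?_
    simp only [I, hIproj]
    have h1 := hli.comp (Fin.cast hd.symm) (Fin.cast_injective _)
    have h2 : (fun i => mvfderiv (𝓡 (n + k)) (J i) p₀) = f ∘ Fin.cast hd.symm :=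
      funext fun i => (hfJ' _).symm
    rw [h2]
    exact h1
  set φ := chartAt (Euc (n + k)) p₀
  have hφ : φ ∈ IsManifold.maximalAtlas (𝓡 (n + k)) ∞ P := IsManifold.chart_mem_maximalAtlas p₀
  have hp : p₀ ∈ φ.source := mem_chart_source _ p₀
  let g : Euc (n + k) → Euc d := I ∘ φ.symm
  have hg : ContDiffOn ℝ ∞ g φ.target :=
    (hI.contMDiff.comp_contMDiffOn (contMDiffOn_symm_of_mem_maximalAtlas hφ)).contDiffOn
  have hgd : HasFDerivAt g (fderiv ℝ g (φ p₀)) (φ p₀) :=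
    ((hg.contDiffAt (φ.open_target.mem_nhds (φ.map_source hp))).differentiableAt
      (by simp)).hasFDerivAt
  have hgs : Surjective (fderiv ℝ g (φ p₀)) := fun w => by
    obtain ⟨ξ, hξ⟩ := hsurj w
    exact ⟨_, (mfderiv_eq_fderiv_chart hφ hp (fun _ _ => rfl) hgd.differentiableAt ξ).symm.trans hξ⟩
  obtain ⟨e, he⟩ := exists_continuousLinearEquiv_fst hgs
  -- In the coordinates e, only the first component is replaced, by the invariants. Since e was
  -- adapted to the derivative of g, the derivative of `F` at the base point is the identity.
  let F : Euc (n + k) → Euc (n + k) := fun y => e.symm (g y, (e y).2)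
  have hF : ContDiffOn ℝ ∞ F φ.target :=
    e.symm.contDiff.comp_contDiffOn (hg.prodMk (e.contDiff.snd).contDiffOn)
  have hFd : HasFDerivAt F ((ContinuousLinearEquiv.refl ℝ (Euc (n + k)) :
      Euc (n + k) ≃L[ℝ] Euc (n + k)) : Euc (n + k) →L[ℝ] Euc (n + k)) (φ p₀) := by
    have h1 : HasFDerivAt (fun y => (g y, (e y).2)) ((fderiv ℝ g (φ p₀)).prod
        ((ContinuousLinearMap.snd ℝ _ _).comp (e : Euc (n + k) →L[ℝ] _))) (φ p₀) :=
      hgd.prodMk (HasFDerivAt.comp (φ p₀) hasFDerivAt_snd e.hasFDerivAt)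
    have h2 := HasFDerivAt.comp (φ p₀) e.symm.hasFDerivAt h1
    refine h2.congr_fderiv (ContinuousLinearMap.ext fun v => ?_)
    apply e.injective
    simp
    exact Prod.ext (he v).symm rfl
  obtain ⟨Φ, h1, h2, h3, h4⟩ := exists_openPartialHomeomorph_of_contDiffOn φ.open_target hF
    (φ.map_source hp) _ hFd
  let Θ := φ.trans Φ
  have hΘp : p₀ ∈ Θ.source := by
    rw [OpenPartialHomeomorph.trans_source]; exact ⟨hp, h1⟩
  have hΘ : ContMDiffOn (𝓡 (n + k)) (𝓡 (n + k)) ∞ Θ Θ.source := by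
    rw [OpenPartialHomeomorph.trans_source]
    have h5 : ContMDiffOn (𝓡 (n + k)) (𝓡 (n + k)) ∞ Φ Φ.source := by
      rw [show ⇑Φ = F from funext h3]
      exact (hF.mono h2).contMDiffOn
    exact h5.comp' (contMDiffOn_of_mem_maximalAtlas hφ)
  have hΘ' : ContMDiffOn (𝓡 (n + k)) (𝓡 (n + k)) ∞ Θ.symm Θ.target := by
    rw [OpenPartialHomeomorph.trans_target]
    exact (contMDiffOn_symm_of_mem_maximalAtlas hφ).comp' h4.contMDiffOn
  have hΘI : ∀ q ∈ Θ.source, (e (Θ q)).1 = I q := by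
    intro q hq
    rw [OpenPartialHomeomorph.trans_source] at hq
    have h5 : Θ q = F (φ q) := h3 (φ q)
    rw [h5]
    simp only [F, e.apply_symm_apply, g, comp_apply]
    rw [φ.left_inv hq.1]
  -- A ball for the product metric is a product of balls. The fibres of the invariant map in the box
  -- are then balls, so functions can be integrated along them.
  obtain ⟨r, hr, hball⟩ := Metric.isOpen_iff.1 (Θ.open_target.preimage e.symm.continuous)
    (e (Θ p₀)) (by
      change e.symm (e (Θ p₀)) ∈ Θ.target
      rw [e.symm_apply_apply]; exact Θ.map_source hΘp)
  have hbp : Metric.ball (e (Θ p₀)) r =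
    Metric.ball (e (Θ p₀)).1 r ×ˢ Metric.ball (e (Θ p₀)).2 r := (ball_prod_same _ _ _).symm
  set O : Set (Euc (n + k)) := e ⁻¹' Metric.ball (e (Θ p₀)) r
  have hO : IsOpen O := Metric.isOpen_ball.preimage e.continuous
  have hOT : O ⊆ Θ.target := fun y hy => by
    have := hball hy
    simpa using this
  set ψ := (Θ.symm.restrOpen O hO).symm with hψ
  have hψs : ψ.source = Θ.source ∩ Θ ⁻¹' O := by
    ext q
    simp [hψ, OpenPartialHomeomorph.restrOpen]
  have hψt : ψ.target = O := by
    have : ψ.target = Θ.target ∩ O := rfl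
    rw [this, inter_eq_right.2 hOT]
  have hsub : ψ.source ⊆ Θ.source := by rw [hψs]; exact inter_subset_left
  have hψa : ψ ∈ IsManifold.maximalAtlas (𝓡 (n + k)) ∞ P := by
    refine OpenPartialHomeomorph.mem_maximalAtlas_of_contMDiffOn _ (hΘ.mono hsub) ?_
    rw [hψt]
    exact hΘ'.mono hOT
  refine ⟨⟨ψ, hψa, e, I, hI, (e (Θ p₀)).1, (e (Θ p₀)).2, r, hr, fun q hq => hΘI q (hsub hq),
    ?_, ?_⟩, ?_⟩
  · rw [hψt, ← hbp]
  · intro q hq K hK ξ hξ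
    -- At every point of the box, I is a linear projection in the new chart.
    have hs : Surjective (mvfderiv (𝓡 (n + k)) I q) := by
      intro w
      obtain ⟨ξ, hξ⟩ := (mdifferentiable_of_mem_maximalAtlas hψa).mfderiv_surjective hq
        (e.symm (w, 0))
      refine ⟨ξ, ?_⟩
      rw [mfderiv_eq_fderiv_chart hψa hq (g := fun y => (e y).1) ?_ ?_ ξ, hξ]
      · rw [show (fun y => (e y).1) = ((ContinuousLinearMap.fst ℝ (Euc d) (Euc (n + k - d))).comp
          (e : Euc (n + k) →L[ℝ] _)) from rfl, ContinuousLinearMap.fderiv]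
        simp
      · intro y hy
        rw [← hΘI _ (hsub (ψ.map_target hy))]
        exact congrArg (fun y => (e y).1) (ψ.right_inv hy).symm
      · exact e.differentiableAt.fst
    have := hfin q
    exact apply_eq_zero_of_mem_of_finrank_eq hs (hS q) (hmem q)
      (Submodule.subset_span ⟨K, isInvariantFunction_iff.2 hK, rfl⟩) hξ
  · rw [hψs]
    refine ⟨hΘp, ?_⟩
    change e (Θ p₀) ∈ Metric.ball _ _
    exact Metric.mem_ball_self hr

end GStructureWithConnection

/-! ### Factorisation of invariants and equivalence of points in a box. -/

namespace GStructureWithConnection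

variable {n k : ℕ} {G : Type*} [TopologicalSpace G] [ChartedSpace (Euc k) G] [Group G]
  {L : ClosedLinearGroup n k G} {P : Type*} [TopologicalSpace P]
  [ChartedSpace (Euc (n + k)) P] [IsManifold (𝓡 (n + k)) ∞ P] {S : GStructureWithConnection L P}
  {d : ℕ} {V : Type*} [NormedAddCommGroup V] [NormedSpace ℝ V]

theorem IsInvariantMap.mvfderiv_frameL {J : P → V} (hJ : S.IsInvariantMap J) :
    S.IsInvariantMap (fun p => (mvfderiv (𝓡 (n + k)) J p).comp (S.frameL p)) := by
  refine ⟨contMDiff_clm_of_apply fun w => (hJ.mvfderiv_frame (isInvariantMap_const w)).contMDiff,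
    fun Φ hΦ p hp => ContinuousLinearMap.ext fun w => ?_⟩
  exact (hJ.mvfderiv_frame (isInvariantMap_const w)).invariant Φ hΦ p hp

/-- The frame in the position of the coframe: tangent vectors of charts. -/
theorem mfderiv_chart_frame {e : OpenPartialHomeomorph P (Euc (n + k))}
    (he : e ∈ IsManifold.maximalAtlas (𝓡 (n + k)) ∞ P) {y : Euc (n + k)} (hy : y ∈ e.target)
    (v : Euc (n + k)) :
    mfderiv (𝓡 (n + k)) 𝓘(ℝ, Euc (n + k)) e (e.symm y)
      (S.frame (e.symm y) (formInChart e S.coframe y v)) = v := by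
  have h : S.frame (e.symm y) (S.coframe (e.symm y)
      (mfderiv 𝓘(ℝ, Euc (n + k)) (𝓡 (n + k)) e.symm y v)) = _ := S.frame_coframe _ _
  exact (congrArg (mfderiv (𝓡 (n + k)) 𝓘(ℝ, Euc (n + k)) e (e.symm y)) h).trans
    (mfderiv_chart_mfderiv_symm he hy v)

/-- The structure equation of the coframe in a chart. -/
theorem fderiv_formInChart_coframe_sub {e : OpenPartialHomeomorph P (Euc (n + k))}
    (he : e ∈ IsManifold.maximalAtlas (𝓡 (n + k)) ∞ P) {y : Euc (n + k)} (hy : y ∈ e.target)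
    (v w : Euc (n + k)) :
    fderiv ℝ (formInChart e S.coframe) y v w - fderiv ℝ (formInChart e S.coframe) y w v =
      -S.frameBracket (fun _ => formInChart e S.coframe y v)
        (fun _ => formInChart e S.coframe y w) (e.symm y) := by
  have h := fderiv_formInChart_sub he (e.map_target hy) S.smooth_coframe
    (S.smoothFieldAt_frame_const (formInChart e S.coframe y v) _)
    (S.smoothFieldAt_frame_const (formInChart e S.coframe y w) _)
  have h0 : ∀ w : Euc n × Euc k,
      mvfderiv (𝓡 (n + k)) (fun q => S.coframe q (S.frame q w)) (e.symm y) = 0 := by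
    intro w
    rw [show (fun q => S.coframe q (S.frame q w)) = fun _ => w from
      funext fun q => S.coframe_frame q w]
    exact mfderiv_const
  rw [h0, h0, e.right_inv hy] at h
  refine (congrArg₂ (fun a b => fderiv ℝ (formInChart e S.coframe) y a b -
    fderiv ℝ (formInChart e S.coframe) y b a) (mfderiv_chart_frame (S := S) he hy v)
    (mfderiv_chart_frame (S := S) he hy w)).symm.trans (h.trans ?_)
  simp [frameBracket]

namespace InvariantBox

variable (B : S.InvariantBox d)

/-- Composing with continuous functionals on V reduces to the scalar invariants covered by `ker_le`.
-/
theorem mvfderiv_eq_zero {J : P → V} (hJ : S.IsInvariantMap J) {q : P} (hq : q ∈ B.chart.source)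
    {ξ : TangentSpace (𝓡 (n + k)) q} (hξ : mvfderiv (𝓡 (n + k)) B.inv q ξ = 0) :
    mvfderiv (𝓡 (n + k)) J q ξ = 0 := by
  refine (SeparatingDual.eq_zero_iff_forall_dual_eq_zero (R := ℝ) _).2 fun T => ?_
  have h1 := B.ker_le q hq _ (hJ.clm_comp T) ξ hξ
  have h2 := mfderiv_comp q (T.differentiableAt (x := J q)).mdifferentiableAt
    ((hJ.contMDiff q).mdifferentiableAt (by simp))
  rw [mfderiv_eq_fderiv, ContinuousLinearMap.fderiv] at h2
  exact (congrArg (fun A => A ξ) h2).symm.trans h1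

/-- The projection in the chart of a box corresponding to the invariant map. -/
def proj : Euc (n + k) →L[ℝ] Euc d :=
  (ContinuousLinearMap.fst ℝ (Euc d) (Euc (n + k - d))).comp (B.coord : Euc (n + k) →L[ℝ] _)

theorem proj_apply (y : Euc (n + k)) : B.proj y = (B.coord y).1 := rfl

theorem mem_target {y : Euc (n + k)} : y ∈ B.chart.target ↔
    (B.coord y).1 ∈ Metric.ball B.ctr B.r ∧ (B.coord y).2 ∈ Metric.ball B.ctr' B.r := by
  rw [B.target_eq]; rfl

theorem inv_mem {q : P} (hq : q ∈ B.chart.source) : B.inv q ∈ Metric.ball B.ctr B.r := by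
  rw [← B.fst_coord q hq]
  exact (B.mem_target.1 (B.chart.map_source hq)).1

theorem inv_symm {y : Euc (n + k)} (hy : y ∈ B.chart.target) :
    B.inv (B.chart.symm y) = B.proj y := by
  rw [← B.fst_coord _ (B.chart.map_target hy), B.chart.right_inv hy, proj_apply]

theorem mvfderiv_inv {q : P} (hq : q ∈ B.chart.source) (ξ : TangentSpace (𝓡 (n + k)) q) :
    mvfderiv (𝓡 (n + k)) B.inv q ξ =
      B.proj (mfderiv (𝓡 (n + k)) 𝓘(ℝ, Euc (n + k)) B.chart q ξ) := by
  rw [mfderiv_eq_fderiv_chart B.mem_maximalAtlas hq (g := B.proj)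
    (fun y hy => (B.inv_symm hy).symm) B.proj.differentiableAt, ContinuousLinearMap.fderiv]

/-- A section of the invariant map of a box. -/
def sec (z : Euc d) : P := B.chart.symm (B.coord.symm (z, B.ctr'))

theorem coord_symm_mem {z : Euc d} {y : Euc (n + k - d)} (hz : z ∈ Metric.ball B.ctr B.r)
    (hy : y ∈ Metric.ball B.ctr' B.r) : B.coord.symm (z, y) ∈ B.chart.target := by
  rw [B.mem_target, B.coord.apply_symm_apply]
  exact ⟨hz, hy⟩

theorem ctr'_mem : B.ctr' ∈ Metric.ball B.ctr' B.r := Metric.mem_ball_self B.r_pos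

theorem sec_mem {z : Euc d} (hz : z ∈ Metric.ball B.ctr B.r) : B.sec z ∈ B.chart.source :=
  B.chart.map_target (B.coord_symm_mem hz B.ctr'_mem)

theorem inv_sec {z : Euc d} (hz : z ∈ Metric.ball B.ctr B.r) : B.inv (B.sec z) = z := by
  rw [sec, B.inv_symm (B.coord_symm_mem hz B.ctr'_mem), proj_apply, B.coord.apply_symm_apply]

theorem contMDiffOn_sec : ContMDiffOn (𝓡 d) (𝓡 (n + k)) ∞ B.sec (Metric.ball B.ctr B.r) := by
  refine (contMDiffOn_symm_of_mem_maximalAtlas B.mem_maximalAtlas).comp (t := B.chart.target)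
    (f := fun z => B.coord.symm (z, B.ctr')) ?_ fun z hz => B.coord_symm_mem hz B.ctr'_mem
  exact (B.coord.symm.contDiff.comp (contDiff_id.prodMk contDiff_const)).contMDiff.contMDiffOn

theorem contDiffOn_comp_sec {J : P → V} (hJ : S.IsInvariantMap J) :
    ContDiffOn ℝ ∞ (J ∘ B.sec) (Metric.ball B.ctr B.r) :=
  (hJ.contMDiff.comp_contMDiffOn B.contMDiffOn_sec).contDiffOn

/-- In a box, all invariant maps factor through the invariant map of the box. -/
theorem apply_sec_inv {J : P → V} (hJ : S.IsInvariantMap J) {q : P} (hq : q ∈ B.chart.source) :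
    J (B.sec (B.inv q)) = J q := by
  set z := B.inv q
  have hz : z ∈ Metric.ball B.ctr B.r := B.inv_mem hq
  have hq2 : (B.coord (B.chart q)).2 ∈ Metric.ball B.ctr' B.r :=
    (B.mem_target.1 (B.chart.map_source hq)).2
  let g : Euc (n + k) → V := J ∘ B.chart.symm
  have hg : ∀ y ∈ B.chart.target, DifferentiableAt ℝ g y := fun y hy =>
    ((hJ.contMDiff.comp_contMDiffOn (contMDiffOn_symm_of_mem_maximalAtlas
      B.mem_maximalAtlas)).contDiffOn.contDiffAt (B.chart.open_target.mem_nhds hy)).differentiableAt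
      (by simp)
  have hg0 : ∀ y ∈ B.chart.target, ∀ v, B.proj v = 0 → fderiv ℝ g y v = 0 := by
    intro y hy v hv
    have hp := B.chart.map_target hy
    obtain ⟨ξ, rfl⟩ := (mdifferentiable_of_mem_maximalAtlas
      B.mem_maximalAtlas).mfderiv_surjective hp v
    have h1 := B.mvfderiv_eq_zero hJ hp ((B.mvfderiv_inv hp ξ).trans hv)
    rw [mfderiv_eq_fderiv_chart B.mem_maximalAtlas hp (g := g) (fun _ _ => rfl)
      (by rw [B.chart.right_inv hy]; exact hg y hy), B.chart.right_inv hy] at h1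
    exact h1
  -- `c` parametrises the fibre over z. The invariant has zero derivative along this connected
  -- fibre, so its value at q equals its value at the section point.
  let c : Euc (n + k - d) → Euc (n + k) := fun y => B.coord.symm (z, y)
  have hc : ∀ y, HasFDerivAt c ((B.coord.symm : _ →L[ℝ] Euc (n + k)).comp
      (ContinuousLinearMap.inr ℝ (Euc d) (Euc (n + k - d)))) y := fun y =>
    HasFDerivAt.comp y B.coord.symm.hasFDerivAt (hasFDerivAt_prodMk_right z y)
  have hgc : ∀ y ∈ Metric.ball B.ctr' B.r, HasFDerivAt (g ∘ c) (0 : Euc (n + k - d) →L[ℝ] V) y := by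
    intro y hy
    have h1 := HasFDerivAt.comp y (hg _ (B.coord_symm_mem hz hy)).hasFDerivAt (hc y)
    refine h1.congr_fderiv (ContinuousLinearMap.ext fun v => ?_)
    refine hg0 _ (B.coord_symm_mem hz hy) _ ?_
    simp [proj]
  have h1 := (Metric.isOpen_ball (x := B.ctr') (ε := B.r)).is_const_of_fderiv_eq_zero
    (𝕜 := ℝ) (f := g ∘ c)
    (convex_ball B.ctr' B.r).isPreconnected
    (fun y hy => (hgc y hy).differentiableAt.differentiableWithinAt)
    (fun y hy => (hgc y hy).fderiv) B.ctr'_mem hq2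
  have h2 : c (B.coord (B.chart q)).2 = B.chart q := by
    simp only [c]
    rw [show z = (B.coord (B.chart q)).1 from (B.fst_coord q hq).symm]
    exact B.coord.symm_apply_apply _
  have h3 : (g ∘ c) (B.coord (B.chart q)).2 = J q := by
    rw [comp_apply, h2]
    exact congrArg J (B.chart.left_inv hq)
  exact h1.trans h3

/-- Points of a box with the same image under the invariant map are locally equivalent. -/
theorem locallyEquivalent {q q' : P} (hq : q ∈ B.chart.source) (hq' : q' ∈ B.chart.source)
    (h : B.inv q = B.inv q') : S.LocallyEquivalent q q' := by
  have hat := B.mem_maximalAtlas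
  have hK := B.isInvariantMap_inv.mvfderiv_frameL
  have hfac : ∀ {V : Type} [NormedAddCommGroup V] [NormedSpace ℝ V] {J : P → V},
      S.IsInvariantMap J → ∀ y ∈ B.chart.target, J (B.sec (B.proj y)) = J (B.chart.symm y) := by
    intro V _ _ J hJ y hy
    rw [← B.inv_symm hy, B.apply_sec_inv hJ (B.chart.map_target hy)]
  -- The structure functions and the coframe derivatives of `B.inv` are invariants, hence factor
  -- through `B.proj`; κ and c are their values on the section `B.sec`.
  obtain ⟨Φ, h1, h2, h3, h4, h5, h6, h7⟩ := exists_openPartialHomeomorph_coframe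
    (η := formInChart B.chart S.coframe) B.chart.open_target
    (fun y hy => (contDiffAt_formInChart hat hy S.smooth_coframe).contDiffWithinAt)
    (fun y hy => (S.isInvertible_formInChart_coframe hat hy).1)
    (fun y hy => S.contDiffAt_inverse_formInChart_coframe hat hy) B.proj
    (κ := fun z => (mvfderiv (𝓡 (n + k)) B.inv (B.sec z)).comp (S.frameL (B.sec z)))
    (c := fun z v w => -S.frameBracket (fun _ => v) (fun _ => w) (B.sec z))
    (fun y hy => ((B.contDiffOn_comp_sec hK).contDiffAt (Metric.isOpen_ball.mem_nhds
      (B.mem_target.1 hy).1)).of_le (WithTop.coe_le_coe.2 le_top))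
    (fun y hy w => by
      rw [(S.isInvertible_formInChart_coframe hat hy).2 w]
      refine (B.mvfderiv_inv (B.chart.map_target hy) _).symm.trans ?_
      exact (congrArg (fun A => A w) (hfac hK y hy)).symm)
    (fun y hy v w => by
      rw [fderiv_formInChart_coframe_sub hat hy]
      exact congrArg Neg.neg (hfac ((isInvariantMap_const _).frameBracket
        (isInvariantMap_const _)) y hy).symm)
    (B.chart.map_source hq) (B.chart.map_source hq')
    (by rw [proj_apply, proj_apply, B.fst_coord q hq, B.fst_coord q' hq', h])
  set Θ := B.chart.trans (Φ.trans B.chart.symm) with hΘ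
  have hsrc : ∀ p, p ∈ Θ.source ↔ p ∈ B.chart.source ∧ B.chart p ∈ Φ.source := by
    intro p
    simp only [hΘ, OpenPartialHomeomorph.trans_source, mem_inter_iff, mem_preimage]
    refine ⟨fun h => ⟨h.1, h.2.1⟩, fun h => ⟨h.1, h.2, h4 (Φ.map_source h.2)⟩⟩
  have hco : ∀ p ∈ Θ.source, ∀ ξ : TangentSpace (𝓡 (n + k)) p,
      S.coframe (Θ p) (mfderiv (𝓡 (n + k)) (𝓡 (n + k)) Θ p ξ) = S.coframe p ξ := by
    intro p hp ξ
    obtain ⟨hp1, hp2⟩ := (hsrc p).1 hp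
    have d1 := (mdifferentiable_of_mem_maximalAtlas hat).mdifferentiableAt hp1
    have d2 : MDifferentiableAt 𝓘(ℝ, Euc (n + k)) 𝓘(ℝ, Euc (n + k)) Φ (B.chart p) :=
      ((h5.contDiffAt (Φ.open_source.mem_nhds hp2)).differentiableAt (by simp)).mdifferentiableAt
    have d3 := (mdifferentiable_of_mem_maximalAtlas hat).symm.mdifferentiableAt
      (h4 (Φ.map_source hp2))
    have e1 := mfderiv_comp p (MDifferentiableAt.comp (B.chart p) d3 d2) d1
    have e2 := mfderiv_comp (B.chart p) d3 d2
    rw [e2, mfderiv_eq_fderiv] at e1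
    refine (congrArg (S.coframe (Θ p)) (congrArg (fun A => A ξ) e1)).trans ?_
    refine (h7 _ hp2 _).trans ?_
    have e3 := B.chart.left_inv hp1
    change S.coframe (B.chart.symm (B.chart p)) (mfderiv 𝓘(ℝ, Euc (n + k)) (𝓡 (n + k))
      B.chart.symm (B.chart p) (mfderiv (𝓡 (n + k)) 𝓘(ℝ, Euc (n + k)) B.chart p ξ)) = _
    rw [mfderiv_symm_mfderiv_chart hat hp1]
    have e4 : ∀ p' : P, p' = p → S.coframe p' ξ = S.coframe p ξ := by
      rintro _ rfl; rfl
    exact e4 _ e3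
  refine ⟨Θ, ⟨?_, ?_, fun p hp ξ => congrArg Prod.fst (hco p hp ξ),
    fun p hp ξ => congrArg Prod.snd (hco p hp ξ)⟩, (hsrc q).2 ⟨hq, h1⟩, ?_⟩
  · refine (contMDiffOn_symm_of_mem_maximalAtlas hat).comp (t := B.chart.target)
      (h5.contMDiffOn.comp ((contMDiffOn_of_mem_maximalAtlas hat).mono
        fun p hp => ((hsrc p).1 hp).1)
        fun p hp => ((hsrc p).1 hp).2) fun p hp => h4 (Φ.map_source ((hsrc p).1 hp).2)
  · have htgt : ∀ p ∈ Θ.target, p ∈ B.chart.source ∧ B.chart p ∈ Φ.target := by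
      intro p hp
      have : p ∈ (B.chart.source ∩ B.chart ⁻¹' Φ.target) := by
        simp only [hΘ, OpenPartialHomeomorph.trans_target, mem_inter_iff, mem_preimage] at hp
        exact hp.1
      exact this
    refine (contMDiffOn_symm_of_mem_maximalAtlas hat).comp (t := B.chart.target)
      (h6.contMDiffOn.comp ((contMDiffOn_of_mem_maximalAtlas hat).mono fun p hp => (htgt p hp).1)
        fun p hp => (htgt p hp).2) fun p hp => h3 (Φ.map_target (htgt p hp).2)
  · change B.chart.symm (Φ (B.chart q)) = q'
    rw [h2, B.chart.left_inv hq']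

end InvariantBox

end GStructureWithConnection

/-! ### The smooth structure of the classifying space. -/

namespace GStructureWithConnection

variable {n k : ℕ} {G : Type*} [TopologicalSpace G] [ChartedSpace (Euc k) G] [Group G]
  {L : ClosedLinearGroup n k G} {P : Type*} [TopologicalSpace P]
  [ChartedSpace (Euc (n + k)) P] [IsManifold (𝓡 (n + k)) ∞ P] (S : GStructureWithConnection L P)

theorem classifyingMap_eq_iff {p q : P} :
    S.classifyingMap p = S.classifyingMap q ↔ S.LocallyEquivalent p q :=
  Quotient.eq (r := S.localEquivalenceSetoid)

theorem classifyingMap_surjective : Surjective S.classifyingMap := Quotient.mk_surjective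

theorem continuous_classifyingMap : Continuous S.classifyingMap := continuous_quot_mk

/-- The saturation of an open set is the union of its images under local equivalences, each of which
is open. -/
theorem isOpenMap_classifyingMap : IsOpenMap S.classifyingMap := by
  intro U hU
  change IsOpen (S.classifyingMap ⁻¹' (S.classifyingMap '' U))
  rw [isOpen_iff_mem_nhds]
  rintro p ⟨u, hu, hup⟩
  obtain ⟨Φ, hΦ, hus, rfl⟩ := S.classifyingMap_eq_iff.1 hup
  have h1 : Φ.symm ⁻¹' U ∩ Φ.target ∈ 𝓝 (Φ u) := by
    have ht := Φ.map_source hus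
    refine Filter.inter_mem ((Φ.continuousAt_symm ht).preimage_mem_nhds ?_)
      (Φ.open_target.mem_nhds ht)
    rw [Φ.left_inv hus]
    exact hU.mem_nhds hu
  filter_upwards [h1] with q hq
  exact ⟨_, hq.1, S.classifyingMap_eq_iff.2 ⟨Φ, hΦ, Φ.map_target hq.2, Φ.right_inv hq.2⟩⟩

variable {S}

/-- The map on the classifying space induced by an invariant map. -/
def IsInvariantMap.descend {V : Type*} [NormedAddCommGroup V] [NormedSpace ℝ V] {J : P → V}
    (hJ : S.IsInvariantMap J) : S.ClassifyingSpace → V :=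
  Quotient.lift J fun _ _ h => hJ.eq_of_locallyEquivalent h

variable {d : ℕ}

/-- The chart of the classifying space defined by a box. -/
def InvariantBox.quotientChart (B : S.InvariantBox d) :
    OpenPartialHomeomorph S.ClassifyingSpace (Euc d) where
  toFun := B.isInvariantMap_inv.descend
  invFun z := S.classifyingMap (B.sec z)
  source := S.classifyingMap '' B.chart.source
  target := Metric.ball B.ctr B.r
  map_source' := by
    rintro _ ⟨q, hq, rfl⟩
    exact B.inv_mem hq
  map_target' z hz := ⟨_, B.sec_mem hz, rfl⟩
  -- Injectivity of the chart is where Cartan's theorem enters: a point of the box is equivalent to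
  -- the section point with the same invariants.
  left_inv' := by
    rintro _ ⟨q, hq, rfl⟩
    have hz := B.inv_mem hq
    exact S.classifyingMap_eq_iff.2 (B.locallyEquivalent (B.sec_mem hz) hq (B.inv_sec hz))
  right_inv' z hz := B.inv_sec hz
  open_source := S.isOpenMap_classifyingMap _ B.chart.open_source
  open_target := Metric.isOpen_ball
  continuousOn_toFun :=
    (B.isInvariantMap_inv.contMDiff.continuous.quotient_lift _).continuousOn
  continuousOn_invFun :=
    S.continuous_classifyingMap.comp_continuousOn B.contMDiffOn_sec.continuousOn

/-- The smooth structure of the classifying space of a fully regular `G`-structure with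
connection. -/
abbrev chartedSpaceClassifyingSpace (hS : S.IsFullyRegular d) :
    ChartedSpace (Euc d) S.ClassifyingSpace where
  atlas := range fun p : P => (exists_invariantBox hS p).choose.quotientChart
  chartAt x := (exists_invariantBox hS x.out).choose.quotientChart
  mem_chart_source x := ⟨x.out, (exists_invariantBox hS x.out).choose_spec, Quotient.out_eq x⟩
  chart_mem_atlas x := ⟨x.out, rfl⟩

/-- A change of charts is the invariant map of one box composed with the section of another, and so
is smooth even on the whole ball. -/
theorem isManifold_classifyingSpace (hS : S.IsFullyRegular d) :
    letI := chartedSpaceClassifyingSpace hS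
    IsManifold (𝓡 d) ∞ S.ClassifyingSpace := by
  let := chartedSpaceClassifyingSpace hS
  refine isManifold_of_contDiffOn _ _ _ ?_
  rintro _ _ ⟨p, rfl⟩ ⟨q, rfl⟩
  refine ((exists_invariantBox hS p).choose.contDiffOn_comp_sec
    (exists_invariantBox hS q).choose.isInvariantMap_inv).mono ?_
  intro z hz
  exact hz.1.1

/-- Between the chart of a box and the quotient chart it defines, h is a linear projection. -/
theorem isSubmersion_classifyingMap (hS : S.IsFullyRegular d) :
    letI := chartedSpaceClassifyingSpace hS
    Manifold.IsSubmersion (𝓡 (n + k)) (𝓡 d) ∞ S.classifyingMap := by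
  let := chartedSpaceClassifyingSpace hS
  have := isManifold_classifyingSpace hS
  have h : Manifold.IsSubmersionOfComplement (Euc (n + k - d)) (𝓡 (n + k)) (𝓡 d) ∞
      S.classifyingMap := by
    intro p
    set B := (exists_invariantBox hS p).choose with hB
    have hp : p ∈ B.chart.source := (exists_invariantBox hS p).choose_spec
    refine Manifold.IsSubmersionAtOfComplement.mk_of_charts B.coord B.chart B.quotientChart hp
      ⟨p, hp, rfl⟩ B.mem_maximalAtlas (IsManifold.subset_maximalAtlas ⟨p, rfl⟩)
      (fun q hq => ⟨q, hq, rfl⟩) ?_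
    intro y hy
    have hy' : y ∈ B.chart.target := by simpa using hy
    exact B.inv_symm hy'
  exact h.isSubmersion

end GStructureWithConnection

/-! ### Descent of smoothness along submersions. -/

section Submersions

variable {m d : ℕ} {M N : Type*} [TopologicalSpace M] [ChartedSpace (Euc m) M]
  [TopologicalSpace N] [ChartedSpace (Euc d) N]
  {π : M → N}

/-- Submersions have local sections through every point. -/
theorem exists_localSection (hπ : Manifold.IsSubmersion (𝓡 m) (𝓡 d) ∞ π) (p : M) :
    ∃ σ : N → M, ContMDiffAt (𝓡 d) (𝓡 m) ∞ σ (π p) ∧ σ (π p) = p ∧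
      ∀ᶠ y in 𝓝 (π p), π (σ y) = y := by
  have hp := hπ.isSubmersionAt p
  set φ := hp.domChart
  set ψ := hp.codChart
  have hφ := hp.domChart_mem_maximalAtlas
  have hψ := hp.codChart_mem_maximalAtlas
  have hpφ : p ∈ φ.source := hp.mem_domChart_source
  have hpψ : π p ∈ ψ.source := hp.mem_codChart_source
  have hsub : φ.source ⊆ π ⁻¹' ψ.source := hp.source_subset_preimage_source
  have hw : ∀ y ∈ φ.target, ψ (π (φ.symm y)) = (hp.equiv y).1 := fun y hy =>
    hp.writtenInCharts (by simpa using hy)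
  -- The fibre coordinate is frozen at that of p, so the section passes through p.
  let c : N → Euc m := fun y => hp.equiv.symm (ψ y, (hp.equiv (φ p)).2)
  have hc : ContMDiffAt (𝓡 d) (𝓡 m) ∞ c (π p) := by
    have h1 : ContDiff ℝ ∞ (fun z : Euc d => hp.equiv.symm (z, (hp.equiv (φ p)).2)) :=
      hp.equiv.symm.contDiff.comp (contDiff_id.prodMk contDiff_const)
    exact h1.contMDiff.contMDiffAt.comp (π p) (contMDiffAt_of_mem_maximalAtlas hψ hpψ)
  have hcp : c (π p) = φ p := by
    have h1 := hw (φ p) (φ.map_source hpφ)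
    rw [φ.left_inv hpφ] at h1
    simp only [c, h1]
    exact hp.equiv.symm_apply_apply _
  have hcT : ∀ᶠ y in 𝓝 (π p), c y ∈ φ.target :=
    hc.continuousAt.preimage_mem_nhds (hcp ▸ φ.open_target.mem_nhds (φ.map_source hpφ))
  refine ⟨fun y => φ.symm (c y), ?_, ?_, ?_⟩
  · refine ContMDiffAt.comp (π p) ?_ hc
    rw [hcp]
    exact contMDiffAt_symm_of_mem_maximalAtlas hφ (φ.map_source hpφ)
  · change φ.symm (c (π p)) = p
    rw [hcp, φ.left_inv hpφ]
  · filter_upwards [hcT, ψ.open_source.mem_nhds hpψ] with y hy hyψ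
    refine ψ.injOn (hsub (φ.map_target hy)) hyψ ?_
    rw [hw _ hy]
    simp [c]

/-- Smoothness of maps descends along submersions. -/
theorem contMDiffAt_of_comp_isSubmersion (hπ : Manifold.IsSubmersion (𝓡 m) (𝓡 d) ∞ π)
    {E H Q : Type*} [NormedAddCommGroup E] [NormedSpace ℝ E] [TopologicalSpace H]
    {I : ModelWithCorners ℝ E H} [TopologicalSpace Q] [ChartedSpace H Q] {f : N → Q} {p : M}
    (hf : ContMDiffAt (𝓡 m) I ∞ (f ∘ π) p) : ContMDiffAt (𝓡 d) I ∞ f (π p) := by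
  obtain ⟨σ, hσ, hσp, hσπ⟩ := exists_localSection hπ p
  refine (ContMDiffAt.comp (π p) (g := f ∘ π) (by rwa [hσp]) hσ).congr_of_eventuallyEq ?_
  filter_upwards [hσπ] with y hy
  simp only [comp_apply, hy]

theorem contMDiff_of_comp_isSubmersion (hπ : Manifold.IsSubmersion (𝓡 m) (𝓡 d) ∞ π)
    (hs : Surjective π) {E H Q : Type*} [NormedAddCommGroup E] [NormedSpace ℝ E]
    [TopologicalSpace H] {I : ModelWithCorners ℝ E H} [TopologicalSpace Q] [ChartedSpace H Q]
    {f : N → Q} (hf : ContMDiff (𝓡 m) I ∞ (f ∘ π)) : ContMDiff (𝓡 d) I ∞ f := fun y => by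
  obtain ⟨p, rfl⟩ := hs y
  exact contMDiffAt_of_comp_isSubmersion hπ (hf p)

end Submersions

/-! ### Functions and tangent vectors on the classifying space, for any structure making h a
submersion. -/

namespace GStructureWithConnection

variable {n k : ℕ} {G : Type*} [TopologicalSpace G] [ChartedSpace (Euc k) G] [Group G]
  {L : ClosedLinearGroup n k G} {P : Type*} [TopologicalSpace P]
  [ChartedSpace (Euc (n + k)) P] [IsManifold (𝓡 (n + k)) ∞ P] {S : GStructureWithConnection L P}

theorem InvariantBox.mvfderiv_inv_surjective {d : ℕ} (B : S.InvariantBox d) {q : P}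
    (hq : q ∈ B.chart.source) : Surjective (mvfderiv (𝓡 (n + k)) B.inv q) := by
  intro w
  obtain ⟨ξ, hξ⟩ := (mdifferentiable_of_mem_maximalAtlas B.mem_maximalAtlas).mfderiv_surjective hq
    (B.coord.symm (w, 0))
  refine ⟨ξ, (B.mvfderiv_inv hq ξ).trans ?_⟩
  rw [hξ]
  simp [InvariantBox.proj]

theorem isInvariantMap_comp_classifyingMap_of_contMDiff {V : Type*} [NormedAddCommGroup V]
    [NormedSpace ℝ V] {f : S.ClassifyingSpace → V}
    (hf : ContMDiff (𝓡 (n + k)) 𝓘(ℝ, V) ∞ (f ∘ S.classifyingMap)) :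
    S.IsInvariantMap (f ∘ S.classifyingMap) :=
  ⟨hf, fun Φ hΦ _ hp => congrArg f
    (S.classifyingMap_eq_iff.2 ⟨Φ, hΦ, hp, rfl⟩).symm⟩

variable {d : ℕ} [ChartedSpace (Euc d) S.ClassifyingSpace]

theorem mvfderiv_comp_classifyingMap
    (hs : Manifold.IsSubmersion (𝓡 (n + k)) (𝓡 d) ∞ S.classifyingMap) {V : Type*}
    [NormedAddCommGroup V] [NormedSpace ℝ V] {f : S.ClassifyingSpace → V}
    (hf : ContMDiff (𝓡 d) 𝓘(ℝ, V) ∞ f) (p : P) (ξ : TangentSpace (𝓡 (n + k)) p) :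
    mvfderiv (𝓡 (n + k)) (f ∘ S.classifyingMap) p ξ =
      mvfderiv (𝓡 d) f (S.classifyingMap p)
        (mfderiv (𝓡 (n + k)) (𝓡 d) S.classifyingMap p ξ) :=
  congrArg (fun A => A ξ) (mfderiv_comp p ((hf _).mdifferentiableAt (by simp))
    ((hs.contMDiff p).mdifferentiableAt (by simp)))

theorem contMDiff_descend
    (hs : Manifold.IsSubmersion (𝓡 (n + k)) (𝓡 d) ∞ S.classifyingMap) {V : Type*}
    [NormedAddCommGroup V] [NormedSpace ℝ V] {J : P → V} (hJ : S.IsInvariantMap J) :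
    ContMDiff (𝓡 d) 𝓘(ℝ, V) ∞ hJ.descend :=
  contMDiff_of_comp_isSubmersion hs S.classifyingMap_surjective hJ.contMDiff

/-- The differentials of smooth functions separate the tangent vectors of the classifying space. -/
theorem tangentSpace_ext (hS : S.IsFullyRegular d)
    (hs : Manifold.IsSubmersion (𝓡 (n + k)) (𝓡 d) ∞ S.classifyingMap) {x : S.ClassifyingSpace}
    {ξ ζ : TangentSpace (𝓡 d) x}
    (h : ∀ f : C^∞⟮𝓡 d, S.ClassifyingSpace; 𝓘(ℝ, ℝ), ℝ⟯, lieDeriv f x ξ = lieDeriv f x ζ) :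
    ξ = ζ := by
  obtain ⟨p, rfl⟩ := S.classifyingMap_surjective x
  -- X may fail to be Hausdorff, so local coordinates need not be extendable by cutoffs. The
  -- invariant map of a box is defined on all of P, hence gives global functions on X, and its
  -- differential is injective by a dimension count.
  obtain ⟨B, hp⟩ := exists_invariantBox hS p
  have hB := B.isInvariantMap_inv
  set I := hB.descend
  have hI : ContMDiff (𝓡 d) 𝓘(ℝ, Euc d) ∞ I := contMDiff_descend hs hB
  have hsurj : Surjective (mvfderiv (𝓡 d) I (S.classifyingMap p)) := by
    intro w
    obtain ⟨v, hv⟩ := B.mvfderiv_inv_surjective hp w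
    exact ⟨_, (mvfderiv_comp_classifyingMap hs hI p v).symm.trans hv⟩
  have hinj : Injective (mvfderiv (𝓡 d) I (S.classifyingMap p)) := by
    let A : Euc d →ₗ[ℝ] Euc d := (mvfderiv (𝓡 d) I (S.classifyingMap p)).toLinearMap
    exact (LinearMap.injective_iff_surjective (f := A)).2 hsurj
  apply hinj
  refine PiLp.ext fun i => ?_
  let π : Euc d →L[ℝ] ℝ := EuclideanSpace.proj i
  have hπ : ∀ v, lieDeriv (⟨π ∘ I, π.contMDiff.comp hI⟩ :
      C^∞⟮𝓡 d, S.ClassifyingSpace; 𝓘(ℝ, ℝ), ℝ⟯) (S.classifyingMap p) v =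
      π (mvfderiv (𝓡 d) I (S.classifyingMap p) v) := by
    intro v
    have h2 := mfderiv_comp (S.classifyingMap p) (π.differentiableAt
      (x := I (S.classifyingMap p))).mdifferentiableAt ((hI _).mdifferentiableAt (by simp))
    rw [mfderiv_eq_fderiv, ContinuousLinearMap.fderiv] at h2
    exact congrArg (fun A => A v) h2
  exact (hπ ξ).symm.trans ((h ⟨π ∘ I, π.contMDiff.comp hI⟩).trans (hπ ζ))

end GStructureWithConnection

/-! ### Pointwise algebra of the exterior derivative. -/

section

variable {m : ℕ} {M : Type*} [TopologicalSpace M] [ChartedSpace (Euc m) M]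
  {V : Type*} [NormedAddCommGroup V] [NormedSpace ℝ V]
  (η : (p : M) → TangentSpace (𝓡 m) p →L[ℝ] V) (p : M)

theorem extDerivOneForm_add_left (ξ ξ' ζ : TangentSpace (𝓡 m) p) :
    extDerivOneForm η p (ξ + ξ') ζ = extDerivOneForm η p ξ ζ + extDerivOneForm η p ξ' ζ := by
  let D : TangentSpace (𝓡 m) p →L[ℝ] Euc m :=
    mfderiv (𝓡 m) 𝓘(ℝ, Euc m) (extChartAt (𝓡 m) p) p
  let B : Euc m →L[ℝ] Euc m →L[ℝ] V := fderiv ℝ (oneFormInChart η p) (extChartAt (𝓡 m) p p)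
  change B (D (ξ + ξ')) (D ζ) - B (D ζ) (D (ξ + ξ')) =
    (B (D ξ) (D ζ) - B (D ζ) (D ξ)) + (B (D ξ') (D ζ) - B (D ζ) (D ξ'))
  rw [map_add, map_add, add_apply, map_add]
  abel

theorem extDerivOneForm_smul_left (c : ℝ) (ξ ζ : TangentSpace (𝓡 m) p) :
    extDerivOneForm η p (c • ξ) ζ = c • extDerivOneForm η p ξ ζ := by
  let D : TangentSpace (𝓡 m) p →L[ℝ] Euc m :=
    mfderiv (𝓡 m) 𝓘(ℝ, Euc m) (extChartAt (𝓡 m) p) p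
  let B : Euc m →L[ℝ] Euc m →L[ℝ] V := fderiv ℝ (oneFormInChart η p) (extChartAt (𝓡 m) p p)
  change B (D (c • ξ)) (D ζ) - B (D ζ) (D (c • ξ)) = c • (B (D ξ) (D ζ) - B (D ζ) (D ξ))
  rw [map_smul, map_smul, smul_apply, map_smul, smul_sub]

theorem extDerivOneForm_swap (ξ ζ : TangentSpace (𝓡 m) p) :
    extDerivOneForm η p ξ ζ = -extDerivOneForm η p ζ ξ := by
  simp only [extDerivOneForm, neg_sub]

end

/-! ### Anchor and bracket of the classifying Lie algebroid. -/

namespace GStructureWithConnection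

open VectorField

variable {n k : ℕ} {G : Type*} [TopologicalSpace G] [ChartedSpace (Euc k) G] [Group G]
  {L : ClosedLinearGroup n k G} {P : Type*} [TopologicalSpace P]
  [ChartedSpace (Euc (n + k)) P] [IsManifold (𝓡 (n + k)) ∞ P] (S : GStructureWithConnection L P)

section FrameBracket

variable {s s' t r : P → Euc n × Euc k}

theorem mdifferentiableAt_frame (hs : ContMDiff (𝓡 (n + k)) 𝓘(ℝ, Euc n × Euc k) ∞ s) (p : P) :
    MDifferentiableAt (𝓡 (n + k)) (𝓡 (n + k)).tangent
      (fun q => (⟨q, S.frame q (s q)⟩ : TangentBundle (𝓡 (n + k)) P)) p :=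
  (S.smoothFieldAt_frame (hs p)).mdifferentiableAt (by simp)

theorem frameBracket_self : S.frameBracket s s = 0 := by
  funext p
  simp [frameBracket]

theorem frameBracket_swap : S.frameBracket s t = -S.frameBracket t s := by
  funext p
  unfold frameBracket
  rw [mlieBracket_swap_apply, map_neg]
  rfl

theorem frameBracket_add_left (hs : ContMDiff (𝓡 (n + k)) 𝓘(ℝ, Euc n × Euc k) ∞ s)
    (hs' : ContMDiff (𝓡 (n + k)) 𝓘(ℝ, Euc n × Euc k) ∞ s') :
    S.frameBracket (s + s') t = S.frameBracket s t + S.frameBracket s' t := by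
  funext p
  have h : (fun q => S.frame q ((s + s') q)) =
      (fun q => S.frame q (s q)) + fun q => S.frame q (s' q) :=
    funext fun q => map_add (S.frame q) (s q) (s' q)
  unfold frameBracket
  rw [h, mlieBracket_add_left (S.mdifferentiableAt_frame hs p) (S.mdifferentiableAt_frame hs' p),
    map_add]
  rfl

theorem frameBracket_add_right (hs : ContMDiff (𝓡 (n + k)) 𝓘(ℝ, Euc n × Euc k) ∞ s)
    (hs' : ContMDiff (𝓡 (n + k)) 𝓘(ℝ, Euc n × Euc k) ∞ s') :
    S.frameBracket t (s + s') = S.frameBracket t s + S.frameBracket t s' := by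
  rw [frameBracket_swap, S.frameBracket_add_left hs hs', S.frameBracket_swap (s := t),
    S.frameBracket_swap (s := t)]
  abel

theorem frameBracket_const_smul_left (hs : ContMDiff (𝓡 (n + k)) 𝓘(ℝ, Euc n × Euc k) ∞ s) (c : ℝ) :
    S.frameBracket (c • s) t = c • S.frameBracket s t := by
  funext p
  have h : (fun q => S.frame q ((c • s) q)) = c • fun q => S.frame q (s q) :=
    funext fun q => map_smul (S.frame q) c (s q)
  unfold frameBracket
  rw [h, mlieBracket_const_smul_left (S.mdifferentiableAt_frame hs p), map_smul]
  rfl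

theorem frameBracket_const_smul_right (hs : ContMDiff (𝓡 (n + k)) 𝓘(ℝ, Euc n × Euc k) ∞ s)
    (c : ℝ) : S.frameBracket t (c • s) = c • S.frameBracket t s := by
  rw [frameBracket_swap, S.frameBracket_const_smul_left hs, S.frameBracket_swap (s := t), smul_neg]

theorem frameBracket_smul_right (ht : ContMDiff (𝓡 (n + k)) 𝓘(ℝ, Euc n × Euc k) ∞ t) {f : P → ℝ}
    (hf : ContMDiff (𝓡 (n + k)) 𝓘(ℝ, ℝ) ∞ f) (p : P) :
    S.frameBracket s (fun q => f q • t q) p =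
      f p • S.frameBracket s t p + mvfderiv (𝓡 (n + k)) f p (S.frame p (s p)) • t p := by
  have h : (fun q => S.frame q (f q • t q)) = f • fun q => S.frame q (t q) :=
    funext fun q => map_smul (S.frame q) (f q) (t q)
  unfold frameBracket
  rw [h, mlieBracket_smul_right ((hf p).mdifferentiableAt (by simp))
    (S.mdifferentiableAt_frame ht p), map_add, map_smul, map_smul, S.coframe_frame, add_comm]

/-- The field with coefficients `frameBracket s t` is the Lie bracket of the two fields itself, so
this is the Jacobi identity on P. -/
theorem frameBracket_jacobi (hs : ContMDiff (𝓡 (n + k)) 𝓘(ℝ, Euc n × Euc k) ∞ s)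
    (ht : ContMDiff (𝓡 (n + k)) 𝓘(ℝ, Euc n × Euc k) ∞ t)
    (hr : ContMDiff (𝓡 (n + k)) 𝓘(ℝ, Euc n × Euc k) ∞ r) :
    S.frameBracket s (S.frameBracket t r) =
      S.frameBracket (S.frameBracket s t) r + S.frameBracket t (S.frameBracket s r) := by
  funext p
  have h : ∀ {s}, ContMDiff (𝓡 (n + k)) 𝓘(ℝ, Euc n × Euc k) ∞ s →
      ContMDiffAt (𝓡 (n + k)) (𝓡 (n + k)).tangent (minSmoothness ℝ 2)
      (fun q => (⟨q, S.frame q (s q)⟩ : TangentBundle (𝓡 (n + k)) P)) p := fun hs =>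
    (S.smoothFieldAt_frame (hs p)).of_le
      (by rw [minSmoothness_of_isRCLikeNormedField]; exact WithTop.coe_le_coe.2 le_top)
  have h' : ∀ s t : P → Euc n × Euc k, (fun q => S.frame q (S.frameBracket s t q)) =
      mlieBracket (𝓡 (n + k)) (fun q => S.frame q (s q)) (fun q => S.frame q (t q)) :=
    fun s t => funext fun q => S.frame_coframe q _
  have h2 := leibniz_identity_mlieBracket_apply (h hs) (h ht) (h hr)
  rw [← h' t r, ← h' s t, ← h' s r] at h2
  have h3 := congrArg (S.coframe p) h2
  rw [map_add] at h3
  exact h3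

end FrameBracket

variable (d : ℕ) [ChartedSpace (Euc d) S.ClassifyingSpace]

/-- The anchor of the classifying Lie algebroid. -/
def anchorMap (x : S.ClassifyingSpace) : (Euc n × Euc k) →L[ℝ] TangentSpace (𝓡 d) x :=
  ((mfderiv (𝓡 (n + k)) (𝓡 d) S.classifyingMap x.out).comp (S.frameL x.out) :
    (Euc n × Euc k) →L[ℝ] Euc d)

variable {S d}

/-- Independence of the chosen representative: h ∘ Φ = h near p for a local equivalence Φ, and Φ
preserves the frame. -/
theorem anchorMap_classifyingMap
    (hs : Manifold.IsSubmersion (𝓡 (n + k)) (𝓡 d) ∞ S.classifyingMap) (p : P)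
    (w : Euc n × Euc k) :
    S.anchorMap d (S.classifyingMap p) w =
      mfderiv (𝓡 (n + k)) (𝓡 d) S.classifyingMap p (S.frame p w) := by
  obtain ⟨Φ, hΦ, hp, hpq⟩ := S.classifyingMap_eq_iff.1
    (Quotient.out_eq (S.classifyingMap p) : S.classifyingMap (S.classifyingMap p).out = _).symm
  have h1 := mfderiv_comp p ((hs.contMDiff (Φ p)).mdifferentiableAt (by simp))
    (hΦ.mdifferentiableAt hp)
  have h2 : S.classifyingMap ∘ Φ =ᶠ[𝓝 p] S.classifyingMap := by
    filter_upwards [Φ.open_source.mem_nhds hp] with q hq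
    exact (S.classifyingMap_eq_iff.2 ⟨Φ, hΦ, hq, rfl⟩).symm
  rw [h2.mfderiv_eq] at h1
  have h3 := congrArg (fun A => A (S.frame p w)) h1
  have h4 : (mfderiv (𝓡 (n + k)) (𝓡 d) S.classifyingMap p (S.frame p w) : Euc d) =
      mfderiv (𝓡 (n + k)) (𝓡 d) S.classifyingMap (Φ p) (S.frame (Φ p) w) := by
    rw [← hΦ.mfderiv_frame hp]
    exact h3
  rw [hpq] at h4
  exact h4.symm

theorem isInvariantMap_comp_classifyingMap
    (hs : Manifold.IsSubmersion (𝓡 (n + k)) (𝓡 d) ∞ S.classifyingMap) {V : Type*}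
    [NormedAddCommGroup V] [NormedSpace ℝ V] {f : S.ClassifyingSpace → V}
    (hf : ContMDiff (𝓡 d) 𝓘(ℝ, V) ∞ f) : S.IsInvariantMap (f ∘ S.classifyingMap) :=
  isInvariantMap_comp_classifyingMap_of_contMDiff (hf.comp hs.contMDiff)

/-- Derivatives along the anchor on X become derivatives along frame fields on P, where every
algebroid identity is verified. -/
theorem lieDeriv_anchorMap
    (hs : Manifold.IsSubmersion (𝓡 (n + k)) (𝓡 d) ∞ S.classifyingMap) {f : S.ClassifyingSpace → ℝ}
    (hf : ContMDiff (𝓡 d) 𝓘(ℝ, ℝ) ∞ f) (p : P) (w : Euc n × Euc k) :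
    lieDeriv f (S.classifyingMap p) (S.anchorMap d (S.classifyingMap p) w) =
      mvfderiv (𝓡 (n + k)) (f ∘ S.classifyingMap) p (S.frame p w) := by
  rw [mvfderiv_comp_classifyingMap hs hf, anchorMap_classifyingMap hs]
  rfl

theorem trivialSection_ext {V : Type*} [NormedAddCommGroup V] [NormedSpace ℝ V]
    {s t : TrivialSection d S.ClassifyingSpace V}
    (h : ∀ p, s (S.classifyingMap p) = t (S.classifyingMap p)) : s = t := by
  refine ContMDiffMap.ext fun x => ?_
  obtain ⟨p, rfl⟩ := S.classifyingMap_surjective x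
  exact h p

theorem smoothOneForm_pullbackOneForm
    (hs : Manifold.IsSubmersion (𝓡 (n + k)) (𝓡 d) ∞ S.classifyingMap) (η : S.OneForm d) :
    SmoothOneForm (S.pullbackOneForm d η) := by
  have h1 : ContMDiff (𝓡 (n + k)).tangent 𝓘(ℝ, (Euc n × Euc k) →L[ℝ] ℝ) ∞
      (fun ξ : TangentBundle (𝓡 (n + k)) P => η (S.classifyingMap ξ.proj)) :=
    (η.contMDiff.comp hs.contMDiff).comp (Bundle.contMDiff_proj _)
  exact h1.clm_apply S.smooth_coframe

theorem extDerivOneForm_frame {V : Type*} [NormedAddCommGroup V] [NormedSpace ℝ V]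
    {η : (p : P) → TangentSpace (𝓡 (n + k)) p →L[ℝ] V} (hη : SmoothOneForm η)
    {s t : P → Euc n × Euc k} (hs : ContMDiff (𝓡 (n + k)) 𝓘(ℝ, Euc n × Euc k) ∞ s)
    (ht : ContMDiff (𝓡 (n + k)) 𝓘(ℝ, Euc n × Euc k) ∞ t) (p : P) :
    extDerivOneForm η p (S.frame p (s p)) (S.frame p (t p)) =
      mvfderiv (𝓡 (n + k)) (fun q => η q (S.frame q (t q))) p (S.frame p (s p)) -
      mvfderiv (𝓡 (n + k)) (fun q => η q (S.frame q (s q))) p (S.frame p (t p)) -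
      η p (S.frame p (S.frameBracket s t p)) := by
  have h := extDerivOneForm_apply hη (S.smoothFieldAt_frame (hs p)) (S.smoothFieldAt_frame (ht p))
  rw [h, frameBracket, S.frame_coframe]

/-- The bracket of the classifying Lie algebroid. -/
def sectionBracket (hs : Manifold.IsSubmersion (𝓡 (n + k)) (𝓡 d) ∞ S.classifyingMap)
    (s t : TrivialSection d S.ClassifyingSpace (Euc n × Euc k)) :
    TrivialSection d S.ClassifyingSpace (Euc n × Euc k) :=
  ⟨((isInvariantMap_comp_classifyingMap hs s.contMDiff).frameBracket
    (isInvariantMap_comp_classifyingMap hs t.contMDiff)).descend, contMDiff_descend hs _⟩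

/-- Alternating forms on the coframe whose values are invariant descend to the classifying
space. -/
theorem exists_contMDiff_descend_alternating
    (hs : Manifold.IsSubmersion (𝓡 (n + k)) (𝓡 d) ∞ S.classifyingMap) {V W : Type*}
    [NormedAddCommGroup V] [NormedSpace ℝ V] [FiniteDimensional ℝ V] [NormedAddCommGroup W]
    [NormedSpace ℝ W] {b : P → V → V → W}
    (hadd : ∀ p v v' w, b p (v + v') w = b p v w + b p v' w)
    (hsmul : ∀ p (c : ℝ) v w, b p (c • v) w = c • b p v w) (halt : ∀ p v w, b p v w = -b p w v)
    (hb : ∀ v w, S.IsInvariantMap fun p => b p v w) :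
    ∃ T : S.ClassifyingSpace → V [⋀^Fin 2]→L[ℝ] W,
      ContMDiff (𝓡 d) 𝓘(ℝ, V [⋀^Fin 2]→L[ℝ] W) ∞ T ∧
      ∀ p v w, T (S.classifyingMap p) ![v, w] = b p v w := by
  have hr : ∀ {Q : S.ClassifyingSpace → Prop}, (∀ p, Q (S.classifyingMap p)) → ∀ x, Q x := by
    intro Q h x
    obtain ⟨p, rfl⟩ := S.classifyingMap_surjective x
    exact h p
  obtain ⟨T, hT, hTb⟩ := exists_contMDiff_alternating (I := 𝓡 d)
    (b := fun x v w => (hb v w).descend x) (hr hadd) (hr hsmul) (hr halt)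
    (fun v w => contMDiff_descend hs (hb v w))
  exact ⟨T, hT, fun p => hTb (S.classifyingMap p)⟩

/-- The values of d(H^*η) on constant frame fields are invariant, so they descend to X. -/
theorem exists_twoForm (hs : Manifold.IsSubmersion (𝓡 (n + k)) (𝓡 d) ∞ S.classifyingMap)
    (η : S.OneForm d) : ∃ τ : S.TwoForm d, ∀ (p : P) (ξ₁ ξ₂ : TangentSpace (𝓡 (n + k)) p),
      τ (S.classifyingMap p) ![S.coframe p ξ₁, S.coframe p ξ₂] =
        extDerivOneForm (S.pullbackOneForm d η) p ξ₁ ξ₂ := by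
  have hη := smoothOneForm_pullbackOneForm hs η
  have hηi := isInvariantMap_comp_classifyingMap hs η.contMDiff
  obtain ⟨T, hT, hTb⟩ := exists_contMDiff_descend_alternating hs
    (b := fun p v w => extDerivOneForm (S.pullbackOneForm d η) p (S.frame p v) (S.frame p w))
    (fun p v v' w => by rw [map_add, extDerivOneForm_add_left])
    (fun p c v w => by rw [map_smul, extDerivOneForm_smul_left])
    (fun p v w => extDerivOneForm_swap _ _ _ _) (fun v w => by
      have hc : ∀ w : Euc n × Euc k, S.IsInvariantMap
          (fun q => S.pullbackOneForm d η q (S.frame q w)) := by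
        intro w
        have h := hηi.clm_comp (ContinuousLinearMap.apply ℝ ℝ w)
        refine ⟨fun p => (h.contMDiff p).congr_of_eventuallyEq ?_, fun Φ hΦ p hp => ?_⟩
        · filter_upwards with q
          exact congrArg (η (S.classifyingMap q)) (S.coframe_frame q w)
        · change η (S.classifyingMap (Φ p)) (S.coframe (Φ p) (S.frame (Φ p) w)) =
            η (S.classifyingMap p) (S.coframe p (S.frame p w))
          rw [S.coframe_frame, S.coframe_frame]
          exact h.invariant Φ hΦ p hp
      have hv := isInvariantMap_const (S := S) v
      have hw := isInvariantMap_const (S := S) w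
      have hfb := hv.frameBracket hw
      -- Cartan's formula exhibits the value as built from coframe derivatives of invariants and an
      -- invariant bracket.
      have e : (fun p => extDerivOneForm (S.pullbackOneForm d η) p (S.frame p v) (S.frame p w)) =
          fun p => mvfderiv (𝓡 (n + k)) (fun q => S.pullbackOneForm d η q (S.frame q w)) p
              (S.frame p v) -
            mvfderiv (𝓡 (n + k)) (fun q => S.pullbackOneForm d η q (S.frame q v)) p (S.frame p w) -
            η (S.classifyingMap p) (S.frameBracket (fun _ => v) (fun _ => w) p) := by
        funext p
        rw [extDerivOneForm_frame hη (s := fun _ => v) (t := fun _ => w) hv.contMDiff hw.contMDiff]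
        congr 1
        exact congrArg (η (S.classifyingMap p)) (S.coframe_frame p _)
      rw [e]
      have h1 := (hc w).mvfderiv_frame hv
      have h2 := (hc v).mvfderiv_frame hw
      refine ⟨(h1.contMDiff.sub h2.contMDiff).sub (hηi.contMDiff.clm_apply hfb.contMDiff),
        fun Φ hΦ p hp => ?_⟩
      have e1 := h1.invariant Φ hΦ p hp
      have e2 := h2.invariant Φ hΦ p hp
      have e3 := hηi.invariant Φ hΦ p hp
      have e4 := hfb.invariant Φ hΦ p hp
      simp only [comp_apply] at e3
      rw [e1, e2, e3, e4])
  refine ⟨⟨T, hT⟩, fun p ξ₁ ξ₂ => ?_⟩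
  have h := hTb p (S.coframe p ξ₁) (S.coframe p ξ₂)
  rw [S.frame_coframe, S.frame_coframe] at h
  exact h

variable [IsManifold (𝓡 d) ∞ S.ClassifyingSpace]

/-- Composed with h, the field is the tangent map of h applied to a smooth frame field; smoothness
then descends along the submersion. -/
theorem smoothFieldAt_anchorMap
    (hs : Manifold.IsSubmersion (𝓡 (n + k)) (𝓡 d) ∞ S.classifyingMap) (w : Euc n × Euc k)
    (x : S.ClassifyingSpace) : SmoothFieldAt (fun x => S.anchorMap d x w) x := by
  obtain ⟨p, rfl⟩ := S.classifyingMap_surjective x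
  refine contMDiffAt_of_comp_isSubmersion hs ?_
  have h1 : ContMDiff (𝓡 (n + k)).tangent (𝓡 d).tangent ∞
      (tangentMap (𝓡 (n + k)) (𝓡 d) S.classifyingMap) :=
    hs.contMDiff.contMDiff_tangentMap (by simp)
  refine (h1.contMDiffAt.comp p (S.smoothFieldAt_frame_const w p)).congr_of_eventuallyEq ?_
  filter_upwards with q
  simp only [comp_apply, anchorMap_classifyingMap hs]
  rfl

/-- The classifying Lie algebroid. -/
def classifyingAlgebroid (hs : Manifold.IsSubmersion (𝓡 (n + k)) (𝓡 d) ∞ S.classifyingMap) :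
    TrivialLieAlgebroid d S.ClassifyingSpace (Euc n × Euc k) where
  anchor := S.anchorMap d
  smooth_anchor := contMDiff_linear_family fun w x => smoothFieldAt_anchorMap hs w x
  -- Each axiom is checked after composing with the surjection h, where it is the corresponding law
  -- for frame fields.
  bracket := LinearMap.mk₂ ℝ (sectionBracket hs)
    (fun s s' t => trivialSection_ext fun p => congrFun (S.frameBracket_add_left
      (s.contMDiff.comp hs.contMDiff) (s'.contMDiff.comp hs.contMDiff)) p)
    (fun c s t => trivialSection_ext fun p => congrFun (S.frameBracket_const_smul_left
      (s.contMDiff.comp hs.contMDiff) c) p)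
    (fun t s s' => trivialSection_ext fun p => congrFun (S.frameBracket_add_right
      (s.contMDiff.comp hs.contMDiff) (s'.contMDiff.comp hs.contMDiff)) p)
    (fun c t s => trivialSection_ext fun p => congrFun (S.frameBracket_const_smul_right
      (s.contMDiff.comp hs.contMDiff) c) p)
  bracket_self s := trivialSection_ext fun p => congrFun S.frameBracket_self p
  jacobi s t r := trivialSection_ext fun p => congrFun (S.frameBracket_jacobi
    (s.contMDiff.comp hs.contMDiff) (t.contMDiff.comp hs.contMDiff)
    (r.contMDiff.comp hs.contMDiff)) p
  leibniz s t f x := by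
    obtain ⟨p, rfl⟩ := S.classifyingMap_surjective x
    rw [lieDeriv_anchorMap hs f.contMDiff]
    exact S.frameBracket_smul_right (t.contMDiff.comp hs.contMDiff)
      (f.contMDiff.comp hs.contMDiff) p

/-! ### The differential -/

/-- The differential of the classifying Lie algebroid. -/
def algebroidDifferential (hs : Manifold.IsSubmersion (𝓡 (n + k)) (𝓡 d) ∞ S.classifyingMap) :
    S.AlgebroidDifferential d where
  d₀ f := ⟨(isInvariantMap_comp_classifyingMap hs f.contMDiff).mvfderiv_frameL.descend,
    contMDiff_descend hs _⟩
  d₁ η := (exists_twoForm hs η).choose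
  pullback_d₀ f p ξ := by
    change mvfderiv (𝓡 (n + k)) (f ∘ S.classifyingMap) p (S.frame p (S.coframe p ξ)) = _
    rw [S.frame_coframe]
    rfl
  pullback_d₁ η := (exists_twoForm hs η).choose_spec

/-- On P the second condition is Cartan's formula for d(H^*η), solved for the bracket term. -/
theorem isClassifyingAlgebroid_classifyingAlgebroid
    (hs : Manifold.IsSubmersion (𝓡 (n + k)) (𝓡 d) ∞ S.classifyingMap) :
    S.IsClassifyingAlgebroid d (classifyingAlgebroid hs) := by
  refine ⟨algebroidDifferential hs, fun s f x => ?_, fun s t η x => ?_⟩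
  · obtain ⟨p, rfl⟩ := S.classifyingMap_surjective x
    exact lieDeriv_anchorMap hs f.contMDiff p _
  · obtain ⟨p, rfl⟩ := S.classifyingMap_surjective x
    have hη := smoothOneForm_pullbackOneForm hs η
    have h1 := extDerivOneForm_frame (S := S) hη (s.contMDiff.comp hs.contMDiff)
      (t.contMDiff.comp hs.contMDiff) p
    have h2 := (algebroidDifferential hs).pullback_d₁ η p (S.frame p (s (S.classifyingMap p)))
      (S.frame p (t (S.classifyingMap p)))
    rw [S.coframe_frame, S.coframe_frame] at h2
    have h3 : ∀ s : TrivialSection d S.ClassifyingSpace (Euc n × Euc k),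
        (fun q => S.pullbackOneForm d η q (S.frame q ((s ∘ S.classifyingMap) q))) =
          (fun y => η y (s y)) ∘ S.classifyingMap := fun s => funext fun q =>
      congrArg (η (S.classifyingMap q)) (S.coframe_frame q _)
    have h4 : S.pullbackOneForm d η p (S.frame p (S.frameBracket (s ∘ S.classifyingMap)
        (t ∘ S.classifyingMap) p)) = η (S.classifyingMap p)
          (sectionBracket hs s t (S.classifyingMap p)) :=
      congrArg (η (S.classifyingMap p)) (S.coframe_frame p _)
    rw [h3, h3, h4] at h1
    have h5 := lieDeriv_anchorMap hs (η.contMDiff.clm_apply t.contMDiff) p (s (S.classifyingMap p))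
    have h6 := lieDeriv_anchorMap hs (η.contMDiff.clm_apply s.contMDiff) p (t (S.classifyingMap p))
    have h7 := h2.trans h1
    change η (S.classifyingMap p) (sectionBracket hs s t (S.classifyingMap p)) =
      lieDeriv (fun y => η y (t y)) (S.classifyingMap p)
        (S.anchorMap d (S.classifyingMap p) (s (S.classifyingMap p))) -
      lieDeriv (fun y => η y (s y)) (S.classifyingMap p)
        (S.anchorMap d (S.classifyingMap p) (t (S.classifyingMap p))) - _
    rw [h5, h6, h7]
    simp only [comp_apply]
    abel

/-- Since h is surjective and H is fibrewise bijective, H^* d_A = d H^* fixes every value of d_A.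
This determines the anchor, because global functions separate tangent vectors, and then the bracket.
-/
theorem isClassifyingAlgebroid_unique (hS : S.IsFullyRegular d)
    (hs : Manifold.IsSubmersion (𝓡 (n + k)) (𝓡 d) ∞ S.classifyingMap)
    {A A' : TrivialLieAlgebroid d S.ClassifyingSpace (Euc n × Euc k)}
    (hA : S.IsClassifyingAlgebroid d A) (hA' : S.IsClassifyingAlgebroid d A') : A = A' := by
  obtain ⟨D, h1, h2⟩ := hA
  obtain ⟨D', h1', h2'⟩ := hA'
  have hanchor : A.anchor = A'.anchor := by
    funext x
    refine ContinuousLinearMap.ext fun w => tangentSpace_ext hS hs fun f => ?_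
    obtain ⟨p, rfl⟩ := S.classifyingMap_surjective x
    have e := h1 ⟨fun _ => w, contMDiff_const⟩ f (S.classifyingMap p)
    have e' := h1' ⟨fun _ => w, contMDiff_const⟩ f (S.classifyingMap p)
    have e1 := D.pullback_d₀ f p (S.frame p w)
    have e1' := D'.pullback_d₀ f p (S.frame p w)
    have e2 : ∀ η : S.OneForm d, S.pullbackOneForm d η p (S.frame p w) =
        η (S.classifyingMap p) w := fun η => congrArg (η _) (S.coframe_frame p w)
    rw [e2] at e1 e1'
    exact e.trans ((e1.trans e1'.symm).trans e'.symm)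
  have hbracket : A.bracket = A'.bracket := by
    refine LinearMap.ext₂ fun s t => trivialSection_ext fun p => ?_
    refine (SeparatingDual.eq_iff_forall_dual_eq (R := ℝ)).2 fun T => ?_
    -- Constant one-forms suffice to separate the values of a section.
    have e := h2 s t ⟨fun _ => T, contMDiff_const⟩ (S.classifyingMap p)
    have e' := h2' s t ⟨fun _ => T, contMDiff_const⟩ (S.classifyingMap p)
    have e1 := D.pullback_d₁ ⟨fun _ => T, contMDiff_const⟩ p (S.frame p (s (S.classifyingMap p)))
      (S.frame p (t (S.classifyingMap p)))
    have e1' := D'.pullback_d₁ ⟨fun _ => T, contMDiff_const⟩ p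
      (S.frame p (s (S.classifyingMap p))) (S.frame p (t (S.classifyingMap p)))
    rw [S.coframe_frame, S.coframe_frame] at e1 e1'
    rw [e1, hanchor] at e
    rw [e1'] at e'
    exact e.trans e'.symm
  cases A
  cases A'
  simp only at hanchor hbracket
  subst hanchor
  subst hbracket
  rfl

end GStructureWithConnection

/-! ### Brackets of frame fields involving vertical directions. -/

/-- The exterior derivative commutes with pullback: the second derivatives of F are symmetric and
cancel. -/
theorem fderiv_pullback_sub {E E' V : Type*} [NormedAddCommGroup E] [NormedSpace ℝ E]
    [NormedAddCommGroup E'] [NormedSpace ℝ E'] [NormedAddCommGroup V] [NormedSpace ℝ V]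
    {F : E → E'} {η : E' → E' →L[ℝ] V} {z : E} (hF : ContDiffAt ℝ 2 F z)
    (hη : DifferentiableAt ℝ η (F z)) (u w : E) :
    fderiv ℝ (fun z => η (F z) (fderiv ℝ F z u)) z w -
      fderiv ℝ (fun z => η (F z) (fderiv ℝ F z w)) z u =
    fderiv ℝ η (F z) (fderiv ℝ F z w) (fderiv ℝ F z u) -
      fderiv ℝ η (F z) (fderiv ℝ F z u) (fderiv ℝ F z w) := by
  have hd : DifferentiableAt ℝ F z := hF.differentiableAt (by simp)
  have hd2 : DifferentiableAt ℝ (fderiv ℝ F) z :=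
    (hF.fderiv_right (m := 1) (by norm_num)).differentiableAt (by simp)
  have key (a b : E) : fderiv ℝ (fun z => η (F z) (fderiv ℝ F z a)) z b =
      η (F z) (fderiv ℝ (fderiv ℝ F) z b a) +
        fderiv ℝ η (F z) (fderiv ℝ F z b) (fderiv ℝ F z a) := by
    have h1 : HasFDerivAt (fun z => fderiv ℝ F z a)
        ((fderiv ℝ (fderiv ℝ F) z).flip a) z := by
      simpa using hd2.hasFDerivAt.clm_apply (hasFDerivAt_const a z)
    have h2 := (hη.hasFDerivAt.comp z hd.hasFDerivAt).clm_apply h1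
    exact congrArg (fun T => T b) h2.fderiv
  rw [key, key, (hF.isSymmSndFDerivAt (by simp)) u w]
  abel

namespace GStructureWithConnection

variable {n k : ℕ} {G : Type*} [TopologicalSpace G] [ChartedSpace (Euc k) G] [Group G]
  {L : ClosedLinearGroup n k G} {P : Type*} [TopologicalSpace P]
  [ChartedSpace (Euc (n + k)) P] [IsManifold (𝓡 (n + k)) ∞ P] (S : GStructureWithConnection L P)

theorem coframe_generator (p : P) (α : Euc k) :
    S.coframe p (mfderiv (𝓡 k) (𝓡 (n + k)) (fun g : G => S.act p g) 1 α) = (0, α) :=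
  Prod.ext (S.horizontal p α) (S.vertical p α)

theorem frame_vertical (p : P) (α : Euc k) :
    S.frame p (0, α) = mfderiv (𝓡 k) (𝓡 (n + k)) (fun g : G => S.act p g) 1 α := by
  rw [← S.coframe_generator p α]
  exact S.frame_coframe p _

theorem contMDiff_act_left (p : P) :
    ContMDiff (𝓡 k) (𝓡 (n + k)) ∞ (fun g : G => S.act p g) :=
  S.contMDiff_act.comp (contMDiff_const.prodMk contMDiff_id)

variable [LieGroup (𝓡 k) ∞ G]

/-- Differentiate p(gh) = (pg)h at h = 1: an orbit map relates the left-invariant field of α to the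
infinitesimal generator. -/
theorem mfderiv_act_mulInvariantVectorField (p : P) (α : GroupLieAlgebra (𝓡 k) G) (g : G) :
    mfderiv (𝓡 k) (𝓡 (n + k)) (fun g : G => S.act p g) g (mulInvariantVectorField α g) =
      S.frame (S.act p g) (0, α) := by
  rw [S.frame_vertical (S.act p g) α]
  have h := mfderiv_comp (I := 𝓡 k) (I' := 𝓡 k) (I'' := 𝓡 (n + k)) (1 : G)
    (g := fun g : G => S.act p g) (f := fun h : G => g * h)
    ((S.contMDiff_act_left p).contMDiffAt.mdifferentiableAt (by simp))
    ((contMDiff_mul_left (I := 𝓡 k) (n := ∞)).contMDiffAt.mdifferentiableAt (by simp))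
  have hf : (fun g : G => S.act p g) ∘ (fun h : G => g * h) = fun h => S.act (S.act p g) h := by
    funext h; exact S.act_mul p g h
  rw [hf] at h
  let D : G → Euc k →L[ℝ] Euc (n + k) :=
    fun g => mfderiv (𝓡 k) (𝓡 (n + k)) (fun g : G => S.act p g) g
  have hD : D (g * 1) = D g := by rw [mul_one]
  have h2 := congrArg (fun T => T (mfderiv (𝓡 k) (𝓡 k) (fun h : G => g * h) 1 α)) hD
  exact h2.symm.trans (congrArg (fun T => T α) h).symm

/-- Orbit maps relate left-invariant fields to generators, hence also their brackets. As the action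
is on the right, no sign appears. -/
theorem frameBracket_vertical (α β : Euc k) (p : P) :
    S.frameBracket (fun _ => (0, α)) (fun _ => (0, β)) p = (0, lieBr G α β) := by
  have hG : LieGroup (𝓡 k) (minSmoothness ℝ 3) G :=
    LieGroup.of_le (n := ∞) (by simpa using (WithTop.coe_le_coe.2 le_top : ((3 : ℕ∞) : ℕ∞ω) ≤ ∞))
  have hX (γ : GroupLieAlgebra (𝓡 k) G) : ContMDiffAt (𝓡 k) (𝓡 k).tangent 1
      (fun g => (⟨g, mulInvariantVectorField γ g⟩ : TangentBundle (𝓡 k) G)) 1 :=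
    (contMDiffAt_mulInvariantVectorField γ).of_le (by simp)
  have hE (w : Euc n × Euc k) (q : P) : ContMDiffAt (𝓡 (n + k)) (𝓡 (n + k)).tangent 1
      (fun q => (⟨q, S.frame q w⟩ : TangentBundle (𝓡 (n + k)) P)) q :=
    (S.smoothFieldAt_frame_const w q).of_le (by simp)
  have hI : IsManifold (𝓡 k) ∞ G := inferInstance
  have h := mfderiv_mlieBracket_of_related (m := k) (l := n + k) (f := fun g : G => S.act p g)
    (p := (1 : G)) (Filter.Eventually.of_forall fun q => (S.contMDiff_act_left p).contMDiffAt)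
    (hX α) (hX β) (hE (0, α) _) (hE (0, β) _)
    (Filter.Eventually.of_forall (S.mfderiv_act_mulInvariantVectorField p α))
    (Filter.Eventually.of_forall (S.mfderiv_act_mulInvariantVectorField p β))
  have h2 : S.frame p (0, lieBr G α β) = VectorField.mlieBracket (𝓡 (n + k))
      (fun q => S.frame q (0, α)) (fun q => S.frame q (0, β)) p := by
    rw [S.frame_vertical]
    let D : P → Euc (n + k) := fun q => VectorField.mlieBracket (𝓡 (n + k))
      (fun q => S.frame q (0, α)) (fun q => S.frame q (0, β)) q
    have hD : D (S.act p 1) = D p := by rw [S.act_one]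
    exact h.trans hD
  have h3 := congrArg (S.coframe p) h2
  rw [S.coframe_frame] at h3
  exact h3.symm

end GStructureWithConnection

/-- Coordinate form of the pullback of η along a map from a vector space. It is applied to partial
maps of the action, in the point and in the group element. -/
theorem formInChart_fderiv_comp {m : ℕ} {M : Type*} [TopologicalSpace M] [ChartedSpace (Euc m) M]
    {V : Type*} [NormedAddCommGroup V] [NormedSpace ℝ V]
    {e : OpenPartialHomeomorph M (Euc m)} (he : e ∈ IsManifold.maximalAtlas (𝓡 m) ∞ M)
    (η : (p : M) → TangentSpace (𝓡 m) p →L[ℝ] V)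
    {E : Type*} [NormedAddCommGroup E] [NormedSpace ℝ E] {f : E → M} {z : E}
    (hf : MDifferentiableAt 𝓘(ℝ, E) (𝓡 m) f z) (hz : f z ∈ e.source) (ζ : E) :
    formInChart e η (e (f z)) (fderiv ℝ (fun z => e (f z)) z ζ) =
      η (f z) (mfderiv 𝓘(ℝ, E) (𝓡 m) f z ζ) := by
  have h1 := mfderiv_comp z ((mdifferentiable_of_mem_maximalAtlas he).mdifferentiableAt hz) hf
  rw [mfderiv_eq_fderiv] at h1
  have h2 := mfderiv_symm_mfderiv_chart he hz (mfderiv 𝓘(ℝ, E) (𝓡 m) f z ζ)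
  have h3 : ∀ q, q = f z → ∀ ξ : Euc m, (show V from η q ξ) = η (f z) ξ := by
    rintro _ rfl _; rfl
  have h4 : mfderiv 𝓘(ℝ, Euc m) (𝓡 m) e.symm (e (f z)) (fderiv ℝ (fun z => e (f z)) z ζ) =
      mfderiv 𝓘(ℝ, E) (𝓡 m) f z ζ :=
    (congrArg (fun A : E →L[ℝ] Euc m =>
      mfderiv 𝓘(ℝ, Euc m) (𝓡 m) e.symm (e (f z)) (A ζ)) h1).trans h2
  exact (h3 _ (e.left_inv hz) _).trans (congrArg (η (f z)) h4)

/-- Inversion has derivative -1 at the identity, so differentiating g⁻¹v at g = 1 in the direction α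
gives -α · v. -/
theorem ClosedLinearGroup.hasFDerivAt_toGL_inv_apply {n k : ℕ} {G : Type*} [TopologicalSpace G]
    [ChartedSpace (Euc k) G] [Group G] (L : ClosedLinearGroup n k G)
    {e : OpenPartialHomeomorph G (Euc k)} (he : e ∈ IsManifold.maximalAtlas (𝓡 k) ∞ G)
    (h1 : (1 : G) ∈ e.source) (v : Euc n) :
    ∃ A : Euc k →L[ℝ] Euc n,
      HasFDerivAt (fun y => (L.toGL (e.symm y)⁻¹ : Euc n →L[ℝ] Euc n) v) A (e 1) ∧
      ∀ α : GroupLieAlgebra (𝓡 k) G,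
        A (mfderiv (𝓡 k) 𝓘(ℝ, Euc k) e 1 α) = -L.lieAct α v := by
  let M : Euc k → (Euc n →L[ℝ] Euc n) := fun y => L.toGL (e.symm y)
  have hM : DifferentiableAt ℝ M (e 1) := by
    have h := (L.contMDiff (e.symm (e 1))).mdifferentiableAt (by simp)
    exact mdifferentiableAt_iff_differentiableAt.1 (h.comp (e 1)
      ((mdifferentiable_of_mem_maximalAtlas he).symm.mdifferentiableAt (e.map_source h1)))
  have hM1 : M (e 1) = ((1 : (Euc n →L[ℝ] Euc n)ˣ) : Euc n →L[ℝ] Euc n) := by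
    simp only [M, e.left_inv h1, map_one]
  have hinv := hasFDerivAt_ringInverse (𝕜 := ℝ) (1 : (Euc n →L[ℝ] Euc n)ˣ)
  rw [← hM1] at hinv
  have hc := (hinv.comp (e 1) hM.hasFDerivAt).clm_apply (hasFDerivAt_const v (e 1))
  have hf : (fun y => (Ring.inverse ∘ M) y v) =
      fun y => (L.toGL (e.symm y)⁻¹ : Euc n →L[ℝ] Euc n) v := by
    funext y
    simp only [comp_apply, M, Ring.inverse_unit, map_inv]
  rw [hf] at hc
  refine ⟨-(fderiv ℝ M (e 1)).flip v, hc.congr_fderiv (by ext b; simp), fun α => ?_⟩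
  have h2 := mfderiv_eq_fderiv_chart (f := fun g => (L.toGL g : Euc n →L[ℝ] Euc n) v)
    (g := fun y => M y v) he h1 (fun _ _ => rfl) (hM.clm_apply (differentiableAt_const v)) α
  have h3 : fderiv ℝ (fun y => M y v) (e 1) = (fderiv ℝ M (e 1)).flip v := by
    simpa using (hM.hasFDerivAt.clm_apply (hasFDerivAt_const v (e 1))).fderiv
  rw [h3] at h2
  exact congrArg Neg.neg h2.symm

namespace GStructureWithConnection

variable {n k : ℕ} {G : Type*} [TopologicalSpace G] [ChartedSpace (Euc k) G] [Group G]
  {L : ClosedLinearGroup n k G} {P : Type*} [TopologicalSpace P]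
  [ChartedSpace (Euc (n + k)) P] [IsManifold (𝓡 (n + k)) ∞ P] (S : GStructureWithConnection L P)

theorem coframe_act_frame (p : P) (g : G) (w : Euc n × Euc k) :
    S.coframe (S.act p g)
      (mfderiv (𝓡 (n + k)) (𝓡 (n + k)) (fun q : P => S.act q g) p (S.frame p w)) =
      ((L.toGL g⁻¹ : Euc n →L[ℝ] Euc n) w.1, adjointAct g⁻¹ w.2) := by
  have h := S.coframe_frame p w
  have h1 : S.θ p (S.frame p w) = w.1 := congrArg Prod.fst h
  have h2 : S.conn p (S.frame p w) = w.2 := congrArg Prod.snd h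
  refine Prod.ext ((S.equivariant_θ g p _).trans ?_) ((S.equivariant_conn g p _).trans ?_)
  · rw [h1]
  · rw [h2]

theorem coframe_act_one_generator (p : P) (α : Euc k) :
    S.coframe (S.act p 1) (mfderiv (𝓡 k) (𝓡 (n + k)) (fun g : G => S.act p g) 1 α) =
      (0, α) := by
  have h : ∀ q, q = p → ∀ ξ : Euc (n + k),
      (show Euc n × Euc k from S.coframe q ξ) = S.coframe p ξ := by
    rintro _ rfl _; rfl
  exact (h _ (S.act_one p) _).trans (S.coframe_generator p α)

variable [LieGroup (𝓡 k) ∞ G]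

/-- Pull the coframe back along the action (x, g) ↦ xg and compute its exterior derivative on a
horizontal vector at p and the direction α in G. Only the change of g⁻¹v with g contributes; the
structure equation converts the result into the bracket. -/
theorem frameBracket_vertical_horizontal (α : Euc k) (v : Euc n) (p : P) :
    S.frameBracket (fun _ => (0, α)) (fun _ => (v, 0)) p = (L.lieAct α v, 0) := by
  set e := chartAt (Euc (n + k)) p
  set ψ := chartAt (Euc k) (1 : G)
  have he : e ∈ IsManifold.maximalAtlas (𝓡 (n + k)) ∞ P := IsManifold.chart_mem_maximalAtlas p
  have hψ : ψ ∈ IsManifold.maximalAtlas (𝓡 k) ∞ G := IsManifold.chart_mem_maximalAtlas 1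
  have h1 : (1 : G) ∈ ψ.source := mem_chart_source _ _
  obtain ⟨x₀, hx₀, hp⟩ : ∃ x ∈ e.target, e.symm x = p :=
    ⟨e p, mem_chart_target _ _, e.left_inv (mem_chart_source _ _)⟩
  clear_value e ψ
  subst hp
  let f : Euc (n + k) × Euc k → P := fun z => S.act (e.symm z.1) (ψ.symm z.2)
  have hy₀ := ψ.map_source h1
  have hfz : f (x₀, ψ 1) = e.symm x₀ := by simp only [f, ψ.left_inv h1, S.act_one]
  have hes : ∀ x ∈ e.target, ContMDiffAt 𝓘(ℝ, Euc (n + k)) (𝓡 (n + k)) ∞ e.symm x := fun x hx =>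
    (contMDiffOn_symm_of_mem_maximalAtlas he).contMDiffAt (e.open_target.mem_nhds hx)
  have hψs : ∀ y ∈ ψ.target, ContMDiffAt 𝓘(ℝ, Euc k) (𝓡 k) ∞ ψ.symm y := fun y hy =>
    (contMDiffOn_symm_of_mem_maximalAtlas hψ).contMDiffAt (ψ.open_target.mem_nhds hy)
  have hf : ∀ x ∈ e.target, ∀ y ∈ ψ.target,
      ContMDiffAt 𝓘(ℝ, Euc (n + k) × Euc k) (𝓡 (n + k)) ∞ f (x, y) := by
    intro x hx y hy
    have a1 : ContMDiffAt 𝓘(ℝ, Euc (n + k) × Euc k) (𝓡 (n + k)) ∞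
        (fun z : Euc (n + k) × Euc k => e.symm z.1) (x, y) :=
      ContMDiffAt.comp (x, y) (hes x hx) contDiffAt_fst.contMDiffAt
    have a2 : ContMDiffAt 𝓘(ℝ, Euc (n + k) × Euc k) (𝓡 k) ∞
        (fun z : Euc (n + k) × Euc k => ψ.symm z.2) (x, y) :=
      ContMDiffAt.comp (x, y) (hψs y hy) contDiffAt_snd.contMDiffAt
    exact (S.contMDiff_act _).comp (x, y) (a1.prodMk a2)
  have hF : ∀ x ∈ e.target, ∀ y ∈ ψ.target, f (x, y) ∈ e.source →
      ContDiffAt ℝ ∞ (fun z => e (f z)) (x, y) := fun x hx y hy h =>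
    contMDiffAt_iff_contDiffAt.1 (((contMDiffOn_of_mem_maximalAtlas he).contMDiffAt
      (e.open_source.mem_nhds h)).comp (x, y) (hf x hx y hy))
  have hsrc : f (x₀, ψ 1) ∈ e.source := by rw [hfz]; exact e.map_target hx₀
  let ξ : Euc (n + k) := fieldInChart e (fun q => S.frame q (v, 0)) x₀
  let a : Euc k := mfderiv (𝓡 k) 𝓘(ℝ, Euc k) ψ 1 α
  let F : Euc (n + k) × Euc k → Euc (n + k) := fun z => e (f z)
  let η := formInChart e S.coframe
  have hFz : F (x₀, ψ 1) = x₀ := (congrArg e hfz).trans (e.right_inv hx₀)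
  have hF₀ : ContDiffAt ℝ ∞ F (x₀, ψ 1) := hF x₀ hx₀ _ hy₀ hsrc
  have hη : DifferentiableAt ℝ η (F (x₀, ψ 1)) := by
    rw [hFz]
    exact (contDiffAt_formInChart he hx₀ S.smooth_coframe).differentiableAt (by simp)
  have h2 : (2 : ℕ∞ω) ≤ ∞ := WithTop.coe_le_coe.2 le_top
  have hΦ (u : Euc (n + k) × Euc k) :
      DifferentiableAt ℝ (fun z => η (F z) (fderiv ℝ F z u)) (x₀, ψ 1) :=
    (hη.comp (x₀, ψ 1) (hF₀.differentiableAt (by simp))).clm_apply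
      ((((hF₀.of_le h2).fderiv_right (m := 1) (by norm_num)).differentiableAt (by simp)).clm_apply
        (differentiableAt_const u))
  have hopen : ∀ᶠ z in 𝓝 (x₀, ψ 1), z.1 ∈ e.target ∧ z.2 ∈ ψ.target ∧ f z ∈ e.source := by
    filter_upwards [(e.open_target.preimage continuous_fst).mem_nhds
        (show (x₀, ψ 1) ∈ Prod.fst ⁻¹' e.target from hx₀),
      (ψ.open_target.preimage continuous_snd).mem_nhds
        (show (x₀, ψ 1) ∈ Prod.snd ⁻¹' ψ.target from hy₀),
      (hf x₀ hx₀ _ hy₀).continuousAt.preimage_mem_nhds (e.open_source.mem_nhds hsrc)]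
      with z a b c using ⟨a, b, c⟩
  -- With the point fixed and g varying, equivariance gives the value (g⁻¹v, 0) on the horizontal
  -- vector.
  have hA : ∀ᶠ y in 𝓝 (ψ 1), η (F (x₀, y)) (fderiv ℝ F (x₀, y) (ξ, 0)) =
      ((L.toGL (ψ.symm y)⁻¹ : Euc n →L[ℝ] Euc n) v, (0 : Euc k)) := by
    filter_upwards [((Continuous.prodMk_right x₀).tendsto (ψ 1)).eventually hopen]
      with y ⟨_, hy, hs⟩
    have a1 := (((hF x₀ hx₀ y hy hs).differentiableAt (by simp)).hasFDerivAt.comp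
      (f := fun x => (x, y)) x₀ (hasFDerivAt_prodMk_left x₀ y)).fderiv
    have a2 := mfderiv_comp x₀ (S.mdifferentiableAt_act_right (ψ.symm y) (e.symm x₀))
      ((hes x₀ hx₀).mdifferentiableAt (by simp))
    have a3 := formInChart_fderiv_comp he S.coframe (f := fun x => f (x, y))
      (((S.mdifferentiableAt_act_right (ψ.symm y) (e.symm x₀))).comp x₀
        ((hes x₀ hx₀).mdifferentiableAt (by simp))) hs ξ
    have a4 := (S.coframe_act_frame (e.symm x₀) (ψ.symm y) (v, 0)).trans
      (congrArg _ ((adjointAct (ψ.symm y)⁻¹).map_zero))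
    refine (congrArg (fun B => η (F (x₀, y)) (B ξ)) a1).symm.trans (a3.trans (Eq.trans ?_ a4))
    exact congrArg (S.coframe (f (x₀, y))) ((congrArg (fun B => B ξ) a2).trans
      (congrArg (mfderiv (𝓡 (n + k)) (𝓡 (n + k)) (fun q => S.act q (ψ.symm y)) (e.symm x₀))
        (mfderiv_symm_fieldInChart he hx₀ _)))
  -- With g = 1 and the point varying, the value on the group direction is that of a generator,
  -- hence constant.
  have hB : ∀ᶠ x in 𝓝 x₀, η (F (x, ψ 1)) (fderiv ℝ F (x, ψ 1) (0, a)) = (0, α) := by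
    filter_upwards [((Continuous.prodMk_left (ψ 1)).tendsto x₀).eventually hopen]
      with x ⟨hx, _, hs⟩
    have a1 := (((hF x hx _ hy₀ hs).differentiableAt (by simp)).hasFDerivAt.comp (ψ 1)
      (hasFDerivAt_prodMk_right x (ψ 1))).fderiv
    have b1 : MDifferentiableAt (𝓡 k) (𝓡 (n + k)) (fun g => S.act (e.symm x) g)
        (ψ.symm (ψ 1)) := (S.contMDiff_act_left (e.symm x)).contMDiffAt.mdifferentiableAt (by simp)
    have b2 := (hψs _ hy₀).mdifferentiableAt (n := ∞) (by simp)
    have a2 := mfderiv_comp (ψ 1) b1 b2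
    have a3 := formInChart_fderiv_comp he S.coframe (f := fun y => f (x, y)) (b1.comp _ b2) hs a
    have a4 : ∀ g : G, g = 1 → S.coframe (S.act (e.symm x) g)
        (mfderiv (𝓡 k) (𝓡 (n + k)) (fun g => S.act (e.symm x) g) g α) = (0, α) := by
      rintro _ rfl
      exact S.coframe_act_one_generator _ α
    refine (congrArg (fun B => η (F (x, ψ 1)) (B a)) a1).symm.trans
      (a3.trans (Eq.trans ?_ (a4 _ (ψ.left_inv h1))))
    exact congrArg (S.coframe (f (x, ψ 1))) ((congrArg (fun B => B a) a2).trans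
      (congrArg (mfderiv (𝓡 k) (𝓡 (n + k)) (fun g => S.act (e.symm x) g) (ψ.symm (ψ 1)))
        (mfderiv_symm_mfderiv_chart hψ h1 α)))
  obtain ⟨A, hA1, hA2⟩ := L.hasFDerivAt_toGL_inv_apply hψ h1 v
  have hdA : fderiv ℝ (fun z => η (F z) (fderiv ℝ F z (ξ, 0))) (x₀, ψ 1) (0, a) =
      (-L.lieAct α v, 0) := by
    have a1 := ((hΦ (ξ, 0)).hasFDerivAt.comp (ψ 1) (hasFDerivAt_prodMk_right x₀ (ψ 1))).unique
      ((hA1.prodMk (hasFDerivAt_const (0 : Euc k) (ψ 1))).congr_of_eventuallyEq hA)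
    exact (congrArg (fun B => B a) a1).trans (congrArg (fun u => (u, (0 : Euc k))) (hA2 α))
  have hdB : fderiv ℝ (fun z => η (F z) (fderiv ℝ F z (0, a))) (x₀, ψ 1) (ξ, 0) = 0 := by
    have a1 := ((hΦ (0, a)).hasFDerivAt.comp (f := fun x => (x, ψ 1)) x₀
      (hasFDerivAt_prodMk_left x₀ (ψ 1))).unique
      ((hasFDerivAt_const ((0, α) : Euc n × Euc k) x₀).congr_of_eventuallyEq hB)
    exact congrArg (fun B => B ξ) a1
  -- The left side is (-α · v, 0) by `hdA` and `hdB`; the right side is minus the bracket by the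
  -- structure equation.
  have key := fderiv_pullback_sub (hF₀.of_le h2) hη (ξ, 0) (0, a)
  have e1 : η x₀ (fderiv ℝ F (x₀, ψ 1) (0, a)) = (0, α) := by
    rw [← hB.self_of_nhds, hFz]
  have e2 : η x₀ (fderiv ℝ F (x₀, ψ 1) (ξ, 0)) = (v, 0) := by
    have := hA.self_of_nhds
    rw [hFz, ψ.left_inv h1] at this
    simpa using this
  rw [hdA, hdB, hFz, fderiv_formInChart_coframe_sub he hx₀] at key
  rw [e1, e2] at key
  simpa using congrArg Neg.neg key.symm

/-- The brackets of the frame fields with constant coefficients. -/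
theorem frameBracket_const (u v : Euc n) (α β : Euc k) (p : P) :
    S.frameBracket (fun _ => (u, α)) (fun _ => (v, β)) p =
      (L.lieAct α v - L.lieAct β u - S.torsion p u v, lieBr G α β - S.curvature p u v) := by
  have hsplit (u : Euc n) (α : Euc k) : (fun _ : P => (u, α)) =
      (fun _ => (u, (0 : Euc k))) + fun _ => ((0 : Euc n), α) := by
    funext p; simp
  have hc (w : Euc n × Euc k) : ContMDiff (𝓡 (n + k)) 𝓘(ℝ, Euc n × Euc k) ∞ (fun _ : P => w) :=
    contMDiff_const
  rw [hsplit u α, hsplit v β, S.frameBracket_add_left (hc _) (hc _),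
    S.frameBracket_add_right (hc _) (hc _), S.frameBracket_add_right (hc _) (hc _)]
  have h := congrFun (S.frameBracket_swap (s := fun _ => (u, 0)) (t := fun _ => (0, β))) p
  simp only [Pi.add_apply, Pi.neg_apply] at h ⊢
  rw [h, S.frameBracket_horizontal, S.frameBracket_vertical, S.frameBracket_vertical_horizontal,
    S.frameBracket_vertical_horizontal]
  refine Prod.ext ?_ ?_
  · simp; abel
  · simp; abel

end GStructureWithConnection

/-! ### The coframe field, torsion, curvature and infinitesimal action on X. -/

namespace GStructureWithConnection

variable {n k : ℕ} {G : Type*} [TopologicalSpace G] [ChartedSpace (Euc k) G] [Group G]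
  {L : ClosedLinearGroup n k G} {P : Type*} [TopologicalSpace P]
  [ChartedSpace (Euc (n + k)) P] [IsManifold (𝓡 (n + k)) ∞ P] {S : GStructureWithConnection L P}
  {d : ℕ} [ChartedSpace (Euc d) S.ClassifyingSpace]

/-- Up to sign, torsion is a component of the bracket of two constant horizontal frame fields. -/
theorem isInvariantMap_torsion (u v : Euc n) : S.IsInvariantMap fun p => S.torsion p u v := by
  have h := ((isInvariantMap_const (S := S) (u, (0 : Euc k))).frameBracket
    (isInvariantMap_const (S := S) (v, (0 : Euc k)))).clm_comp
      (-ContinuousLinearMap.fst ℝ (Euc n) (Euc k))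
  simpa [S.frameBracket_horizontal] using h

theorem isInvariantMap_curvature (u v : Euc n) :
    S.IsInvariantMap fun p => S.curvature p u v := by
  have h := ((isInvariantMap_const (S := S) (u, (0 : Euc k))).frameBracket
    (isInvariantMap_const (S := S) (v, (0 : Euc k)))).clm_comp
      (-ContinuousLinearMap.snd ℝ (Euc n) (Euc k))
  simpa [S.frameBracket_horizontal] using h

theorem alternating_descend_ext {V W : Type*} [NormedAddCommGroup V] [NormedSpace ℝ V]
    [NormedAddCommGroup W] [NormedSpace ℝ W] {T T' : S.ClassifyingSpace → V [⋀^Fin 2]→L[ℝ] W}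
    (h : ∀ p u v, T (S.classifyingMap p) ![u, v] = T' (S.classifyingMap p) ![u, v]) : T = T' := by
  funext x
  obtain ⟨p, rfl⟩ := S.classifyingMap_surjective x
  ext v
  have hv : v = ![v 0, v 1] := by
    funext i; fin_cases i <;> rfl
  rw [hv]
  exact h p _ _

theorem frame_add_left (p : P) (u u' : Euc n) :
    S.frame p (u + u', 0) = S.frame p (u, 0) + S.frame p (u', 0) := by
  rw [← map_add]; simp

theorem frame_smul_left (p : P) (c : ℝ) (u : Euc n) :
    S.frame p (c • u, 0) = c • S.frame p (u, 0) := by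
  rw [← map_smul]; simp

theorem existsUnique_isInducedTorsion
    (hs : Manifold.IsSubmersion (𝓡 (n + k)) (𝓡 d) ∞ S.classifyingMap) :
    ∃! T, S.IsInducedTorsion d T := by
  obtain ⟨T, hT, h⟩ := exists_contMDiff_descend_alternating hs (b := S.torsion)
    (fun p u u' v => by simp only [torsion, frame_add_left, extDerivOneForm_add_left])
    (fun p c u v => by simp only [torsion, frame_smul_left, extDerivOneForm_smul_left])
    (fun p u v => extDerivOneForm_swap _ _ _ _) isInvariantMap_torsion
  exact ⟨T, ⟨hT, h⟩, fun T' hT' => alternating_descend_ext fun p u v =>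
    (hT'.apply p u v).trans (h p u v).symm⟩

theorem existsUnique_isInducedCurvature
    (hs : Manifold.IsSubmersion (𝓡 (n + k)) (𝓡 d) ∞ S.classifyingMap) :
    ∃! R, S.IsInducedCurvature d R := by
  obtain ⟨R, hR, h⟩ := exists_contMDiff_descend_alternating hs (b := S.curvature)
    (fun p u u' v => by simp only [curvature, frame_add_left, extDerivOneForm_add_left])
    (fun p c u v => by simp only [curvature, frame_smul_left, extDerivOneForm_smul_left])
    (fun p u v => extDerivOneForm_swap _ _ _ _) isInvariantMap_curvature
  exact ⟨R, ⟨hR, h⟩, fun R' hR' => alternating_descend_ext fun p u v =>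
    (hR'.apply p u v).trans (h p u v).symm⟩

/-- Since [p]g = h(pg), the chain rule gives dh of the generator of α, and the generator is frame(0,
α). -/
theorem infAct_classifyingMap [LieGroup (𝓡 k) ∞ G]
    (hs : Manifold.IsSubmersion (𝓡 (n + k)) (𝓡 d) ∞ S.classifyingMap) (p : P) (α : Euc k) :
    S.infAct (S.classifyingMap p) α = S.anchorMap d (S.classifyingMap p) (0, α) := by
  rw [anchorMap_classifyingMap hs, S.frame_vertical]
  have h := mfderiv_comp (I := 𝓡 k) (I' := 𝓡 (n + k)) (I'' := 𝓡 d) (1 : G)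
    (g := S.classifyingMap) (f := fun g : G => S.act p g)
    ((hs.contMDiff _).mdifferentiableAt (by simp))
    ((S.contMDiff_act_left p).contMDiffAt.mdifferentiableAt (by simp))
  have h2 : ∀ q, q = p → ∀ ξ : Euc (n + k),
      (show Euc d from mfderiv (𝓡 (n + k)) (𝓡 d) S.classifyingMap q ξ) =
        mfderiv (𝓡 (n + k)) (𝓡 d) S.classifyingMap p ξ := by
    rintro _ rfl _; rfl
  exact (congrArg (fun B => B α) h).trans (h2 _ (S.act_one p) _)

variable [IsManifold (𝓡 d) ∞ S.ClassifyingSpace]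

theorem isCoframeField_anchorMap
    (hs : Manifold.IsSubmersion (𝓡 (n + k)) (𝓡 d) ∞ S.classifyingMap) :
    S.IsCoframeField d fun x =>
      (S.anchorMap d x).comp (ContinuousLinearMap.inl ℝ (Euc n) (Euc k)) where
  smooth := contMDiff_linear_family
    (ρ := fun x => (S.anchorMap d x).comp (ContinuousLinearMap.inl ℝ (Euc n) (Euc k)))
    fun u x => smoothFieldAt_anchorMap hs (u, 0) x
  deriv_eq f p u := lieDeriv_anchorMap hs f.contMDiff p (u, 0)

theorem IsCoframeField.unique (hS : S.IsFullyRegular d)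
    {F F' : (x : S.ClassifyingSpace) → Euc n →L[ℝ] TangentSpace (𝓡 d) x}
    (hF : S.IsCoframeField d F) (hF' : S.IsCoframeField d F')
    (hs : Manifold.IsSubmersion (𝓡 (n + k)) (𝓡 d) ∞ S.classifyingMap) : F = F' := by
  funext x
  obtain ⟨p, rfl⟩ := S.classifyingMap_surjective x
  exact ContinuousLinearMap.ext fun u => tangentSpace_ext hS hs fun f =>
    (hF.deriv_eq f p u).trans (hF'.deriv_eq f p u).symm

end GStructureWithConnection

end

/-! ### The main theorem. -/

theorem mainTheorem1 {n k d : ℕ} {G : Type*} [TopologicalSpace G] [ChartedSpace (Euc k) G]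
    [Group G] [LieGroup (𝓡 k) ∞ G] (L : ClosedLinearGroup n k G)
    {P : Type*} [TopologicalSpace P] [T2Space P] [SecondCountableTopology P]
    [ChartedSpace (Euc (n + k)) P] [IsManifold (𝓡 (n + k)) ∞ P]
    (S : GStructureWithConnection L P) (hS : S.IsFullyRegular d) :
    (∃ (_ : ChartedSpace (Euc d) S.ClassifyingSpace)
        (_ : IsManifold (𝓡 d) ∞ S.ClassifyingSpace),
      Manifold.IsSubmersion (𝓡 (n + k)) (𝓡 d) ∞ S.classifyingMap) ∧
    ∀ (_ : ChartedSpace (Euc d) S.ClassifyingSpace)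
      (_ : IsManifold (𝓡 d) ∞ S.ClassifyingSpace),
      Manifold.IsSubmersion (𝓡 (n + k)) (𝓡 d) ∞ S.classifyingMap →
      (∃! F, S.IsCoframeField d F) ∧
      (∃! T, S.IsInducedTorsion d T) ∧
      (∃! R, S.IsInducedCurvature d R) ∧
      (∃! A, S.IsClassifyingAlgebroid d A) ∧
      ∀ F T R A, S.IsCoframeField d F → S.IsInducedTorsion d T → S.IsInducedCurvature d R →
        S.IsClassifyingAlgebroid d A →
        (∀ (x : S.ClassifyingSpace) (u : Euc n) (α : Euc k),
          A.anchor x (u, α) = F x u + S.infAct x α) ∧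
        ∀ (u v : Euc n) (α β : Euc k) (x : S.ClassifyingSpace),
          A.bracket (S.constSection d u α) (S.constSection d v β) x =
            (L.lieAct α v - L.lieAct β u - T x ![u, v], lieBr G α β - R x ![u, v]) := by
  refine ⟨⟨GStructureWithConnection.chartedSpaceClassifyingSpace hS,
    GStructureWithConnection.isManifold_classifyingSpace hS,
    GStructureWithConnection.isSubmersion_classifyingMap hS⟩, fun _ _ hs => ?_⟩
  refine ⟨⟨_, GStructureWithConnection.isCoframeField_anchorMap hs, fun F hF =>
      hF.unique hS (GStructureWithConnection.isCoframeField_anchorMap hs) hs⟩,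
    GStructureWithConnection.existsUnique_isInducedTorsion hs,
    GStructureWithConnection.existsUnique_isInducedCurvature hs,
    ⟨_, GStructureWithConnection.isClassifyingAlgebroid_classifyingAlgebroid hs, fun A hA =>
      GStructureWithConnection.isClassifyingAlgebroid_unique hS hs hA
        (GStructureWithConnection.isClassifyingAlgebroid_classifyingAlgebroid hs)⟩, ?_⟩
  intro F T R A hF hT hR hA
  -- By uniqueness, F and A are the constructed ones; T and R enter only through their values along
  -- h.
  obtain rfl := hF.unique hS (GStructureWithConnection.isCoframeField_anchorMap hs) hs
  obtain rfl := GStructureWithConnection.isClassifyingAlgebroid_unique hS hs hA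
    (GStructureWithConnection.isClassifyingAlgebroid_classifyingAlgebroid hs)
  refine ⟨fun x u α => ?_, fun u v α β x => ?_⟩
  · obtain ⟨p, rfl⟩ := S.classifyingMap_surjective x
    rw [GStructureWithConnection.infAct_classifyingMap hs]
    have h : ((u, α) : Euc n × Euc k) = (u, 0) + (0, α) := by simp
    exact (congrArg (S.anchorMap d (S.classifyingMap p)) h).trans (map_add _ _ _)
  · obtain ⟨p, rfl⟩ := S.classifyingMap_surjective x
    rw [hT.apply, hR.apply]
    exact S.frameBracket_const u v α β p
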